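/- All manifolds and vector bundles are smooth, real and finite-dimensional (manifolds are Hausdorff, second countable and without boundary). A Lie algebroid is a vector bundle $B\to N$ with an $\mathbb R$-Lie bracket on $\Gamma(B)$ and a vector bundle morphism $\rho_B\colon B\to TN$ over $\mathrm{id}_N$ (the anchor) such that $[a,hb]=h[a,b]+\rho_B(a)(h)\,b$ for $a,b\in\Gamma(B)$, $h\in C^\infty(N)$. For a smooth map $f\colon P\to N$ set $$f^{!!}B=\{(v,b)\in TP\times B\mid Tf(v)=\rho_B(b)\}.$$ The pullback Lie algebroid $f^{!!}B\to P$ exists if the fibres of $f^{!!}B$ over $P$ have constant dimension. Then $f^{!!}B$ is a smooth subbundle of $TP\oplus f^!B$, with anchor $(v,b)\mapsto v$ and bracket $$\Bigl[\bigl(X,\textstyle\sum_i h_i f^!b_i\bigr),\bigl(Y,\sum_j g_j f^!c_j\bigr)\Bigr]=\Bigl([X,Y],\ \textstyle\sum_{i,j}h_ig_j f^![b_i,c_j]+\sum_j X(g_j)f^!c_j-\sum_i Y(h_i)f^!b_i\Bigr).$$ **Proposition 3.15.** Let $B\to N$ be a Lie algebroid, $M$ a manifold, $I\subseteq\mathbb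 R$ an open interval and $\varphi\colon I\times M\to N$ a smooth map such that $\varphi^{!!}B$ exists; write $\varphi_t=\varphi(t,\cdot)$. Suppose that $\varphi^{!!}B$ has a smooth section of the form $\tilde y\colon(s,m)\mapsto(\partial_t|_s,0_m,y(s,m))$. Then for every $t\in I$ the pullback $\varphi_t^{!!}B\to M$ exists, and for all $s,t\in I$ there is an isomorphism of Lie algebroids $\Psi_{s,t}\colon\varphi_s^{!!}B\to\varphi_t^{!!}B$ over $\mathrm{id}_M$. These isomorphisms are given by the flow of the linear vector field $\widehat D$ on the total space of $\varphi^{!!}B$ that corresponds to the derivation $D=[\tilde y,\cdot]$ of $\Gamma(\varphi^{!!}B)$, i.e. of $$\widehat D(e(p))=T_pe\,(\partial_t|_p)+\left.\tfrac{d}{dr}\right|_{r=0}\bigl(e(p)-r\,D(e)(p)\bigr)\qquad(e\in\Gamma(\varphi^{!!}B),\ p\in I\times M):$$ with $\varphi_s^{!!}B$ embedded in $\varphi^{!!}B$ by $(v,b)\mapsto(0_s,v,b)$, the integral curve of $\widehat D$ that starts at $e\in\varphi_s^{!!}B$ is defined on $\{r\in\mathbb R\mid s+r\in I\}$, and its value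 at time $t-s$ is $\Psi_{s,t}(e)\in\varphi_t^{!!}B$. -/

import Mathlib

open Bundle Filter TopologicalSpace
open scoped Manifold ContDiff Topology

noncomputable section

set_option linter.unusedSectionVars false

/-- The product `h • b` of a smooth function and a smooth section of a vector bundle. -/
def ContMDiffSection.funSMul
    {E : Type*} [NormedAddCommGroup E] [NormedSpace ℝ E]
    {H : Type*} [TopologicalSpace H] {I : ModelWithCorners ℝ E H}
    {N : Type*} [TopologicalSpace N] [ChartedSpace H N]
    {F : Type*} [NormedAddCommGroup F] [NormedSpace ℝ F]
    {V : N → Type*} [TopologicalSpace (TotalSpace F V)]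
    [∀ x, AddCommGroup (V x)] [∀ x, Module ℝ (V x)] [∀ x, TopologicalSpace (V x)]
    [FiberBundle F V] [VectorBundle ℝ F V]
    (h : C^∞⟮I, N; ℝ⟯) (b : Cₛ^∞⟮I; F, V⟯) : Cₛ^∞⟮I; F, V⟯ :=
  ⟨(h : N → ℝ) • (b : ∀ x, V x), h.contMDiff.smul_section b.contMDiff⟩

/-- A Lie algebroid: a smooth vector bundle `V → N` (with model fibre `F`), an `ℝ`-Lie algebra
bracket on the space of its global smooth sections, and a smooth vector bundle morphism `V → TN`
over the identity, the anchor, which are related by the Leibniz rule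
`[a, h • b] = h • [a, b] + ρ(a)(h) • b`. -/
structure LieAlgebroid
    {E : Type*} [NormedAddCommGroup E] [NormedSpace ℝ E]
    {H : Type*} [TopologicalSpace H] (I : ModelWithCorners ℝ E H)
    {N : Type*} [TopologicalSpace N] [ChartedSpace H N] [IsManifold I ∞ N]
    (F : Type*) [NormedAddCommGroup F] [NormedSpace ℝ F]
    (V : N → Type*) [TopologicalSpace (TotalSpace F V)]
    [∀ x, AddCommGroup (V x)] [∀ x, Module ℝ (V x)] [∀ x, TopologicalSpace (V x)]
    [FiberBundle F V] [VectorBundle ℝ F V] [ContMDiffVectorBundle ∞ F V I] where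
  /-- the bracket of smooth sections -/
  bracket : Cₛ^∞⟮I; F, V⟯ →ₗ[ℝ] Cₛ^∞⟮I; F, V⟯ →ₗ[ℝ] Cₛ^∞⟮I; F, V⟯
  bracket_self : ∀ a, bracket a a = 0
  jacobi : ∀ a b c, bracket a (bracket b c) = bracket (bracket a b) c + bracket b (bracket a c)
  /-- the anchor -/
  anchor : ∀ x : N, V x →ₗ[ℝ] TangentSpace I x
  contMDiff_anchor : ContMDiff (I.prod 𝓘(ℝ, F)) I.tangent ∞
    (fun b : TotalSpace F V ↦ (⟨b.proj, anchor b.proj b.2⟩ : TangentBundle I N))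
  leibniz : ∀ (a b : Cₛ^∞⟮I; F, V⟯) (h : C^∞⟮I, N; ℝ⟯) (x : N),
    bracket a (ContMDiffSection.funSMul h b) x =
      h x • bracket a b x + mvfderiv I h x (anchor x (a x)) • b x

namespace LieAlgebroid

section Pullback

variable {E : Type*} [NormedAddCommGroup E] [NormedSpace ℝ E]
  {H : Type*} [TopologicalSpace H] {I : ModelWithCorners ℝ E H}
  {N : Type*} [TopologicalSpace N] [ChartedSpace H N] [IsManifold I ∞ N]
  {F : Type*} [NormedAddCommGroup F] [NormedSpace ℝ F]
  {V : N → Type*} [TopologicalSpace (TotalSpace F V)]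
  [∀ x, AddCommGroup (V x)] [∀ x, Module ℝ (V x)] [∀ x, TopologicalSpace (V x)]
  [FiberBundle F V] [VectorBundle ℝ F V] [ContMDiffVectorBundle ∞ F V I]
  (B : LieAlgebroid I F V)
  {EP : Type*} [NormedAddCommGroup EP] [NormedSpace ℝ EP]
  {HP : Type*} [TopologicalSpace HP] (IP : ModelWithCorners ℝ EP HP)
  {P : Type*} [TopologicalSpace P] [ChartedSpace HP P] [IsManifold IP ∞ P]

/-- The anchor as a map between total spaces. -/
def anchorMap (b : TotalSpace F V) : TangentBundle I N :=
  ⟨b.proj, B.anchor b.proj b.2⟩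

/-- The total space `f^{!!}B = {(v, b) ∈ TP × B | Tf(v) = ρ(b)}`, inside the manifold `TP × B`. -/
def pullbackTotal (f : P → N) : Set (TangentBundle IP P × TotalSpace F V) :=
  {q | tangentMap IP I f q.1 = B.anchorMap q.2}

/-- The fibre of `f^{!!}B` over `x`: all `(v, b) ∈ T_xP × B_{f(x)}` with `T_xf(v) = ρ(b)`. -/
def pullbackFiber (f : P → N) (x : P) : Submodule ℝ (TangentSpace IP x × V (f x)) :=
  LinearMap.eqLocus
    ((mfderiv IP I f x).toLinearMap ∘ₗ LinearMap.fst ℝ (TangentSpace IP x) (V (f x)))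
    (B.anchor (f x) ∘ₗ LinearMap.snd ℝ (TangentSpace IP x) (V (f x)))

/-- The pullback Lie algebroid `f^{!!}B` exists: its fibres have constant dimension. (Then it is a
smooth vector subbundle of `TP ⊕ f^!B`, since it is the kernel of a smooth morphism of vector
bundles.) -/
def HasPullback (f : P → N) : Prop :=
  ∃ r : ℕ, ∀ x, Module.finrank ℝ (B.pullbackFiber IP f x) = r

/-- A pair `(v, b) ∈ T_xP × B_{f(x)}`, seen as a point of the manifold `TP × B`. -/
def toProd (F : Type*) {V : N → Type*} {IP : ModelWithCorners ℝ EP HP} (f : P → N) {x : P}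
    (e : TangentSpace IP x × V (f x)) : TangentBundle IP P × TotalSpace F V :=
  (⟨x, e.1⟩, ⟨f x, e.2⟩)

/-- A smooth section of `f^{!!}B`. -/
structure PullbackSection (f : P → N) where
  toFun : ∀ x, B.pullbackFiber IP f x
  contMDiff_toFun : ContMDiff IP (IP.tangent.prod (I.prod 𝓘(ℝ, F))) ∞
    (fun x ↦ toProd F f (toFun x).1)

variable {IP} {B}

/-- The component in `TP` of a section of `f^{!!}B`. This is its image under the anchor
`f^{!!}B → TP`, `(v, b) ↦ v`. -/
def PullbackSection.fst {f : P → N} (σ : B.PullbackSection IP f) (x : P) : TangentSpace IP x :=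
  (σ.toFun x).1.1

/-- The component in `f^!B` of a section of `f^{!!}B`. -/
def PullbackSection.snd {f : P → N} (σ : B.PullbackSection IP f) (x : P) : V (f x) :=
  (σ.toFun x).1.2

/-- Near `x`, the second component of `σ` is `∑ i, h i • f^!(b i)`, with functions `h i` on `P` that
are smooth at `x` and smooth sections `b i` of `B`. -/
def PullbackSection.IsDecomposition {f : P → N} (σ : B.PullbackSection IP f) (x : P)
    {n : ℕ} (h : Fin n → P → ℝ) (b : Fin n → Cₛ^∞⟮I; F, V⟯) : Prop :=
  (∀ i, ContMDiffAt IP 𝓘(ℝ, ℝ) ∞ (h i) x) ∧ ∀ᶠ z in 𝓝 x, σ.snd z = ∑ i, h i z • b i (f z)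

/-- Decompositions exist around every point. -/
theorem PullbackSection.exists_isDecomposition [FiniteDimensional ℝ E] [FiniteDimensional ℝ F]
    [T2Space N] {f : P → N} (σ : B.PullbackSection IP f) (x : P) :
    ∃ (n : ℕ) (h : Fin n → P → ℝ) (b : Fin n → Cₛ^∞⟮I; F, V⟯), σ.IsDecomposition x h b := by
  let t := trivializationAt F V (f x)
  let β := Module.finBasis ℝ F
  have hx : f x ∈ t.baseSet := mem_baseSet_trivializationAt F V (f x)
  obtain ⟨ψ, -, hψ⟩ := (SmoothBumpFunction.nhds_basis_tsupport (I := I) (f x)).mem_iff.1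
    (t.open_baseSet.mem_nhds hx)
  have hσ : ContMDiffAt IP (I.prod 𝓘(ℝ, F)) ∞ (fun z ↦ (⟨f z, σ.snd z⟩ : TotalSpace F V)) x :=
    (contMDiff_snd.comp σ.contMDiff_toFun) x
  have hf : ContinuousAt f x := (contMDiffAt_totalSpace.1 hσ).1.continuousAt
  refine ⟨_, fun i z ↦ β.coord i (t ⟨f z, σ.snd z⟩).2,
    fun i ↦ ⟨(ψ : N → ℝ) • t.localFrame β i,
      ContMDiffOn.smul_section_of_tsupport ψ.contMDiff.contMDiffOn t.open_baseSet hψ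
        (t.contMDiffOn_localFrame_baseSet ∞ β i)⟩, fun i ↦ ?_, ?_⟩
  · have h2 := (contMDiffAt_totalSpace.1 hσ).2
    exact ((β.coord i).toContinuousLinearMap.contMDiff.contMDiffAt).comp x h2
  · filter_upwards [hf.eventually (t.open_baseSet.mem_nhds hx), hf.eventually ψ.eventuallyEq_one]
      with z hz hz1
    have key : σ.snd z = ∑ i, (t.basisAt β hz).repr (σ.snd z) i • t.basisAt β hz i :=
      ((t.basisAt β hz).sum_repr _).symm
    rw [key]
    refine Finset.sum_congr rfl fun i _ ↦ ?_
    have h1 : ψ (f z) = 1 := hz1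
    have h2 : (t.basisAt β hz).repr (σ.snd z) i = β.coord i (t ⟨f z, σ.snd z⟩).2 := by
      simp [Trivialization.basisAt]
    rw [← key, h2]
    simp [h1, t.localFrame_apply_of_mem_baseSet β hz]

/-- The section `υ` is the bracket of the sections `σ` and `τ` of `f^{!!}B`. For
`σ = (X, ∑ i, h i • f^!(b i))` and `τ = (Y, ∑ j, g j • f^!(c j))` the bracket is
`([X, Y], ∑ i j, h i * g j • f^![b i, c j] + ∑ j, X(g j) • f^!(c j) - ∑ i, Y(h i) • f^!(b i))`. -/
def IsPullbackBracket {f : P → N} (σ τ υ : B.PullbackSection IP f) : Prop :=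
  ∀ x, υ.fst x = VectorField.mlieBracket IP σ.fst τ.fst x ∧
    ∀ (n m : ℕ) (h : Fin n → P → ℝ) (b : Fin n → Cₛ^∞⟮I; F, V⟯)
      (g : Fin m → P → ℝ) (c : Fin m → Cₛ^∞⟮I; F, V⟯),
      σ.IsDecomposition x h b → τ.IsDecomposition x g c →
      υ.snd x = ∑ i, ∑ j, (h i x * g j x) • B.bracket (b i) (c j) (f x)
        + ∑ j, mvfderiv IP (g j) x (σ.fst x) • c j (f x)
        - ∑ i, mvfderiv IP (h i) x (τ.fst x) • b i (f x)

/-- A family of maps between the fibres of `f^{!!}B` and `g^{!!}B` over the identity of `P` is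
smooth as a map between the total spaces. (These are embedded in `TP × B`.) -/
def IsSmoothFamily {f g : P → N}
    (Φ : ∀ x, B.pullbackFiber IP f x → B.pullbackFiber IP g x) : Prop :=
  ∃ G : TangentBundle IP P × TotalSpace F V → TangentBundle IP P × TotalSpace F V,
    ContMDiffOn (IP.tangent.prod (I.prod 𝓘(ℝ, F))) (IP.tangent.prod (I.prod 𝓘(ℝ, F))) ∞ G
      (B.pullbackTotal IP f) ∧
    ∀ x (e : B.pullbackFiber IP f x), G (toProd F f e.1) = toProd F g (Φ x e).1

theorem toProd_mem {f : P → N} {x : P} (e : B.pullbackFiber IP f x) :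
    toProd F f e.1 ∈ B.pullbackTotal IP f := by
  have h : mfderiv IP I f x e.1.1 = B.anchor (f x) e.1.2 := e.2
  simp only [pullbackTotal, Set.mem_ofPred_eq, tangentMap, anchorMap, toProd]
  rw [h]

/-- The section `x ↦ Φ_x(σ(x))`. -/
def PullbackSection.map {f g : P → N} (σ : B.PullbackSection IP f)
    (Φ : ∀ x, B.pullbackFiber IP f x → B.pullbackFiber IP g x) (hΦ : IsSmoothFamily Φ) :
    B.PullbackSection IP g where
  toFun x := Φ x (σ.toFun x)
  contMDiff_toFun := by
    obtain ⟨G, hG, hGΦ⟩ := hΦ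
    simp only [← hGΦ]
    exact hG.comp_contMDiff σ.contMDiff_toFun (fun x ↦ toProd_mem _)

variable (IP) (B)

/-- An isomorphism of Lie algebroids over the identity of `P` from `f^{!!}B` to `g^{!!}B`: an
isomorphism of smooth vector bundles that respects the anchors and the brackets. -/
structure PullbackIso (f g : P → N) where
  toEquiv : ∀ x, B.pullbackFiber IP f x ≃ₗ[ℝ] B.pullbackFiber IP g x
  smooth : IsSmoothFamily (fun x ↦ toEquiv x)
  smooth_symm : IsSmoothFamily (fun x ↦ (toEquiv x).symm)
  /-- the anchor of `(v, b)` is `v` -/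
  anchor_eq : ∀ x e, (toEquiv x e).1.1 = e.1.1
  /-- any two sections have a bracket, and it is sent to the bracket of their images -/
  map_bracket : ∀ σ τ : B.PullbackSection IP f, ∃ υ : B.PullbackSection IP f,
    IsPullbackBracket σ τ υ ∧
    IsPullbackBracket (σ.map _ smooth) (τ.map _ smooth) (υ.map _ smooth)

variable {IP} {B}

/-- The vertical tangent vector `d/dr|_{r=0} (e + r • d)` at `e`, for `e` and `d` in the same fibre
of `f^{!!}B`. It is given as a tangent vector of the manifold `TP × B`, in which the total space of
`f^{!!}B` is embedded. -/
def verticalLift {f : P → N} {x : P} (e d : B.pullbackFiber IP f x) :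
    TangentSpace (IP.tangent.prod (I.prod 𝓘(ℝ, F))) (toProd F f e.1) :=
  id (mfderiv 𝓘(ℝ, ℝ) (IP.tangent.prod (I.prod 𝓘(ℝ, F)))
    (fun r : ℝ ↦ toProd F f (e + r • d).1) 0 (1 : ℝ) : (EP × EP) × (E × F))

/-- The vector field `χ` on the total space of `f^{!!}B` is the linear vector field of the
derivation `D` of the sections of `f^{!!}B` with symbol `X`:
`χ(e(x)) = T_xe(X(x)) + d/dr|_{r=0} (e(x) - r • D(e)(x))` for all smooth sections `e`.
Tangent vectors of the total space are seen as tangent vectors of the manifold `TP × B`, so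
only the values of `χ` at the points of `f^{!!}B` matter. -/
def IsLinearVectorField {f : P → N} (D : B.PullbackSection IP f → B.PullbackSection IP f)
    (X : ∀ x : P, TangentSpace IP x)
    (χ : ∀ q : TangentBundle IP P × TotalSpace F V,
      TangentSpace (IP.tangent.prod (I.prod 𝓘(ℝ, F))) q) : Prop :=
  ∀ (e : B.PullbackSection IP f) (x : P),
    χ (toProd F f (e.toFun x).1) =
      mfderiv IP (IP.tangent.prod (I.prod 𝓘(ℝ, F))) (fun z ↦ toProd F f (e.toFun z).1) x (X x) +
      verticalLift (e.toFun x) (-(D e).toFun x)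

end Pullback

end LieAlgebroid

end

/-!
Let `y = (∂/∂t, y)` be the given section of `φ^{!!}B`. The derivation `[y, ·]` is a differential
equation along the curves `t ↦ (t, m)`: in a frame of `B` near `φ (t, m)`, with structure functions
`c = structureMap`, a curve `(0, w, b t)` of elements of `φ_t^{!!}B` over `m` satisfies
`[y, (w, b)] = 0` if
`d/dt b = (derivative of y in the direction w) - c (y, b)`
(`SolvesFlatEquation`). This equation is linear in `(w, b)`, it does not depend on the frame
(`SolvesFlatEquation.isFlatAt`), and it preserves the condition `Tφ_t(w) = ρ(b)`
(`SolvesFlatEquation.isFlatAt_of_initial`); both facts are consequences of the Leibniz rule and of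
the compatibility of the anchor with the brackets.

Linearity yields solutions on the whole interval. They are glued from local ones by
`exists_global_solution`, a connectedness argument. For the smooth dependence of the solutions on
parameters, a local fundamental solution is obtained from the Volterra integral equation: it is the
image of the coefficient under the inversion of operators on a Banach space of continuous curves,
hence smooth (`exists_smooth_fundamental_solution`). Parallel transport along flat curves is thus a
smooth family of linear isomorphisms `φ_s^{!!}B → φ_t^{!!}B` over the identity of `M`.

It is compatible with the brackets because the bracket of two flat sections is flat, which is the
Jacobi identity in a frame (`structureMap_jacobi`, `IsFlatSection.bracket`): the flat extension of
`[σ, τ]` is the bracket of the flat extensions of `σ` and `τ`.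

Every element of `φ^{!!}B` is the sum of a multiple of `y` and an element of some `φ_t^{!!}B`. This
gives the ranks of the slices. Since `y` is flat as well, it also gives the flow of the linear vector
field of `[y, ·]` (`flowCurve`), and this vector field is defined as the velocity of the flow. Its
defining equation is then checked in the components of the manifold `TP × B`
(`mfderiv_tangentBundle_prod_totalSpace`).
-/


noncomputable section

set_option linter.unusedSectionVars false

/-! ### Linear differential equations with parameters -/

section ParametricODE

open Set

universe u v

/-- The continuous curve `τ ↦ f (p, τ)` on `[0, 1]`. -/
def curryUnitInterval {P G : Type*} [NormedAddCommGroup P] [NormedAddCommGroup G]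
    (f : P × ℝ → G) (hf : Continuous f) (p : P) : C(Icc (0 : ℝ) 1, G) :=
  ⟨fun τ ↦ f (p, τ), hf.comp (by fun_prop)⟩

theorem continuous_curryUnitInterval {P G : Type*} [NormedAddCommGroup P] [NormedAddCommGroup G]
    (f : P × ℝ → G) (hf : Continuous f) : Continuous (curryUnitInterval f hf) :=
  (ContinuousMap.curry ⟨fun q : P × Icc (0 : ℝ) 1 ↦ f (q.1, q.2), hf.comp (by fun_prop)⟩).continuous

/-- A bilinear map `H × P → G` turns a curve in `H` and a vector in `P` into a curve in `G`. -/
def ContinuousMap.bilinCLM {K H P G : Type*} [TopologicalSpace K] [CompactSpace K]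
    [NormedAddCommGroup H] [NormedSpace ℝ H]
    [NormedAddCommGroup P] [NormedSpace ℝ P] [NormedAddCommGroup G] [NormedSpace ℝ G]
    (L : H →L[ℝ] P →L[ℝ] G) : C(K, H) →L[ℝ] P →L[ℝ] C(K, G) :=
  LinearMap.mkContinuous₂
    (LinearMap.mk₂ ℝ (fun (h : C(K, H)) (v : P) ↦
        (⟨fun τ ↦ L (h τ) v, by fun_prop⟩ : C(K, G)))
      (fun _ _ _ ↦ by ext; simp) (fun _ _ _ ↦ by ext; simp)
      (fun _ _ _ ↦ by ext; simp) (fun _ _ _ ↦ by ext; simp)) ‖L‖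
    (fun h v ↦ by
      refine (ContinuousMap.norm_le _ (by positivity)).2 fun τ ↦ ?_
      refine (L.le_opNorm₂ (h τ) v).trans ?_
      gcongr
      exact h.norm_coe_le_norm τ)

theorem ContDiff.bilinCLM {X K H P G : Type*} [TopologicalSpace K] [CompactSpace K]
    [NormedAddCommGroup X] [NormedSpace ℝ X] [NormedAddCommGroup H] [NormedSpace ℝ H]
    [NormedAddCommGroup P] [NormedSpace ℝ P] [NormedAddCommGroup G] [NormedSpace ℝ G]
    (L : H →L[ℝ] P →L[ℝ] G) {n : ℕ∞ω} {g : X → C(K, H)} (hg : ContDiff ℝ n g) :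
    ContDiff ℝ n (fun x ↦ ContinuousMap.bilinCLM L (g x)) := by
  have h : ContDiff ℝ n (fun h : C(K, H) ↦ ContinuousMap.bilinCLM L h) :=
    ContinuousLinearMap.contDiff _
  exact h.comp hg

theorem hasFDerivAt_curryUnitInterval {P H G : Type*}
    [NormedAddCommGroup P] [NormedSpace ℝ P] [NormedAddCommGroup G] [NormedSpace ℝ G]
    [NormedAddCommGroup H] [NormedSpace ℝ H] (L : H →L[ℝ] P →L[ℝ] G)
    (f : P × ℝ → G) (hf : Continuous f) (f' : P × ℝ → H) (hf' : Continuous f')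
    (h : ∀ p τ, HasFDerivAt (fun q ↦ f (q, τ)) (L (f' (p, τ))) p) (p : P) :
    HasFDerivAt (curryUnitInterval f hf)
      (ContinuousMap.bilinCLM L (curryUnitInterval f' hf' p)) p := by
  rw [hasFDerivAt_iff_isLittleO, Asymptotics.isLittleO_iff]
  intro ε hε
  have hc := (continuous_curryUnitInterval f' hf').continuousAt (x := p)
  have hε' : 0 < ε / (‖L‖ + 1) := by positivity
  obtain ⟨δ, hδ, hball⟩ := Metric.mem_nhds_iff.1 (hc.preimage_mem_nhds
    (Metric.closedBall_mem_nhds (curryUnitInterval f' hf' p) hε'))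
  filter_upwards [Metric.ball_mem_nhds p hδ] with q hq
  refine (ContinuousMap.norm_le _ (by positivity)).2 fun τ ↦ ?_
  -- the mean value inequality, uniformly in `τ`
  change ‖f (q, τ) - f (p, τ) - L (f' (p, τ)) (q - p)‖ ≤ ε * ‖q - p‖
  refine Convex.norm_image_sub_le_of_norm_hasFDerivWithin_le' (s := Metric.ball p δ)
    (f := fun q ↦ f (q, τ)) (f' := fun q ↦ L (f' (q, τ))) (φ := L (f' (p, τ)))
    (fun x _ ↦ (h x τ).hasFDerivWithinAt) (fun x hx ↦ ?_) (convex_ball p δ)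
    (Metric.mem_ball_self hδ) hq
  have h1 : ‖curryUnitInterval f' hf' x - curryUnitInterval f' hf' p‖ ≤ ε / (‖L‖ + 1) := by
    rw [← dist_eq_norm]; exact hball hx
  have h2 : ‖f' (x, τ) - f' (p, τ)‖ ≤ ε / (‖L‖ + 1) := (ContinuousMap.norm_coe_le_norm
    (curryUnitInterval f' hf' x - curryUnitInterval f' hf' p) τ).trans h1
  rw [← map_sub]
  refine (L.le_opNorm_of_le h2).trans ?_
  rw [mul_div_assoc', div_le_iff₀ (by positivity)]
  nlinarith [norm_nonneg L]

set_option synthInstance.maxHeartbeats 100000 in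
/-- A smooth family of curves depends smoothly on its parameter, as a map into the Banach space of
continuous curves. -/
theorem contDiff_curryUnitInterval {P : Type u} [NormedAddCommGroup P] [NormedSpace ℝ P] (n : ℕ) :
    ∀ {G : Type (max u v)} [NormedAddCommGroup G] [NormedSpace ℝ G] (f : P × ℝ → G)
      (hf : ContDiff ℝ ∞ f), ContDiff ℝ n (curryUnitInterval f hf.continuous) := by
  induction n with
  | zero => intro G _ _ f hf; exact contDiff_zero.2 (continuous_curryUnitInterval f _)
  | succ n ih =>
    intro G _ _ f hf
    have hf' : ContDiff ℝ ∞ (fun q : P × ℝ ↦ (fderiv ℝ f q).comp (ContinuousLinearMap.inl ℝ P ℝ)) :=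
      (hf.fderiv_right (m := ∞) (by simp)).clm_comp contDiff_const
    refine contDiff_succ_iff_hasFDerivAt.2 ⟨fun p ↦ ContinuousMap.bilinCLM (.id ℝ (P →L[ℝ] G))
      (curryUnitInterval _ hf'.continuous p), ?_, fun p ↦ ?_⟩
    · exact ContDiff.bilinCLM (.id ℝ (P →L[ℝ] G)) (ih _ hf')
    · refine hasFDerivAt_curryUnitInterval (.id ℝ (P →L[ℝ] G)) f hf.continuous _ hf'.continuous
        (fun p τ ↦ ?_) p
      have h1 : HasFDerivAt f (fderiv ℝ f (p, τ)) (p, τ) :=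
        (hf.differentiable (by simp) _).hasFDerivAt
      exact h1.comp p (hasFDerivAt_prodMk_left p τ)

section Volterra

variable {𝒞 : Type*} [NormedRing 𝒞] [NormedAlgebra ℝ 𝒞] [CompleteSpace 𝒞] (V : 𝒞 →L[ℝ] 𝒞)

/-- The operator `x ↦ x - V (b x)` on a Banach algebra. -/
def volterraOp (b : 𝒞) : 𝒞 →L[ℝ] 𝒞 := 1 - V.comp (ContinuousLinearMap.mul ℝ 𝒞 b)

/-- The solution of the equation `x - V (b x) = 1`, if `x ↦ x - V (b x)` is invertible. -/
def volterraSol (b : 𝒞) : 𝒞 := Ring.inverse (volterraOp V b) 1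

theorem contDiff_volterraOp : ContDiff ℝ ∞ (volterraOp V) :=
  contDiff_const.sub (contDiff_const.clm_comp (ContinuousLinearMap.mul ℝ 𝒞).contDiff)

theorem isOpen_isUnit_volterraOp : IsOpen {b | IsUnit (volterraOp V b)} :=
  Units.isOpen.preimage (contDiff_volterraOp V).continuous

theorem volterraOp_zero : volterraOp V 0 = 1 := by simp [volterraOp]

theorem volterraSol_zero : volterraSol V 0 = 1 := by
  rw [volterraSol, volterraOp_zero, Ring.inverse_one]; rfl

variable {V} {b : 𝒞}

theorem contDiffAt_volterraSol (hb : IsUnit (volterraOp V b)) :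
    ContDiffAt ℝ ∞ (volterraSol V) b := by
  obtain ⟨x, hx⟩ := hb
  have h := contDiffAt_ringInverse ℝ (n := ∞) x
  rw [hx] at h
  exact (h.comp b (contDiff_volterraOp V).contDiffAt).clm_apply contDiffAt_const

theorem volterraSol_eq (hb : IsUnit (volterraOp V b)) :
    volterraSol V b = 1 + V (b * volterraSol V b) := by
  have h : (volterraOp V b * Ring.inverse (volterraOp V b)) 1 = 1 := by
    rw [Ring.mul_inverse_cancel _ hb]; rfl
  exact sub_eq_iff_eq_add.1 h

theorem eq_volterraSol (hb : IsUnit (volterraOp V b)) {x : 𝒞} (hx : x = 1 + V (b * x)) :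
    x = volterraSol V b := by
  have h : (Ring.inverse (volterraOp V b) * volterraOp V b) x = x := by
    rw [Ring.inverse_mul_cancel _ hb]; rfl
  have h1 : volterraOp V b x = 1 := sub_eq_iff_eq_add.2 hx
  rw [volterraSol, ← h1]
  exact h.symm

end Volterra

/-- The linear operator `x ↦ ∫_0^τ x` on curves over `[0, 1]`. -/
def integralCLM (G : Type*) [NormedAddCommGroup G] [NormedSpace ℝ G] :
    C(Icc (0 : ℝ) 1, G) →L[ℝ] C(Icc (0 : ℝ) 1, G) :=
  LinearMap.mkContinuous
    { toFun := fun x ↦ ⟨fun τ ↦ ∫ σ in (0 : ℝ)..τ, IccExtend zero_le_one x σ,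
        (intervalIntegral.continuous_primitive (fun a b ↦
          (x.continuous.Icc_extend').intervalIntegrable a b) 0).comp continuous_subtype_val⟩
      map_add' := fun x y ↦ by
        ext τ
        exact intervalIntegral.integral_add ((x.continuous.Icc_extend').intervalIntegrable _ _)
          ((y.continuous.Icc_extend').intervalIntegrable _ _)
      map_smul' := fun c x ↦ by
        ext τ
        exact intervalIntegral.integral_smul c _ } 1
    (fun x ↦ by
      refine (ContinuousMap.norm_le _ (by positivity)).2 fun τ ↦ ?_
      refine (intervalIntegral.norm_integral_le_of_norm_le_const (C := ‖x‖) fun σ _ ↦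
        x.norm_coe_le_norm _).trans ?_
      rw [one_mul, sub_zero, abs_of_nonneg τ.2.1]
      exact mul_le_of_le_one_right (norm_nonneg _) τ.2.2)

theorem ContDiffAt.continuousMap_eval {K X G : Type*} [TopologicalSpace K] [CompactSpace K]
    [NormedAddCommGroup X] [NormedSpace ℝ X] [NormedAddCommGroup G] [NormedSpace ℝ G]
    {n : ℕ∞ω} {g : X → C(K, G)} {x : X} (hg : ContDiffAt ℝ n g x) (k : K) :
    ContDiffAt ℝ n (fun z ↦ g z k) x :=
  (ContinuousMap.evalCLM ℝ k : C(K, G) →L[ℝ] G).contDiff.contDiffAt.comp x hg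

/-- Near any parameter, a linear differential equation `R' = A R` with smooth coefficients in a
Banach algebra has an invertible solution that is jointly smooth in the time and the parameter. -/
theorem exists_smooth_fundamental_solution {P : Type u} [NormedAddCommGroup P] [NormedSpace ℝ P]
    [FiniteDimensional ℝ P] {𝔸 : Type (max u v)} [NormedRing 𝔸] [NormedAlgebra ℝ 𝔸]
    [CompleteSpace 𝔸] (A : ℝ × P → 𝔸) (hA : ContDiff ℝ ∞ A) (t₀ : ℝ) (p₀ : P) :
    ∃ δ > 0, ∃ R : ℝ × P → 𝔸, ∀ t ∈ Metric.ball t₀ δ, ∀ p ∈ Metric.ball p₀ δ,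
      ContDiffAt ℝ ∞ R (t, p) ∧ IsUnit (R (t, p)) ∧
      HasDerivAt (fun r ↦ R (r, p)) (A (t, p) * R (t, p)) t := by
  -- rescaled to the unit interval, the equation has the coefficient `T • A (t₀ + T τ, p)`
  let f : (ℝ × P) × ℝ → 𝔸 := fun q ↦ q.1.1 • A (t₀ + q.1.1 * q.2, q.1.2)
  have hf : ContDiff ℝ ∞ f := by
    have : ContDiff ℝ ∞ (fun q : (ℝ × P) × ℝ ↦ (t₀ + q.1.1 * q.2, q.1.2)) := by fun_prop
    have h2 : ContDiff ℝ ∞ (fun q : (ℝ × P) × ℝ ↦ q.1.1) := by fun_prop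
    exact h2.smul (hA.comp this)
  let a : ℝ × P → C(Icc (0 : ℝ) 1, 𝔸) := curryUnitInterval f hf.continuous
  have ha : ContDiff ℝ ∞ a := contDiff_infty.2 fun n ↦ contDiff_curryUnitInterval.{u, v} n f hf
  let V := integralCLM 𝔸
  let U : Set (ℝ × P) := a ⁻¹' {b | IsUnit (volterraOp V b)}
  have hU : IsOpen U := (isOpen_isUnit_volterraOp V).preimage ha.continuous
  let sol : ℝ × P → C(Icc (0 : ℝ) 1, 𝔸) := fun q ↦ volterraSol V (a q)
  let R₀ : ℝ × P → 𝔸 := fun q ↦ sol q ⟨1, by simp⟩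
  have hR₀ : ∀ q ∈ U, ContDiffAt ℝ ∞ R₀ q := fun q hq ↦
    ContDiffAt.continuousMap_eval ((contDiffAt_volterraSol hq).comp q ha.contDiffAt) _
  have hV : ∀ (q : ℝ × P) (x : C(Icc (0 : ℝ) 1, 𝔸)) (τ : Icc (0 : ℝ) 1),
      V (a q * x) τ = ∫ σ in (0 : ℝ)..τ, f (q, σ) * IccExtend zero_le_one x σ := by
    intro q x τ
    refine intervalIntegral.integral_congr fun σ hσ ↦ ?_
    rw [uIcc_of_le τ.2.1] at hσ
    have hσ' : σ ∈ Icc (0 : ℝ) 1 := ⟨hσ.1, hσ.2.trans τ.2.2⟩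
    simp only [IccExtend_of_mem _ _ hσ']
    rfl
  have hsol : ∀ q ∈ U, ∀ τ : Icc (0 : ℝ) 1,
      sol q τ = 1 + ∫ σ in (0 : ℝ)..τ, f (q, σ) * IccExtend zero_le_one (sol q) σ :=
    fun q hq τ ↦ by
      rw [← hV]
      exact congrArg (fun x : C(Icc (0 : ℝ) 1, 𝔸) ↦ x τ) (volterraSol_eq hq)
  have huniq : ∀ q ∈ U, ∀ x : C(Icc (0 : ℝ) 1, 𝔸), (∀ τ : Icc (0 : ℝ) 1,
      x τ = 1 + ∫ σ in (0 : ℝ)..τ, f (q, σ) * IccExtend zero_le_one x σ) → x = sol q :=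
    fun q hq x hx ↦ eq_volterraSol hq (by ext τ; rw [hx τ, ← hV]; rfl)
  have ha0 : ∀ p, a (0, p) = 0 := fun p ↦ by ext τ; exact zero_smul ℝ _
  -- the operator stays invertible, and so does the solution, for short times
  have hR1 : R₀ (0, p₀) = 1 := by
    change volterraSol V (a (0, p₀)) _ = 1
    rw [ha0, volterraSol_zero]; rfl
  have hU0 : (0, p₀) ∈ U := by
    change IsUnit (volterraOp V (a (0, p₀)))
    rw [ha0, volterraOp_zero]; exact isUnit_one
  have hnhds : ∀ᶠ q in 𝓝 ((0 : ℝ), p₀), q ∈ U ∧ IsUnit (R₀ q) :=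
    Filter.Eventually.and (hU.mem_nhds hU0) ((hR₀ _ hU0).continuousAt.preimage_mem_nhds
      (Units.isOpen.mem_nhds (by rw [hR1]; exact isUnit_one)))
  obtain ⟨δ, hδ, hbox⟩ := Metric.eventually_nhds_iff_ball.1 hnhds
  rw [← ball_prod_same] at hbox
  have hscale : ∀ T ∈ Metric.ball (0 : ℝ) δ, ∀ p ∈ Metric.ball p₀ δ, ∀ θ : Icc (0 : ℝ) 1,
      sol (T, p) θ = R₀ (T * θ, p) := by
    intro T hT p hp θ
    have hT' : T * θ ∈ Metric.ball (0 : ℝ) δ := by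
      rw [mem_ball_zero_iff] at hT ⊢
      refine lt_of_le_of_lt ?_ hT
      rw [norm_mul, Real.norm_of_nonneg θ.2.1]
      exact mul_le_of_le_one_right (norm_nonneg _) θ.2.2
    let x : C(Icc (0 : ℝ) 1, 𝔸) := ⟨fun τ ↦ IccExtend zero_le_one (sol (T, p)) (θ * τ),
      ((sol (T, p)).continuous.Icc_extend').comp (by fun_prop)⟩
    have hmem : ∀ τ ∈ Icc (0 : ℝ) 1, (θ : ℝ) * τ ∈ Icc (0 : ℝ) 1 := fun τ hτ ↦
      ⟨mul_nonneg θ.2.1 hτ.1, mul_le_one₀ θ.2.2 hτ.1 hτ.2⟩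
    have hx : x = sol (T * θ, p) := by
      refine huniq _ (hbox (_, _) ⟨hT', hp⟩).1 x fun τ ↦ ?_
      have h1 : x τ = sol (T, p) ⟨θ * τ, hmem τ τ.2⟩ := IccExtend_of_mem _ _ (hmem τ τ.2)
      rw [h1, hsol _ (hbox (_, _) ⟨hT, hp⟩).1]
      congr 1
      have h2 := intervalIntegral.smul_integral_comp_mul_left (a := 0) (b := τ)
        (fun σ ↦ f ((T, p), σ) * IccExtend zero_le_one (sol (T, p)) σ) θ
      rw [mul_zero] at h2
      rw [← h2, ← intervalIntegral.integral_smul]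
      refine intervalIntegral.integral_congr fun σ hσ ↦ ?_
      rw [uIcc_of_le τ.2.1] at hσ
      have hσ' : σ ∈ Icc (0 : ℝ) 1 := ⟨hσ.1, hσ.2.trans τ.2.2⟩
      simp only [IccExtend_of_mem zero_le_one x hσ']
      change _ = f ((T * θ, p), σ) * IccExtend zero_le_one (sol (T, p)) (θ * σ)
      simp only [f, ← smul_mul_assoc, smul_smul, mul_assoc, mul_comm T (θ : ℝ)]
      congr 3
      ring_nf
    have h3 := congrArg (fun x : C(Icc (0 : ℝ) 1, 𝔸) ↦ x ⟨1, by simp⟩) hx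
    have h4 : IccExtend zero_le_one (sol (T, p)) ((θ : ℝ) * 1) = R₀ (T * θ, p) := h3
    rw [mul_one, IccExtend_of_mem _ _ θ.2] at h4
    exact h4
  have hint : ∀ T ∈ Metric.ball (0 : ℝ) δ, ∀ p ∈ Metric.ball p₀ δ,
      R₀ (T, p) = 1 + ∫ s in (0 : ℝ)..T, A (t₀ + s, p) * R₀ (s, p) := by
    intro T hT p hp
    have h1 := hsol _ (hbox (_, _) ⟨hT, hp⟩).1 ⟨1, by simp⟩
    change R₀ (T, p) = _ at h1
    rw [h1]
    congr 1
    have h2 := intervalIntegral.smul_integral_comp_mul_left (a := 0) (b := 1)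
        (fun s ↦ A (t₀ + s, p) * R₀ (s, p)) T
    rw [mul_zero, mul_one] at h2
    rw [← h2, ← intervalIntegral.integral_smul]
    refine intervalIntegral.integral_congr fun σ hσ ↦ ?_
    rw [uIcc_of_le zero_le_one] at hσ
    simp only [IccExtend_of_mem zero_le_one (sol (T, p)) hσ, hscale T hT p hp ⟨σ, hσ⟩, f,
      smul_mul_assoc]
  refine ⟨δ, hδ, fun q ↦ R₀ (q.1 - t₀, q.2), fun t ht p hp ↦ ?_⟩
  have ht' : t - t₀ ∈ Metric.ball (0 : ℝ) δ := by
    rw [mem_ball_zero_iff]; rwa [Metric.mem_ball, dist_eq_norm] at ht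
  have hu := hbox (t - t₀, p) ⟨ht', hp⟩
  refine ⟨(hR₀ _ hu.1).comp (t, p) (f := fun q : ℝ × P ↦ (q.1 - t₀, q.2)) (by fun_prop), hu.2, ?_⟩
  have hcont : ContinuousOn (fun s ↦ A (t₀ + s, p) * R₀ (s, p)) (Metric.ball 0 δ) := by
    intro s hs
    have h1 := (hR₀ (s, p) (hbox (s, p) ⟨hs, hp⟩).1).continuousAt
    have h2 : ContinuousAt (fun s ↦ R₀ (s, p)) s :=
      h1.comp (f := fun s : ℝ ↦ (s, p)) (by fun_prop)
    exact ((hA.continuous.comp (by fun_prop : Continuous fun s : ℝ ↦ (t₀ + s, p))).continuousAt.mul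
      h2).continuousWithinAt
  have hsub : uIcc 0 (t - t₀) ⊆ Metric.ball (0 : ℝ) δ :=
    ((convex_ball (0 : ℝ) δ).ordConnected).uIcc_subset (Metric.mem_ball_self hδ) ht'
  have hder : HasDerivAt (fun T ↦ R₀ (T, p)) (A (t, p) * R₀ (t - t₀, p)) (t - t₀) := by
    have h1 := intervalIntegral.integral_hasDerivAt_right
      ((hcont.mono hsub).intervalIntegrable)
      (hcont.stronglyMeasurableAtFilter Metric.isOpen_ball _ ht')
      (hcont.continuousAt (Metric.isOpen_ball.mem_nhds ht'))
    rw [add_sub_cancel] at h1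
    refine (h1.const_add 1).congr_of_eventuallyEq ?_
    filter_upwards [Metric.isOpen_ball.mem_nhds ht'] with T hT using hint T hT p hp
  exact hder.comp_sub_const t t₀

/-- The local version of `exists_smooth_fundamental_solution`. -/
theorem exists_smooth_fundamental_solution_of_contDiffOn {P : Type u} [NormedAddCommGroup P]
    [NormedSpace ℝ P] [FiniteDimensional ℝ P] {𝔸 : Type (max u v)} [NormedRing 𝔸]
    [NormedAlgebra ℝ 𝔸] [CompleteSpace 𝔸] {A : ℝ × P → 𝔸} {O : Set (ℝ × P)} (hO : IsOpen O)
    (hA : ContDiffOn ℝ ∞ A O) {t₀ : ℝ} {p₀ : P} (h₀ : (t₀, p₀) ∈ O) :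
    ∃ δ > 0, Metric.ball t₀ δ ×ˢ Metric.ball p₀ δ ⊆ O ∧
      ∃ R : ℝ × P → 𝔸, ∀ t ∈ Metric.ball t₀ δ, ∀ p ∈ Metric.ball p₀ δ,
      ContDiffAt ℝ ∞ R (t, p) ∧ IsUnit (R (t, p)) ∧
      HasDerivAt (fun r ↦ R (r, p)) (A (t, p) * R (t, p)) t := by
  obtain ⟨r, hr, hrO⟩ := Metric.nhds_basis_closedBall.mem_iff.1 (hO.mem_nhds h₀)
  let χ : ContDiffBump (t₀, p₀) := ⟨r / 2, r, by positivity, by linarith⟩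
  have hχ : ContDiff ℝ ∞ (fun q ↦ χ q • A q) := by
    refine contDiff_iff_contDiffAt.2 fun q ↦ ?_
    by_cases hq : q ∈ tsupport χ
    swap
    · exact (contDiffAt_const (c := (0 : 𝔸))).congr_of_eventuallyEq
        ((notMem_tsupport_iff_eventuallyEq.1 hq).mono fun z hz ↦ by simp [hz])
    have hqO : q ∈ O := hrO (χ.tsupport_eq ▸ hq)
    exact χ.contDiffAt.smul (hA.contDiffAt (hO.mem_nhds hqO))
  obtain ⟨δ, hδ, R, hR⟩ := exists_smooth_fundamental_solution.{u, v} _ hχ t₀ p₀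
  have hsub : Metric.ball t₀ (min δ (r / 2)) ×ˢ Metric.ball p₀ (min δ (r / 2)) ⊆
      Metric.closedBall (t₀, p₀) (r / 2) := by
    rw [ball_prod_same]
    exact (Metric.ball_subset_ball (min_le_right _ _)).trans Metric.ball_subset_closedBall
  refine ⟨min δ (r / 2), lt_min hδ (by positivity), ?_, R, fun t ht p hp ↦ ?_⟩
  · exact hsub.trans ((Metric.closedBall_subset_closedBall (by linarith)).trans hrO)
  · obtain ⟨h1, h2, h3⟩ := hR t (Metric.ball_subset_ball (min_le_left _ _) ht) p
      (Metric.ball_subset_ball (min_le_left _ _) hp)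
    refine ⟨h1, h2, ?_⟩
    rwa [χ.one_of_mem_closedBall (hsub ⟨ht, hp⟩), one_smul] at h3

/-- Uniqueness for homogeneous linear differential equations on an interval. -/
theorem eq_zero_of_linear_ode {G : Type*} [NormedAddCommGroup G] [NormedSpace ℝ G]
    {K : Set ℝ} (hK : K.OrdConnected) (hKo : IsOpen K) {B : ℝ → G →L[ℝ] G} (hB : ContinuousOn B K)
    {x : ℝ → G} (hx : ∀ t ∈ K, HasDerivAt x (B t (x t)) t) {s t : ℝ} (hs : s ∈ K) (ht : t ∈ K)
    (h0 : x s = 0) : x t = 0 := by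
  obtain ⟨a, b, ha, hb, hsub⟩ : ∃ a b, (s ∈ Ioo a b ∧ t ∈ Ioo a b) ∧ a ≤ b ∧ Icc a b ⊆ K := by
    obtain ⟨a, ha, haK⟩ := exists_Icc_mem_subset_of_mem_nhds (hKo.mem_nhds hs)
    obtain ⟨ε, hε, hsε⟩ := Metric.isOpen_iff.1 hKo _ hs
    obtain ⟨ε', hε', htε⟩ := Metric.isOpen_iff.1 hKo _ ht
    have h1 : min s t - min ε ε' / 2 ∈ K := by
      have := lt_min hε hε'
      rcases le_total s t with h | h
      · rw [min_eq_left h]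
        refine hsε ?_
        rw [Metric.mem_ball, Real.dist_eq, abs_lt]
        constructor <;> linarith [min_le_left ε ε']
      · rw [min_eq_right h]
        refine htε ?_
        rw [Metric.mem_ball, Real.dist_eq, abs_lt]
        constructor <;> linarith [min_le_right ε ε']
    have h2 : max s t + min ε ε' / 2 ∈ K := by
      have := lt_min hε hε'
      rcases le_total s t with h | h
      · rw [max_eq_right h]
        refine htε ?_
        rw [Metric.mem_ball, Real.dist_eq, abs_lt]
        constructor <;> linarith [min_le_right ε ε']
      · rw [max_eq_left h]
        refine hsε ?_
        rw [Metric.mem_ball, Real.dist_eq, abs_lt]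
        constructor <;> linarith [min_le_left ε ε']
    have := lt_min hε hε'
    refine ⟨_, _, ⟨⟨?_, ?_⟩, ?_, ?_⟩, ?_, hK.out h1 h2⟩
    all_goals linarith [min_le_left s t, min_le_right s t, le_max_left s t, le_max_right s t]
  obtain ⟨C, hC⟩ := isCompact_Icc.exists_bound_of_continuousOn (hB.mono hsub)
  have hLip : ∀ r ∈ Ioo a b, LipschitzOnWith (Real.toNNReal C) (fun y ↦ B r y) univ := fun r hr ↦ by
    refine LipschitzWith.lipschitzOnWith ((B r).lipschitz.weaken ?_)
    rw [← norm_toNNReal]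
    exact Real.toNNReal_mono (hC r (Ioo_subset_Icc_self hr))
  have := ODE_solution_unique_of_mem_Ioo (v := fun r y ↦ B r y) (s := fun _ ↦ univ) hLip ha.1
    (f := x) (g := fun _ ↦ 0)
    (fun r hr ↦ ⟨hx r (hsub (Ioo_subset_Icc_self hr)), mem_univ _⟩)
    (fun r _ ↦ ⟨by simpa using hasDerivAt_const r (0 : G), mem_univ _⟩) h0
  exact this ha.2

end ParametricODE

/-! ### Derivatives of vector-valued functions on manifolds -/

section ManifoldCalculus

variable {EP : Type*} [NormedAddCommGroup EP] [NormedSpace ℝ EP]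
  {HP : Type*} [TopologicalSpace HP] {IP : ModelWithCorners ℝ EP HP}
  {P : Type*} [TopologicalSpace P] [ChartedSpace HP P]
  {EQ : Type*} [NormedAddCommGroup EQ] [NormedSpace ℝ EQ]
  {HQ : Type*} [TopologicalSpace HQ] {IQ : ModelWithCorners ℝ EQ HQ}
  {Q : Type*} [TopologicalSpace Q] [ChartedSpace HQ Q]
  {G G' : Type*} [NormedAddCommGroup G] [NormedSpace ℝ G]
  [NormedAddCommGroup G'] [NormedSpace ℝ G']

theorem HasMFDerivAt.mvfderiv_eq {g : P → G} {x : P} {L : TangentSpace IP x →L[ℝ] G}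
    (h : HasMFDerivAt IP 𝓘(ℝ, G) g x L) : mvfderiv IP g x = L := by
  rw [mvfderiv, h.mfderiv]; rfl

theorem MDifferentiableAt.hasMFDerivAt_mvfderiv {g : P → G} {x : P}
    (h : MDifferentiableAt IP 𝓘(ℝ, G) g x) :
    HasMFDerivAt IP 𝓘(ℝ, G) g x (mvfderiv IP g x : TangentSpace IP x →L[ℝ] G) :=
  h.hasMFDerivAt

theorem mvfderiv_eq_fderiv (g : G → G') (x : G) : mvfderiv 𝓘(ℝ, G) g x = fderiv ℝ g x := by
  rw [mvfderiv, mfderiv_eq_fderiv]; rfl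

theorem mvfderiv_comp_vec {g : Q → G} {f : P → Q} {x : P}
    (hg : MDifferentiableAt IQ 𝓘(ℝ, G) g (f x)) (hf : MDifferentiableAt IP IQ f x)
    (v : TangentSpace IP x) :
    mvfderiv IP (fun z ↦ g (f z)) x v = mvfderiv IQ g (f x) (mfderiv IP IQ f x v) :=
  congrArg (fun L ↦ L v) ((hg.hasMFDerivAt.comp x hf.hasMFDerivAt).mvfderiv_eq)

theorem mvfderiv_comp_fderiv {g : G → G'} {f : P → G} {x : P}
    (hg : DifferentiableAt ℝ g (f x)) (hf : MDifferentiableAt IP 𝓘(ℝ, G) f x)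
    (v : TangentSpace IP x) :
    mvfderiv IP (fun z ↦ g (f z)) x v = fderiv ℝ g (f x) (mvfderiv IP f x v) := by
  rw [mvfderiv_comp_vec (IQ := 𝓘(ℝ, G)) (g := g) hg.mdifferentiableAt hf, mvfderiv_eq_fderiv]
  rfl

theorem mvfderiv_clm_comp (L : G →L[ℝ] G') {g : P → G} {x : P}
    (hg : MDifferentiableAt IP 𝓘(ℝ, G) g x) (v : TangentSpace IP x) :
    mvfderiv IP (fun z ↦ L (g z)) x v = L (mvfderiv IP g x v) := by
  rw [mvfderiv_comp_fderiv (g := L) L.differentiableAt hg, L.fderiv]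

theorem mvfderiv_clm_apply {A : P → G →L[ℝ] G'} {g : P → G} {x : P}
    (hA : MDifferentiableAt IP 𝓘(ℝ, G →L[ℝ] G') A x)
    (hg : MDifferentiableAt IP 𝓘(ℝ, G) g x) (v : TangentSpace IP x) :
    mvfderiv IP (fun z ↦ A z (g z)) x v = mvfderiv IP A x v (g x) + A x (mvfderiv IP g x v) := by
  let LA : EP →L[ℝ] G →L[ℝ] G' := mvfderiv IP A x
  let Lg : EP →L[ℝ] G := mvfderiv IP g x
  have h : HasMFDerivAt IP 𝓘(ℝ, G') (fun z ↦ A z (g z)) x ((A x).comp Lg + LA.flip (g x)) :=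
    ⟨hA.continuousAt.clm_apply hg.continuousAt, by
      have h := hA.hasMFDerivAt_mvfderiv.2.clm_apply hg.hasMFDerivAt_mvfderiv.2
      simp only [writtenInExtChartAt, Function.comp, extChartAt_to_inv] at h
      exact h⟩
  rw [h.mvfderiv_eq, add_comm]
  rfl

theorem Filter.EventuallyEq.mvfderiv_eq {g g' : P → G} {x : P} (h : g =ᶠ[𝓝 x] g') :
    mvfderiv IP g x = mvfderiv IP g' x := by
  ext v
  simp only [mvfderiv, ContinuousLinearMap.comp_apply, h.mfderiv_eq]
  rfl

theorem mvfderiv_sum {ι : Type*} (s : Finset ι) {g : ι → P → G} {x : P}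
    (hg : ∀ i ∈ s, MDifferentiableAt IP 𝓘(ℝ, G) (g i) x) (v : TangentSpace IP x) :
    mvfderiv IP (fun z ↦ ∑ i ∈ s, g i z) x v = ∑ i ∈ s, mvfderiv IP (g i) x v := by
  let L : ι → EP →L[ℝ] G := fun i ↦ mvfderiv IP (g i) x
  have h : HasMFDerivAt IP 𝓘(ℝ, G) (fun z ↦ ∑ i ∈ s, g i z) x (∑ i ∈ s, L i) :=
    ⟨tendsto_finsetSum s fun i hi ↦ (hg i hi).continuousAt,
      HasFDerivWithinAt.fun_sum fun i hi ↦ (hg i hi).hasMFDerivAt_mvfderiv.2⟩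
  rw [h.mvfderiv_eq]
  exact sum_apply (F := EP →L[ℝ] G) _ _ _

section

variable [IsManifold IP ∞ P]

variable [IP.Boundaryless]

theorem mvfderiv_eq_fderiv_comp_extChartAt_symm {g : P → G} {x z : P}
    (hz : z ∈ (extChartAt IP x).source)
    (hg : MDifferentiableAt IP 𝓘(ℝ, G) g z) (v : TangentSpace IP z) :
    mvfderiv IP g z v = fderiv ℝ (fun u ↦ g ((extChartAt IP x).symm u)) (extChartAt IP x z)
      (mvfderiv IP (extChartAt IP x) z v) := by
  have hz' : z ∈ (chartAt HP x).source := by rwa [extChartAt_source] at hz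
  have h1 : MDifferentiableAt IP 𝓘(ℝ, EP) (extChartAt IP x) z := mdifferentiableAt_extChartAt hz'
  have h2 : MDifferentiableAt 𝓘(ℝ, EP) IP (extChartAt IP x).symm (extChartAt IP x z) := by
    have := mdifferentiableWithinAt_extChartAt_symm (I := IP) ((extChartAt IP x).map_source hz)
    rwa [IP.range_eq_univ, mdifferentiableWithinAt_univ] at this
  have h1' : IsManifold IP 1 P := .of_le (n := ∞) (by simp)
  have h3 : MDifferentiableAt 𝓘(ℝ, EP) 𝓘(ℝ, G) (fun u ↦ g ((extChartAt IP x).symm u))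
      (extChartAt IP x z) := by
    have hg' : MDifferentiableAt IP 𝓘(ℝ, G) g ((extChartAt IP x).symm (extChartAt IP x z)) := by
      rwa [(extChartAt IP x).left_inv hz]
    exact MDifferentiableAt.comp (extChartAt IP x z) hg' h2
  have h4 := mvfderiv_comp_fderiv h3.differentiableAt h1 v
  have h5 : g =ᶠ[𝓝 z] fun w ↦ g ((extChartAt IP x).symm (extChartAt IP x w)) := by
    filter_upwards [extChartAt_source_mem_nhds' hz] with w hw
    rw [(extChartAt IP x).left_inv hw]
  rw [h5.mvfderiv_eq, h4]

/-- The components of a tangent vector in the chart at `x`. -/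
theorem trivializationAt_tangent_eq_mvfderiv {x z : P} (hz : z ∈ (extChartAt IP x).source)
    (v : TangentSpace IP z) :
    (trivializationAt EP (TangentSpace IP) x ⟨z, v⟩).2 = mvfderiv IP (extChartAt IP x) z v := by
  have hz' : z ∈ (chartAt HP x).source := by rwa [extChartAt_source] at hz
  have h1' : IsManifold IP 1 P := .of_le (n := ∞) (by simp)
  have h := congrArg (fun L ↦ L v) (TangentBundle.continuousLinearMapAt_trivializationAt (I := IP) hz')
  refine Eq.trans ?_ h
  rw [Trivialization.continuousLinearMapAt_apply, Trivialization.coe_linearMapAt_of_mem]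
  exact hz'

theorem contMDiffAt_mvfderiv_extChartAt {x : P} {X : ∀ z : P, TangentSpace IP z}
    (hX : ContMDiffAt IP IP.tangent ∞ (fun z ↦ (⟨z, X z⟩ : TangentBundle IP P)) x) :
    ContMDiffAt IP 𝓘(ℝ, EP) ∞ (fun z ↦ mvfderiv IP (extChartAt IP x) z (X z)) x := by
  refine ((contMDiffAt_section x).1 hX).congr_of_eventuallyEq ?_
  filter_upwards [extChartAt_source_mem_nhds (I := IP) x] with z hz
  exact (trivializationAt_tangent_eq_mvfderiv hz _).symm

theorem mvfderiv_extChartAt_self (x : P) (v : TangentSpace IP x) :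
    mvfderiv IP (extChartAt IP x) x v = v := by
  have h1' : IsManifold IP 1 P := .of_le (n := ∞) (by simp)
  exact congrArg (fun L ↦ L v) (mfderiv_extChartAt_self (I := IP) (x := x))

theorem ContMDiffAt.eventually_mdifferentiableAt {g : P → G} {x : P}
    (hg : ContMDiffAt IP 𝓘(ℝ, G) ∞ g x) : ∀ᶠ z in 𝓝 x, MDifferentiableAt IP 𝓘(ℝ, G) g z := by
  have h1' : IsManifold IP 1 P := .of_le (n := ∞) (by simp)
  filter_upwards [(contMDiffAt_iff_contMDiffAt_nhds (n := 1) (by simp)).1 (hg.of_le (by simp))]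
    with z hz
  exact hz.mdifferentiableAt (by simp)

theorem ContMDiffAt.contDiffAt_comp_extChartAt_symm {g : P → G} {x : P}
    (hg : ContMDiffAt IP 𝓘(ℝ, G) ∞ g x) :
    ContDiffAt ℝ ∞ (fun u ↦ g ((extChartAt IP x).symm u)) (extChartAt IP x x) := by
  have h := (contMDiffAt_iff.1 hg).2
  rw [IP.range_eq_univ, contDiffWithinAt_univ] at h
  exact h

theorem ContMDiffAt.mvfderiv_apply {g : P → G} {x : P} (hg : ContMDiffAt IP 𝓘(ℝ, G) ∞ g x)
    {X : ∀ z : P, TangentSpace IP z}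
    (hX : ContMDiffAt IP IP.tangent ∞ (fun z ↦ (⟨z, X z⟩ : TangentBundle IP P)) x) :
    ContMDiffAt IP 𝓘(ℝ, G) ∞ (fun z ↦ mvfderiv IP g z (X z)) x := by
  have h1 : ContMDiffAt IP 𝓘(ℝ, EP →L[ℝ] G) ∞ (fun z ↦ fderiv ℝ
      (fun u ↦ g ((extChartAt IP x).symm u)) (extChartAt IP x z)) x :=
    (hg.contDiffAt_comp_extChartAt_symm.fderiv_right (m := ∞) (by simp)).contMDiffAt.comp x
      contMDiffAt_extChartAt
  refine (h1.clm_apply (contMDiffAt_mvfderiv_extChartAt hX)).congr_of_eventuallyEq ?_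
  filter_upwards [extChartAt_source_mem_nhds (I := IP) x, hg.eventually_mdifferentiableAt]
    with z hz hgz
  exact mvfderiv_eq_fderiv_comp_extChartAt_symm hz hgz _

/-- The commutator of two vector fields, as derivations of vector-valued functions, in terms of
their components in a chart. -/
theorem mvfderiv_mvfderiv_sub {g : P → G} {x : P} (hg : ContMDiffAt IP 𝓘(ℝ, G) ∞ g x)
    {X Y : ∀ z : P, TangentSpace IP z}
    (hX : ContMDiffAt IP IP.tangent ∞ (fun z ↦ (⟨z, X z⟩ : TangentBundle IP P)) x)
    (hY : ContMDiffAt IP IP.tangent ∞ (fun z ↦ (⟨z, Y z⟩ : TangentBundle IP P)) x) :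
    mvfderiv IP (fun z ↦ mvfderiv IP g z (Y z)) x (X x) -
      mvfderiv IP (fun z ↦ mvfderiv IP g z (X z)) x (Y x) =
    fderiv ℝ (fun u ↦ g ((extChartAt IP x).symm u)) (extChartAt IP x x)
      (mvfderiv IP (fun z ↦ mvfderiv IP (extChartAt IP x) z (Y z)) x (X x) -
      mvfderiv IP (fun z ↦ mvfderiv IP (extChartAt IP x) z (X z)) x (Y x)) := by
  have hg' := hg.contDiffAt_comp_extChartAt_symm
  set κ := extChartAt IP x with hκ
  set D : EP → EP →L[ℝ] G := fderiv ℝ (fun u ↦ g (κ.symm u)) with hD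
  have hDd : DifferentiableAt ℝ D (κ x) :=
    (hg'.fderiv_right (m := ∞) (by simp)).differentiableAt (by simp)
  have hκd : MDifferentiableAt IP 𝓘(ℝ, EP) κ x :=
    (contMDiffAt_extChartAt (n := 1)).mdifferentiableAt (by simp)
  have hDκ : MDifferentiableAt IP 𝓘(ℝ, EP →L[ℝ] G) (fun z ↦ D (κ z)) x :=
    hDd.mdifferentiableAt.comp x hκd
  have key : ∀ {X Y : ∀ z : P, TangentSpace IP z}
      (_ : ContMDiffAt IP IP.tangent ∞ (fun z ↦ (⟨z, Y z⟩ : TangentBundle IP P)) x),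
      mvfderiv IP (fun z ↦ mvfderiv IP g z (Y z)) x (X x) =
        fderiv ℝ D (κ x) (X x) (Y x) + D (κ x) (mvfderiv IP (fun z ↦ mvfderiv IP κ z (Y z)) x (X x)) := by
    intro X Y hY
    have h1 : (fun z ↦ mvfderiv IP g z (Y z)) =ᶠ[𝓝 x] fun z ↦ D (κ z) (mvfderiv IP κ z (Y z)) := by
      filter_upwards [extChartAt_source_mem_nhds (I := IP) x, hg.eventually_mdifferentiableAt]
        with z hz hgz
      exact mvfderiv_eq_fderiv_comp_extChartAt_symm hz hgz _
    rw [h1.mvfderiv_eq, mvfderiv_clm_apply hDκ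
      ((contMDiffAt_mvfderiv_extChartAt hY).mdifferentiableAt (by simp)),
      mvfderiv_comp_fderiv hDd hκd, mvfderiv_extChartAt_self, mvfderiv_extChartAt_self]
  rw [key hY, key hX, map_sub]
  have hsymm : fderiv ℝ D (κ x) (X x) (Y x) = fderiv ℝ D (κ x) (Y x) (X x) :=
    (hg'.isSymmSndFDerivAt (by
    rw [minSmoothness_of_isRCLikeNormedField]; exact WithTop.coe_le_coe.2 (le_top : (2 : ℕ∞) ≤ ⊤))) _ _
  rw [hsymm]
  abel

/-- The components of the Lie bracket of two vector fields in the chart at the base point. -/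
theorem mlieBracket_eq_mvfderiv_sub {x : P} {X Y : ∀ z : P, TangentSpace IP z}
    (hX : ContMDiffAt IP IP.tangent ∞ (fun z ↦ (⟨z, X z⟩ : TangentBundle IP P)) x)
    (hY : ContMDiffAt IP IP.tangent ∞ (fun z ↦ (⟨z, Y z⟩ : TangentBundle IP P)) x) :
    VectorField.mlieBracket IP X Y x =
      mvfderiv IP (fun z ↦ mvfderiv IP (extChartAt IP x) z (Y z)) x (X x) -
      mvfderiv IP (fun z ↦ mvfderiv IP (extChartAt IP x) z (X z)) x (Y x) := by
  have h1' : IsManifold IP 1 P := .of_le (n := ∞) (by simp)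
  set κ := extChartAt IP x with hκ
  have hpull : ∀ Z : ∀ z : P, TangentSpace IP z,
      VectorField.mpullbackWithin 𝓘(ℝ, EP) IP κ.symm Z (Set.range IP) =ᶠ[𝓝 (κ x)]
        fun u ↦ mvfderiv IP κ (κ.symm u) (Z (κ.symm u)) := by
    intro Z
    filter_upwards [extChartAt_target_mem_nhds (I := IP) x] with u hu
    rw [VectorField.mpullbackWithin_apply]
    have := ContinuousLinearMap.inverse_eq
      (mfderivWithin_extChartAt_symm_comp_mfderiv_extChartAt (I := IP) hu)
      (mfderiv_extChartAt_comp_mfderivWithin_extChartAt_symm (I := IP) hu)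
    rw [this]
    rfl
  have hder : ∀ {Z : ∀ z : P, TangentSpace IP z}
      (_ : ContMDiffAt IP IP.tangent ∞ (fun z ↦ (⟨z, Z z⟩ : TangentBundle IP P)) x) (v : TangentSpace IP x),
      fderiv ℝ (VectorField.mpullbackWithin 𝓘(ℝ, EP) IP κ.symm Z (Set.range IP)) (κ x) v =
        mvfderiv IP (fun z ↦ mvfderiv IP κ z (Z z)) x v := by
    intro Z hZ v
    rw [(hpull Z).fderiv_eq, mvfderiv_eq_fderiv_comp_extChartAt_symm (mem_extChartAt_source x)
      ((contMDiffAt_mvfderiv_extChartAt hZ).mdifferentiableAt (by simp)), mvfderiv_extChartAt_self]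
  have hval : ∀ Z : ∀ z : P, TangentSpace IP z,
      VectorField.mpullbackWithin 𝓘(ℝ, EP) IP κ.symm Z (Set.range IP) (κ x) = Z x := by
    intro Z
    refine (hpull Z).eq_of_nhds.trans ?_
    rw [hκ, extChartAt_to_inv]
    exact mvfderiv_extChartAt_self (IP := IP) x (Z x)
  let L : EP →L[ℝ] EP := mvfderiv IP (extChartAt IP x) x
  have hL : L = .id ℝ EP := by ext v; exact mvfderiv_extChartAt_self x v
  have hinv : ∀ w : EP, L.inverse w = w := fun w ↦ by rw [hL]; simp
  rw [VectorField.mlieBracket, VectorField.mlieBracketWithin_apply]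
  refine (hinv _).trans ?_
  let X' : EP → EP := VectorField.mpullbackWithin 𝓘(ℝ, EP) IP κ.symm X (Set.range IP)
  let Y' : EP → EP := VectorField.mpullbackWithin 𝓘(ℝ, EP) IP κ.symm Y (Set.range IP)
  change VectorField.lieBracketWithin ℝ X' Y' (κ.symm ⁻¹' Set.univ ∩ Set.range IP) (κ x) = _
  rw [Set.preimage_univ, Set.univ_inter, IP.range_eq_univ, VectorField.lieBracketWithin_univ,
    VectorField.lieBracket, show X' (κ x) = X x from hval X, show Y' (κ x) = Y x from hval Y]
  exact congrArg₂ _ (hder hY _) (hder hX _)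

/-- The Lie bracket acts on vector-valued functions as the commutator. -/
theorem mvfderiv_mlieBracket {g : P → G} {x : P} (hg : ContMDiffAt IP 𝓘(ℝ, G) ∞ g x)
    {X Y : ∀ z : P, TangentSpace IP z}
    (hX : ContMDiffAt IP IP.tangent ∞ (fun z ↦ (⟨z, X z⟩ : TangentBundle IP P)) x)
    (hY : ContMDiffAt IP IP.tangent ∞ (fun z ↦ (⟨z, Y z⟩ : TangentBundle IP P)) x) :
    mvfderiv IP g x (VectorField.mlieBracket IP X Y x) =
      mvfderiv IP (fun z ↦ mvfderiv IP g z (Y z)) x (X x) -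
      mvfderiv IP (fun z ↦ mvfderiv IP g z (X z)) x (Y x) := by
  rw [mvfderiv_mvfderiv_sub hg hX hY, ← mlieBracket_eq_mvfderiv_sub hX hY,
    mvfderiv_eq_fderiv_comp_extChartAt_symm (mem_extChartAt_source x)
      (hg.mdifferentiableAt (by simp)), mvfderiv_extChartAt_self]

end

end ManifoldCalculus

/-! ### A Lie algebroid in a local frame -/

namespace LieAlgebroid

section Frame

variable {E : Type*} [NormedAddCommGroup E] [NormedSpace ℝ E] [FiniteDimensional ℝ E]
  {N : Type*} [TopologicalSpace N] [T2Space N] [ChartedSpace E N] [IsManifold 𝓘(ℝ, E) ∞ N]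
  {F : Type*} [NormedAddCommGroup F] [NormedSpace ℝ F] [FiniteDimensional ℝ F]
  {V : N → Type*} [TopologicalSpace (TotalSpace F V)]
  [∀ x, AddCommGroup (V x)] [∀ x, Module ℝ (V x)] [∀ x, TopologicalSpace (V x)]
  [FiberBundle F V] [VectorBundle ℝ F V] [ContMDiffVectorBundle ∞ F V 𝓘(ℝ, E)]
  {EQ : Type*} [NormedAddCommGroup EQ] [NormedSpace ℝ EQ]
  {HQ : Type*} [TopologicalSpace HQ] {IQ : ModelWithCorners ℝ EQ HQ}
  {Q : Type*} [TopologicalSpace Q] [ChartedSpace HQ Q]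

variable (F V) in
/-- The components, in the model fibre, of a vector of the fibre over `n`, with respect to the
preferred trivialization at `n₀`. They are `0` outside the base set of the trivialization. -/
def coord (n₀ n : N) : V n →ₗ[ℝ] F := (trivializationAt F V n₀).linearMapAt ℝ n

variable (F V) in
/-- The vector of the fibre over `n` with given components in the preferred trivialization at
`n₀`. -/
def frameVec (n₀ n : N) : F →ₗ[ℝ] V n := (trivializationAt F V n₀).symmₗ ℝ n

theorem coord_eq {n₀ n : N} (hn : n ∈ (trivializationAt F V n₀).baseSet) (v : V n) :
    coord F V n₀ n v = (trivializationAt F V n₀ ⟨n, v⟩).2 := by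
  rw [coord, Trivialization.coe_linearMapAt_of_mem _ hn]

theorem coord_frameVec {n₀ n : N} (hn : n ∈ (trivializationAt F V n₀).baseSet) (u : F) :
    coord F V n₀ n (frameVec F V n₀ n u) = u :=
  (trivializationAt F V n₀).linearMapAt_symmₗ hn u

theorem frameVec_coord {n₀ n : N} (hn : n ∈ (trivializationAt F V n₀).baseSet) (v : V n) :
    frameVec F V n₀ n (coord F V n₀ n v) = v :=
  (trivializationAt F V n₀).symmₗ_linearMapAt hn v

theorem coord_injective {n₀ n : N} (hn : n ∈ (trivializationAt F V n₀).baseSet) :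
    Function.Injective (coord F V n₀ n) :=
  Function.LeftInverse.injective (frameVec_coord hn)

/-- Smoothness of a section along a map, in terms of its components. -/
theorem contMDiffWithinAt_iff_coord {f : Q → N} {s : ∀ q, V (f q)} {S : Set Q} {q : Q} {n₀ : N}
    (hq : f q ∈ (trivializationAt F V n₀).baseSet) :
    ContMDiffWithinAt IQ (𝓘(ℝ, E).prod 𝓘(ℝ, F)) ∞
      (fun z ↦ (⟨f z, s z⟩ : TotalSpace F V)) S q ↔
    ContMDiffWithinAt IQ 𝓘(ℝ, E) ∞ f S q ∧
      ContMDiffWithinAt IQ 𝓘(ℝ, F) ∞ (fun z ↦ coord F V n₀ (f z) (s z)) S q := by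
  rw [(trivializationAt F V n₀).contMDiffWithinAt_iff
    ((trivializationAt F V n₀).mem_source.2 hq)]
  refine and_congr_right fun hf ↦ ?_
  have h : (fun z ↦ coord F V n₀ (f z) (s z)) =ᶠ[𝓝[S] q]
      fun z ↦ (trivializationAt F V n₀ ⟨f z, s z⟩).2 := by
    filter_upwards [hf.continuousWithinAt.preimage_mem_nhdsWithin
      ((trivializationAt F V n₀).open_baseSet.mem_nhds hq)] with z hz using coord_eq hz _
  exact (h.contMDiffWithinAt_iff (coord_eq hq _)).symm

theorem contMDiffAt_iff_coord {f : Q → N} {s : ∀ q, V (f q)} {q : Q} {n₀ : N}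
    (hq : f q ∈ (trivializationAt F V n₀).baseSet) :
    ContMDiffAt IQ (𝓘(ℝ, E).prod 𝓘(ℝ, F)) ∞ (fun z ↦ (⟨f z, s z⟩ : TotalSpace F V)) q ↔
    ContMDiffAt IQ 𝓘(ℝ, E) ∞ f q ∧
      ContMDiffAt IQ 𝓘(ℝ, F) ∞ (fun z ↦ coord F V n₀ (f z) (s z)) q := by
  simp only [← contMDiffWithinAt_univ]
  exact contMDiffWithinAt_iff_coord hq

theorem contMDiffAt_coord_section {n₀ x : N} (hx : x ∈ (trivializationAt F V n₀).baseSet)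
    (b : Cₛ^∞⟮𝓘(ℝ, E); F, V⟯) :
    ContMDiffAt 𝓘(ℝ, E) 𝓘(ℝ, F) ∞ (fun z ↦ coord F V n₀ z (b z)) x :=
  ((contMDiffAt_iff_coord (f := fun z ↦ z) hx).1 b.contMDiff.contMDiffAt).2

variable (E F V) in
theorem exists_frameBump (n₀ : N) : ∃ ψ : SmoothBumpFunction 𝓘(ℝ, E) n₀,
    tsupport ψ ⊆ (trivializationAt F V n₀).baseSet := by
  obtain ⟨ψ, -, hψ⟩ := (SmoothBumpFunction.nhds_basis_tsupport (I := 𝓘(ℝ, E)) n₀).mem_iff.1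
    ((trivializationAt F V n₀).open_baseSet.mem_nhds (mem_baseSet_trivializationAt F V n₀))
  exact ⟨ψ, hψ⟩

variable (E F V) in
/-- A bump function at `n₀` that is supported in the domain of the preferred trivialization. -/
def frameBump (n₀ : N) : SmoothBumpFunction 𝓘(ℝ, E) n₀ := (exists_frameBump E F V n₀).choose

variable (E F V) in
theorem tsupport_frameBump (n₀ : N) :
    tsupport (frameBump E F V n₀) ⊆ (trivializationAt F V n₀).baseSet :=
  (exists_frameBump E F V n₀).choose_spec

variable (E F V) in
/-- A neighbourhood of `n₀` on which the local frame at `n₀` is the restriction of global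
sections, see `frameSection`. -/
def frameNhd (n₀ : N) : Set N := {n | ∀ᶠ z in 𝓝 n, frameBump E F V n₀ z = 1}

theorem isOpen_frameNhd (n₀ : N) : IsOpen (frameNhd E F V n₀) := isOpen_setOfPred_eventually_nhds

theorem mem_frameNhd_self (n₀ : N) : n₀ ∈ frameNhd E F V n₀ :=
  (frameBump E F V n₀).eventuallyEq_one

theorem frameNhd_subset_baseSet (n₀ : N) :
    frameNhd E F V n₀ ⊆ (trivializationAt F V n₀).baseSet := fun n hn ↦
  tsupport_frameBump E F V n₀ (subset_tsupport _ (by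
    rw [Function.mem_support, Eventually.self_of_nhds hn]; exact one_ne_zero))

theorem frameNhd_subset_source (n₀ : N) : frameNhd E F V n₀ ⊆ (chartAt E n₀).source := fun n hn ↦
  (frameBump E F V n₀).support_subset_source (by
    rw [Function.mem_support, Eventually.self_of_nhds hn]; exact one_ne_zero)

variable (E V) in
/-- A global section that is constant near `n₀`, in the preferred trivialization at `n₀`. -/
def frameSection (n₀ : N) : F →ₗ[ℝ] Cₛ^∞⟮𝓘(ℝ, E); F, V⟯ where
  toFun u := ⟨(frameBump E F V n₀ : N → ℝ) • fun n ↦ frameVec F V n₀ n u,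
    ContMDiffOn.smul_section_of_tsupport (frameBump E F V n₀).contMDiff.contMDiffOn
      (trivializationAt F V n₀).open_baseSet (tsupport_frameBump E F V n₀) fun n hn ↦ by
        refine ContMDiffAt.contMDiffWithinAt
          ((contMDiffAt_iff_coord (f := fun z : N ↦ z) hn).2 ⟨contMDiffAt_id, ?_⟩)
        refine (contMDiffAt_const (c := u)).congr_of_eventuallyEq ?_
        filter_upwards [(trivializationAt F V n₀).open_baseSet.mem_nhds hn] with z hz
          using coord_frameVec hz u⟩
  map_add' u v := by
    ext n; exact (congrArg _ (map_add _ u v)).trans (smul_add (frameBump E F V n₀ n) _ _)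
  map_smul' c u := by
    ext n; exact (congrArg _ (map_smul _ c u)).trans (smul_comm (frameBump E F V n₀ n) c _)

theorem frameSection_apply {n₀ n : N} (hn : n ∈ frameNhd E F V n₀) (u : F) :
    frameSection E V n₀ u n = frameVec F V n₀ n u := by
  change frameBump E F V n₀ n • frameVec F V n₀ n u = _
  rw [Eventually.self_of_nhds hn, one_smul]

theorem coord_frameSection {n₀ n : N} (hn : n ∈ frameNhd E F V n₀) (u : F) :
    coord F V n₀ n (frameSection E V n₀ u n) = u := by
  rw [frameSection_apply hn, coord_frameVec (frameNhd_subset_baseSet n₀ hn)]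

theorem mvfderiv_coord_frameSection {n₀ n : N} (hn : n ∈ frameNhd E F V n₀) (u : F)
    (v : TangentSpace 𝓘(ℝ, E) n) :
    mvfderiv 𝓘(ℝ, E) (fun z ↦ coord F V n₀ z (frameSection E V n₀ u z)) n v = 0 := by
  have h : (fun z ↦ coord F V n₀ z (frameSection E V n₀ u z)) =ᶠ[𝓝 n] fun _ ↦ u := by
    filter_upwards [(isOpen_frameNhd n₀).mem_nhds hn] with z hz using coord_frameSection hz u
  rw [h.mvfderiv_eq, mvfderiv_const]
  rfl

/-- Near `n₀`, a linear functional of the components of a section, as a global smooth function. -/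
def coordFun (n₀ : N) (b : Cₛ^∞⟮𝓘(ℝ, E); F, V⟯) (ℓ : F →L[ℝ] ℝ) : C^∞⟮𝓘(ℝ, E), N; ℝ⟯ :=
  ⟨fun n ↦ frameBump E F V n₀ n • ℓ (coord F V n₀ n (b n)), by
    refine contMDiff_of_tsupport fun n hn ↦ ?_
    have hn' := tsupport_frameBump E F V n₀ (tsupport_smul_subset_left _ _ hn)
    exact (frameBump E F V n₀).contMDiff.contMDiffAt.smul
      (ℓ.contMDiff.contMDiffAt.comp n (contMDiffAt_coord_section hn' b))⟩

theorem coordFun_apply {n₀ n : N} (hn : n ∈ frameNhd E F V n₀) (b : Cₛ^∞⟮𝓘(ℝ, E); F, V⟯)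
    (ℓ : F →L[ℝ] ℝ) : coordFun n₀ b ℓ n = ℓ (coord F V n₀ n (b n)) := by
  change frameBump E F V n₀ n • ℓ (coord F V n₀ n (b n)) = _
  rw [Eventually.self_of_nhds hn, one_smul]

variable (B : LieAlgebroid 𝓘(ℝ, E) F V)

theorem bracket_swap (a b : Cₛ^∞⟮𝓘(ℝ, E); F, V⟯) : B.bracket a b = -B.bracket b a := by
  have h := B.bracket_self (a + b)
  simp only [map_add, LinearMap.add_apply, B.bracket_self, zero_add, add_zero] at h
  exact eq_neg_of_add_eq_zero_right h

/-- The evaluation of sections at a point. -/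
def evalSection (x : N) : Cₛ^∞⟮𝓘(ℝ, E); F, V⟯ →ₗ[ℝ] V x where
  toFun a := a x
  map_add' _ _ := rfl
  map_smul' _ _ := rfl

theorem bracket_congr_right (a : Cₛ^∞⟮𝓘(ℝ, E); F, V⟯) {b b' : Cₛ^∞⟮𝓘(ℝ, E); F, V⟯} {x : N}
    (h : ∀ᶠ z in 𝓝 x, b z = b' z) : B.bracket a b x = B.bracket a b' x := by
  obtain ⟨ψ, -, hψ⟩ := (SmoothBumpFunction.nhds_basis_tsupport (I := 𝓘(ℝ, E)) x).mem_iff.1 h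
  have h0 : ContMDiffSection.funSMul ⟨ψ, ψ.contMDiff⟩ (b - b') = 0 := by
    ext z
    change ψ z • (b z - b' z) = 0
    by_cases hz : z ∈ tsupport ψ
    · rw [show b z = b' z from hψ hz, sub_self, smul_zero]
    · rw [image_eq_zero_of_notMem_tsupport hz, zero_smul]
  have h1 := B.leibniz a (b - b') ⟨ψ, ψ.contMDiff⟩ x
  rw [h0, map_zero] at h1
  have h2 : (0 : V x) = ψ x • B.bracket a (b - b') x + _ • (b x - b' x) := h1
  rw [ψ.eventuallyEq_one.self_of_nhds, h.self_of_nhds, sub_self, smul_zero, add_zero, map_sub] at h2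
  have h3 : (0 : V x) = (1 : ℝ) • (B.bracket a b x - B.bracket a b' x) := h2
  rw [one_smul] at h3
  exact sub_eq_zero.1 h3.symm

theorem bracket_congr {a a' b b' : Cₛ^∞⟮𝓘(ℝ, E); F, V⟯} {x : N}
    (ha : ∀ᶠ z in 𝓝 x, a z = a' z) (hb : ∀ᶠ z in 𝓝 x, b z = b' z) :
    B.bracket a b x = B.bracket a' b' x := by
  rw [B.bracket_congr_right a hb, B.bracket_swap, B.bracket_swap a']
  exact congrArg Neg.neg (B.bracket_congr_right b' ha)

theorem bracket_funSMul_funSMul (a b : Cₛ^∞⟮𝓘(ℝ, E); F, V⟯) (h k : C^∞⟮𝓘(ℝ, E), N; ℝ⟯) (x : N) :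
    B.bracket (ContMDiffSection.funSMul h a) (ContMDiffSection.funSMul k b) x =
      (h x * k x) • B.bracket a b x
        + (h x * mvfderiv 𝓘(ℝ, E) k x (B.anchor x (a x))) • b x
        - (k x * mvfderiv 𝓘(ℝ, E) h x (B.anchor x (b x))) • a x := by
  have h1 : B.bracket (ContMDiffSection.funSMul h a) b x =
      h x • B.bracket a b x - mvfderiv 𝓘(ℝ, E) h x (B.anchor x (b x)) • a x := by
    have h2 := B.leibniz b a h x
    rw [B.bracket_swap]
    change -(B.bracket b (ContMDiffSection.funSMul h a) x) = _
    rw [h2, B.bracket_swap b a]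
    change -(h x • -(B.bracket a b x) + _) = _
    rw [smul_neg]
    abel
  rw [B.leibniz, h1]
  have h3 : ContMDiffSection.funSMul h a x = h x • a x := rfl
  rw [h3, map_smul, map_smul, smul_eq_mul]
  module

/-- The structure functions of a Lie algebroid in the local frame at `n₀`: the components of the
brackets of the sections of the frame. -/
def structureMap (n₀ n : N) : F →L[ℝ] F →L[ℝ] F :=
  let β := Module.finBasis ℝ F
  ∑ i, ∑ j, (β.coord i).toContinuousLinearMap.smulRight
    ((β.coord j).toContinuousLinearMap.smulRight
      (coord F V n₀ n (B.bracket (frameSection E V n₀ (β i)) (frameSection E V n₀ (β j)) n)))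

theorem structureMap_apply (n₀ n : N) (u v : F) : B.structureMap n₀ n u v =
    ∑ i, ∑ j, (((Module.finBasis ℝ F).coord i u) * ((Module.finBasis ℝ F).coord j v)) •
      coord F V n₀ n (B.bracket (frameSection E V n₀ (Module.finBasis ℝ F i))
        (frameSection E V n₀ (Module.finBasis ℝ F j)) n) := by
  simp [structureMap, sum_apply, smul_smul]

theorem ContMDiffAt.clm_smulRight {G : Type*} [NormedAddCommGroup G] [NormedSpace ℝ G]
    (ℓ : F →L[ℝ] ℝ) {g : Q → G} {q : Q} (hg : ContMDiffAt IQ 𝓘(ℝ, G) ∞ g q) :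
    ContMDiffAt IQ 𝓘(ℝ, F →L[ℝ] G) ∞ (fun z ↦ ℓ.smulRight (g z)) q :=
  (ContinuousLinearMap.smulRightL ℝ F G ℓ).contMDiff.contMDiffAt.comp q hg

theorem contMDiffAt_structureMap {n₀ n : N} (hn : n ∈ frameNhd E F V n₀) :
    ContMDiffAt 𝓘(ℝ, E) 𝓘(ℝ, F →L[ℝ] F →L[ℝ] F) ∞ (B.structureMap n₀) n := by
  unfold structureMap
  refine contMDiffAt_finsetSum fun i _ ↦ contMDiffAt_finsetSum fun j _ ↦ ?_
  exact ContMDiffAt.clm_smulRight _ (ContMDiffAt.clm_smulRight _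
    (contMDiffAt_coord_section (frameNhd_subset_baseSet n₀ hn) _))

theorem eventually_eq_sum_coordFun {n₀ x : N} (hx : x ∈ frameNhd E F V n₀)
    (b : Cₛ^∞⟮𝓘(ℝ, E); F, V⟯) :
    ∀ᶠ z in 𝓝 x, b z = (∑ i, ContMDiffSection.funSMul
      (coordFun n₀ b ((Module.finBasis ℝ F).coord i).toContinuousLinearMap)
      (frameSection E V n₀ (Module.finBasis ℝ F i)) : Cₛ^∞⟮𝓘(ℝ, E); F, V⟯) z := by
  filter_upwards [(isOpen_frameNhd n₀).mem_nhds hx] with z hz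
  apply coord_injective (frameNhd_subset_baseSet n₀ hz)
  change _ = coord F V n₀ z (evalSection z _)
  rw [map_sum, map_sum]
  have h : ∀ i, coord F V n₀ z (evalSection z (ContMDiffSection.funSMul
      (coordFun n₀ b ((Module.finBasis ℝ F).coord i).toContinuousLinearMap)
      (frameSection E V n₀ (Module.finBasis ℝ F i)))) =
      (Module.finBasis ℝ F).repr (coord F V n₀ z (b z)) i • Module.finBasis ℝ F i := fun i ↦ by
    change coord F V n₀ z (coordFun n₀ b _ z • frameSection E V n₀ (Module.finBasis ℝ F i) z) = _
    rw [map_smul, coordFun_apply hz, coord_frameSection hz]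
    rfl
  simp only [h, Module.Basis.sum_repr]

/-- The bracket in the local frame at `n₀`. -/
theorem coord_bracket {n₀ x : N} (hx : x ∈ frameNhd E F V n₀) (b c : Cₛ^∞⟮𝓘(ℝ, E); F, V⟯) :
    coord F V n₀ x (B.bracket b c x) =
      B.structureMap n₀ x (coord F V n₀ x (b x)) (coord F V n₀ x (c x))
      + mvfderiv 𝓘(ℝ, E) (fun z ↦ coord F V n₀ z (c z)) x (B.anchor x (b x))
      - mvfderiv 𝓘(ℝ, E) (fun z ↦ coord F V n₀ z (b z)) x (B.anchor x (c x)) := by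
  set β := Module.finBasis ℝ F with hβ
  let cf : Cₛ^∞⟮𝓘(ℝ, E); F, V⟯ → Fin (Module.finrank ℝ F) → C^∞⟮𝓘(ℝ, E), N; ℝ⟯ := fun b i ↦
    coordFun n₀ b (β.coord i).toContinuousLinearMap
  let ε : Fin (Module.finrank ℝ F) → Cₛ^∞⟮𝓘(ℝ, E); F, V⟯ := fun i ↦ frameSection E V n₀ (β i)
  have hcf : ∀ b i, cf b i x = β.coord i (coord F V n₀ x (b x)) := fun b i ↦ coordFun_apply hx b _
  have hε : ∀ i, coord F V n₀ x (ε i x) = β i := fun i ↦ coord_frameSection hx _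
  have hval : ∀ b : Cₛ^∞⟮𝓘(ℝ, E); F, V⟯, b x = ∑ i, cf b i x • ε i x := fun b ↦ by
    refine (eventually_eq_sum_coordFun hx b).self_of_nhds.trans ?_
    exact map_sum (evalSection x) _ _
  have hder : ∀ (b : Cₛ^∞⟮𝓘(ℝ, E); F, V⟯) (v : TangentSpace 𝓘(ℝ, E) x),
      mvfderiv 𝓘(ℝ, E) (fun z ↦ coord F V n₀ z (b z)) x v =
        ∑ i, mvfderiv 𝓘(ℝ, E) (cf b i) x v • β i := by
    intro b v
    have h1 : (fun z ↦ coord F V n₀ z (b z)) =ᶠ[𝓝 x] fun z ↦ ∑ i, cf b i z • β i := by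
      filter_upwards [(isOpen_frameNhd n₀).mem_nhds hx] with z hz
      simp only [cf, coordFun_apply hz]
      exact (β.sum_repr _).symm
    rw [h1.mvfderiv_eq, mvfderiv_sum]
    · refine Finset.sum_congr rfl fun i _ ↦ ?_
      exact mvfderiv_clm_comp ((ContinuousLinearMap.id ℝ ℝ).smulRight (β i))
        ((cf b i).contMDiff.contMDiffAt.mdifferentiableAt (by simp)) v
    · intro i _
      exact (((ContinuousLinearMap.id ℝ ℝ).smulRight (β i)).contMDiff.contMDiffAt.comp x
        ((cf b i).contMDiff (n := ∞)).contMDiffAt).mdifferentiableAt (by simp)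
  rw [B.bracket_congr (eventually_eq_sum_coordFun hx b) (eventually_eq_sum_coordFun hx c)]
  change coord F V n₀ x (evalSection x (B.bracket (∑ i, ContMDiffSection.funSMul (cf b i) (ε i))
    (∑ i, ContMDiffSection.funSMul (cf c i) (ε i)))) = _
  have hterm : ∀ i j, coord F V n₀ x (evalSection x (B.bracket
      (ContMDiffSection.funSMul (cf b i) (ε i)) (ContMDiffSection.funSMul (cf c j) (ε j)))) =
      (cf b i x * cf c j x) • coord F V n₀ x (B.bracket (ε i) (ε j) x)
        + (cf b i x * mvfderiv 𝓘(ℝ, E) (cf c j) x (B.anchor x (ε i x))) • β j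
        - (cf c j x * mvfderiv 𝓘(ℝ, E) (cf b i) x (B.anchor x (ε j x))) • β i := fun i j ↦ by
    change coord F V n₀ x (B.bracket (ContMDiffSection.funSMul (cf b i) (ε i))
      (ContMDiffSection.funSMul (cf c j) (ε j)) x) = _
    rw [bracket_funSMul_funSMul, map_sub, map_add, map_smul, map_smul, map_smul, hε, hε]
  simp only [map_sum, LinearMap.sum_apply, hterm]
  have hanchor : ∀ b : Cₛ^∞⟮𝓘(ℝ, E); F, V⟯,
      B.anchor x (b x) = ∑ i, cf b i x • B.anchor x (ε i x) := fun b ↦ by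
    rw [hval b, map_sum]
    simp only [map_smul]
  rw [structureMap_apply, hder, hder, hanchor b, hanchor c]
  simp only [← hβ, ← hcf, map_sum, map_smul, Finset.sum_add_distrib, Finset.sum_sub_distrib,
    smul_eq_mul, Finset.sum_smul]
  refine congrArg₂ _ (congrArg₂ _ ?_ ?_) ?_
  · rw [Finset.sum_comm]
  · rw [Finset.sum_comm]
  · rw [Finset.sum_comm]

end Frame

end LieAlgebroid

/-! ### Product rules -/

section Calculus

variable {EP : Type*} [NormedAddCommGroup EP] [NormedSpace ℝ EP]
  {HP : Type*} [TopologicalSpace HP] {IP : ModelWithCorners ℝ EP HP}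
  {P : Type*} [TopologicalSpace P] [ChartedSpace HP P]
  {G : Type*} [NormedAddCommGroup G] [NormedSpace ℝ G]
  {G' : Type*} [NormedAddCommGroup G'] [NormedSpace ℝ G']

theorem mvfderiv_clm_apply_const {A : P → G →L[ℝ] G'} {x : P}
    (hA : MDifferentiableAt IP 𝓘(ℝ, G →L[ℝ] G') A x) (u : G) (v : TangentSpace IP x) :
    mvfderiv IP (fun z ↦ A z u) x v = mvfderiv IP A x v u :=
  mvfderiv_clm_comp (ContinuousLinearMap.apply ℝ G' u) hA v

theorem mvfderiv_clm_apply_apply {A : P → G →L[ℝ] G →L[ℝ] G'} {g k : P → G} {x : P}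
    (hA : MDifferentiableAt IP 𝓘(ℝ, G →L[ℝ] G →L[ℝ] G') A x)
    (hg : MDifferentiableAt IP 𝓘(ℝ, G) g x) (hk : MDifferentiableAt IP 𝓘(ℝ, G) k x)
    (v : TangentSpace IP x) :
    mvfderiv IP (fun z ↦ A z (g z) (k z)) x v = mvfderiv IP A x v (g x) (k x) +
      A x (mvfderiv IP g x v) (k x) + A x (g x) (mvfderiv IP k x v) := by
  have h : MDifferentiableAt IP 𝓘(ℝ, G →L[ℝ] G') (fun z ↦ A z (g z)) x := hA.clm_apply hg
  rw [mvfderiv_clm_apply h hk, mvfderiv_clm_apply hA hg]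
  rfl

theorem mvfderiv_clm_apply_apply_const {A : P → G →L[ℝ] G →L[ℝ] G'} {x : P}
    (hA : MDifferentiableAt IP 𝓘(ℝ, G →L[ℝ] G →L[ℝ] G') A x) (u w : G) (v : TangentSpace IP x) :
    mvfderiv IP (fun z ↦ A z u w) x v = mvfderiv IP A x v u w := by
  rw [mvfderiv_clm_apply_apply hA mdifferentiableAt_const mdifferentiableAt_const, mvfderiv_const,
    mvfderiv_const]
  simp

end Calculus

/-! ### The structure equations of a Lie algebroid -/

namespace LieAlgebroid

section StructureEquations

variable {E : Type*} [NormedAddCommGroup E] [NormedSpace ℝ E] [FiniteDimensional ℝ E]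
  {N : Type*} [TopologicalSpace N] [T2Space N] [ChartedSpace E N] [IsManifold 𝓘(ℝ, E) ∞ N]
  {F : Type*} [NormedAddCommGroup F] [NormedSpace ℝ F] [FiniteDimensional ℝ F]
  {V : N → Type*} [TopologicalSpace (TotalSpace F V)]
  [∀ x, AddCommGroup (V x)] [∀ x, Module ℝ (V x)] [∀ x, TopologicalSpace (V x)]
  [FiberBundle F V] [VectorBundle ℝ F V] [ContMDiffVectorBundle ∞ F V 𝓘(ℝ, E)]
  (B : LieAlgebroid 𝓘(ℝ, E) F V)
  {G : Type*} [NormedAddCommGroup G] [NormedSpace ℝ G]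

theorem contMDiffAt_anchor_section (a : Cₛ^∞⟮𝓘(ℝ, E); F, V⟯) (x : N) :
    ContMDiffAt 𝓘(ℝ, E) 𝓘(ℝ, E).tangent ∞
      (fun z ↦ (⟨z, B.anchor z (a z)⟩ : TangentBundle 𝓘(ℝ, E) N)) x :=
  (B.contMDiff_anchor.comp a.contMDiff).contMDiffAt

/-- The derivative of a smooth function along the anchor of a section. -/
def anchorDeriv (a : Cₛ^∞⟮𝓘(ℝ, E); F, V⟯) (h : C^∞⟮𝓘(ℝ, E), N; ℝ⟯) : C^∞⟮𝓘(ℝ, E), N; ℝ⟯ :=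
  ⟨fun z ↦ mvfderiv 𝓘(ℝ, E) h z (B.anchor z (a z)), fun x ↦
    h.contMDiff.contMDiffAt.mvfderiv_apply (B.contMDiffAt_anchor_section a x)⟩

/-- The anchor is compatible with the brackets: this follows from the Jacobi identity for `a`, `b`
and `h • c`, if `c` does not vanish at the point in question. -/
theorem mvfderiv_anchor_bracket_smooth (a b : Cₛ^∞⟮𝓘(ℝ, E); F, V⟯) (h : C^∞⟮𝓘(ℝ, E), N; ℝ⟯)
    (x : N) :
    mvfderiv 𝓘(ℝ, E) h x (B.anchor x (B.bracket a b x)) =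
      mvfderiv 𝓘(ℝ, E) (B.anchorDeriv b h) x (B.anchor x (a x)) -
      mvfderiv 𝓘(ℝ, E) (B.anchorDeriv a h) x (B.anchor x (b x)) := by
  have hx := mem_frameNhd_self (E := E) (F := F) (V := V) x
  rcases subsingleton_or_nontrivial F with hF | hF
  · have h0 : ∀ v : V x, v = 0 := fun v ↦
      coord_injective (F := F) (frameNhd_subset_baseSet x hx) (Subsingleton.elim _ _)
    rw [h0 (a x), h0 (b x), h0 (B.bracket a b x), map_zero, map_zero, map_zero, map_zero, sub_zero]
  obtain ⟨u, hu⟩ := exists_ne (0 : F)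
  let c : Cₛ^∞⟮𝓘(ℝ, E); F, V⟯ := frameSection E V x u
  have hc : c x ≠ 0 := fun h0 ↦ hu (by
    rw [← coord_frameSection hx u]
    exact (congrArg _ h0).trans (map_zero _))
  have hL : ∀ (a b : Cₛ^∞⟮𝓘(ℝ, E); F, V⟯) (h : C^∞⟮𝓘(ℝ, E), N; ℝ⟯),
      B.bracket a (ContMDiffSection.funSMul h b) =
        ContMDiffSection.funSMul h (B.bracket a b) +
          ContMDiffSection.funSMul (B.anchorDeriv a h) b := fun a b h ↦ by
    ext z
    exact B.leibniz a b h z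
  have hJ := congrArg (fun s : Cₛ^∞⟮𝓘(ℝ, E); F, V⟯ ↦ s x)
    (B.jacobi a b (ContMDiffSection.funSMul h c))
  have hJc := congrArg (fun s : Cₛ^∞⟮𝓘(ℝ, E); F, V⟯ ↦ s x) (B.jacobi a b c)
  simp only [hL, map_add, ContMDiffSection.coe_add, Pi.add_apply] at hJ hJc
  have e : ∀ (k : C^∞⟮𝓘(ℝ, E), N; ℝ⟯) (s : Cₛ^∞⟮𝓘(ℝ, E); F, V⟯),
    ContMDiffSection.funSMul k s x = k x • s x := fun _ _ ↦ rfl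
  simp only [e, hJc] at hJ
  have e2 : ∀ (a : Cₛ^∞⟮𝓘(ℝ, E); F, V⟯) (k : C^∞⟮𝓘(ℝ, E), N; ℝ⟯),
    B.anchorDeriv a k x = mvfderiv 𝓘(ℝ, E) k x (B.anchor x (a x)) := fun _ _ ↦ rfl
  have h1 : (mvfderiv 𝓘(ℝ, E) h x (B.anchor x (B.bracket a b x)) -
      (mvfderiv 𝓘(ℝ, E) (B.anchorDeriv b h) x (B.anchor x (a x)) -
      mvfderiv 𝓘(ℝ, E) (B.anchorDeriv a h) x (B.anchor x (b x)))) • c x = 0 := by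
    rw [← e2, ← e2 a (B.anchorDeriv b h), ← e2 b (B.anchorDeriv a h), ← sub_eq_zero.2 hJ.symm]
    module
  exact sub_eq_zero.1 ((smul_eq_zero.1 h1).resolve_right hc)

/-- Compatibility of the anchor with the brackets, for local vector valued functions. -/
theorem mvfderiv_anchor_bracket (a b : Cₛ^∞⟮𝓘(ℝ, E); F, V⟯) {g : N → G} {x : N}
    (hg : ∀ᶠ z in 𝓝 x, ContMDiffAt 𝓘(ℝ, E) 𝓘(ℝ, G) ∞ g z) :
    mvfderiv 𝓘(ℝ, E) g x (B.anchor x (B.bracket a b x)) =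
      mvfderiv 𝓘(ℝ, E) (fun z ↦ mvfderiv 𝓘(ℝ, E) g z (B.anchor z (b z))) x (B.anchor x (a x)) -
      mvfderiv 𝓘(ℝ, E) (fun z ↦ mvfderiv 𝓘(ℝ, E) g z (B.anchor z (a z))) x (B.anchor x (b x)) := by
  refine (SeparatingDual.eq_iff_forall_dual_eq (R := ℝ)).2 fun ℓ ↦ ?_
  -- cut off `ℓ ∘ g` by a bump function to obtain a global smooth function `h`
  obtain ⟨ψ, -, hψ⟩ := (SmoothBumpFunction.nhds_basis_tsupport (I := 𝓘(ℝ, E)) x).mem_iff.1 hg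
  let h : C^∞⟮𝓘(ℝ, E), N; ℝ⟯ := ⟨fun z ↦ ψ z • ℓ (g z), by
    refine contMDiff_of_tsupport fun z hz ↦ ?_
    exact ψ.contMDiff.contMDiffAt.smul
      (ℓ.contMDiff.contMDiffAt.comp z (hψ (tsupport_smul_subset_left _ _ hz)))⟩
  have hh : ∀ᶠ z in 𝓝 x, (h : N → ℝ) =ᶠ[𝓝 z] fun y ↦ ℓ (g y) := by
    filter_upwards [ψ.eventuallyEq_one.eventually_nhds] with z hz
    filter_upwards [hz] with y hy
    change ψ y • ℓ (g y) = _
    rw [hy, Pi.one_apply, one_smul]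
  have hd : ∀ᶠ z in 𝓝 x, ∀ v : TangentSpace 𝓘(ℝ, E) z,
      mvfderiv 𝓘(ℝ, E) h z v = ℓ (mvfderiv 𝓘(ℝ, E) g z v) := by
    filter_upwards [hh, hg] with z hz hgz v
    rw [hz.mvfderiv_eq, mvfderiv_clm_comp ℓ (hgz.mdifferentiableAt (by simp))]
  have h2 : ∀ (a : Cₛ^∞⟮𝓘(ℝ, E); F, V⟯) (v : TangentSpace 𝓘(ℝ, E) x),
      mvfderiv 𝓘(ℝ, E) (B.anchorDeriv a h) x v =
        ℓ (mvfderiv 𝓘(ℝ, E) (fun z ↦ mvfderiv 𝓘(ℝ, E) g z (B.anchor z (a z))) x v) := fun a v ↦ by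
    have h3 : (B.anchorDeriv a h : N → ℝ) =ᶠ[𝓝 x]
        fun z ↦ ℓ (mvfderiv 𝓘(ℝ, E) g z (B.anchor z (a z))) := by
      filter_upwards [hd] with z hz using hz _
    rw [h3.mvfderiv_eq, mvfderiv_clm_comp ℓ]
    exact (hg.self_of_nhds.mvfderiv_apply
      (B.contMDiffAt_anchor_section a x)).mdifferentiableAt (by simp)
  rw [map_sub, ← h2, ← h2, ← hd.self_of_nhds]
  exact B.mvfderiv_anchor_bracket_smooth a b h x

theorem structureMap_swap (n₀ n : N) (u v : F) :
    B.structureMap n₀ n u v = -B.structureMap n₀ n v u := by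
  rw [structureMap_apply, structureMap_apply, Finset.sum_comm]
  simp only [← Finset.sum_neg_distrib]
  refine Finset.sum_congr rfl fun i _ ↦ Finset.sum_congr rfl fun j _ ↦ ?_
  rw [B.bracket_swap (frameSection E V n₀ (Module.finBasis ℝ F i))]
  have h : ∀ s : Cₛ^∞⟮𝓘(ℝ, E); F, V⟯, (-s) n = -(s n) := fun _ ↦ rfl
  rw [h, map_neg, smul_neg, mul_comm, neg_neg]

theorem structureMap_eq_coord_bracket {n₀ n : N} (hn : n ∈ frameNhd E F V n₀) (u v : F) :
    B.structureMap n₀ n u v =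
      coord F V n₀ n (B.bracket (frameSection E V n₀ u) (frameSection E V n₀ v) n) := by
  rw [B.coord_bracket hn, mvfderiv_coord_frameSection hn, mvfderiv_coord_frameSection hn,
    coord_frameSection hn, coord_frameSection hn, add_zero, sub_zero]

theorem bracket_frameSection {n₀ n : N} (hn : n ∈ frameNhd E F V n₀) (u v : F) :
    B.bracket (frameSection E V n₀ u) (frameSection E V n₀ v) n =
      frameVec F V n₀ n (B.structureMap n₀ n u v) := by
  rw [B.structureMap_eq_coord_bracket hn, frameVec_coord (frameNhd_subset_baseSet n₀ hn)]

/-- The anchor in the local frame and the chart at `n₀`. -/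
def anchorMatrix (n₀ n : N) : F →L[ℝ] E :=
  ∑ i, ((Module.finBasis ℝ F).coord i).toContinuousLinearMap.smulRight
    (mvfderiv 𝓘(ℝ, E) (extChartAt 𝓘(ℝ, E) n₀) n
      (B.anchor n (frameSection E V n₀ (Module.finBasis ℝ F i) n)))

theorem anchorMatrix_apply {n₀ n : N} (hn : n ∈ frameNhd E F V n₀) (u : F) :
    B.anchorMatrix n₀ n u =
      mvfderiv 𝓘(ℝ, E) (extChartAt 𝓘(ℝ, E) n₀) n (B.anchor n (frameVec F V n₀ n u)) := by
  conv_rhs => rw [← (Module.finBasis ℝ F).sum_repr u]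
  simp only [anchorMatrix, sum_apply, frameSection_apply hn, map_sum, map_smul]
  rfl

theorem anchorMatrix_coord {n₀ n : N} (hn : n ∈ frameNhd E F V n₀) (b : V n) :
    B.anchorMatrix n₀ n (coord F V n₀ n b) =
      mvfderiv 𝓘(ℝ, E) (extChartAt 𝓘(ℝ, E) n₀) n (B.anchor n b) := by
  rw [B.anchorMatrix_apply hn, frameVec_coord (frameNhd_subset_baseSet n₀ hn)]

theorem frameNhd_subset_extChartAt_source (n₀ : N) :
    frameNhd E F V n₀ ⊆ (extChartAt 𝓘(ℝ, E) n₀).source := by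
  rw [extChartAt_source]
  exact frameNhd_subset_source n₀

theorem contMDiffAt_anchorMatrix {n₀ n : N} (hn : n ∈ frameNhd E F V n₀) :
    ContMDiffAt 𝓘(ℝ, E) 𝓘(ℝ, F →L[ℝ] E) ∞ (B.anchorMatrix n₀) n := by
  unfold anchorMatrix
  refine contMDiffAt_finsetSum fun i _ ↦ ContMDiffAt.clm_smulRight _ ?_
  exact (contMDiffAt_extChartAt' (frameNhd_subset_source n₀ hn)).mvfderiv_apply
    (B.contMDiffAt_anchor_section _ n)

/-- The compatibility of anchor and bracket, in a local frame. -/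
theorem anchorMatrix_structureMap {n₀ n : N} (hn : n ∈ frameNhd E F V n₀) (u v : F) :
    B.anchorMatrix n₀ n (B.structureMap n₀ n u v) =
      mvfderiv 𝓘(ℝ, E) (B.anchorMatrix n₀) n (B.anchor n (frameVec F V n₀ n u)) v -
      mvfderiv 𝓘(ℝ, E) (B.anchorMatrix n₀) n (B.anchor n (frameVec F V n₀ n v)) u := by
  have hW := (isOpen_frameNhd (E := E) (F := F) (V := V) n₀).mem_nhds hn
  have hg : ∀ᶠ z in 𝓝 n, ContMDiffAt 𝓘(ℝ, E) 𝓘(ℝ, E) ∞ (extChartAt 𝓘(ℝ, E) n₀) z := by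
    filter_upwards [hW] with z hz using contMDiffAt_extChartAt' (frameNhd_subset_source n₀ hz)
  have h := B.mvfderiv_anchor_bracket (frameSection E V n₀ u) (frameSection E V n₀ v) hg
  rw [B.bracket_frameSection hn, ← B.anchorMatrix_apply hn] at h
  have h2 : ∀ (u : F) (w : TangentSpace 𝓘(ℝ, E) n), mvfderiv 𝓘(ℝ, E) (fun z ↦
      mvfderiv 𝓘(ℝ, E) (extChartAt 𝓘(ℝ, E) n₀) z (B.anchor z (frameSection E V n₀ u z))) n w =
      mvfderiv 𝓘(ℝ, E) (B.anchorMatrix n₀) n w u := fun u w ↦ by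
    have h3 : (fun z ↦ mvfderiv 𝓘(ℝ, E) (extChartAt 𝓘(ℝ, E) n₀) z
        (B.anchor z (frameSection E V n₀ u z))) =ᶠ[𝓝 n] fun z ↦ B.anchorMatrix n₀ z u := by
      filter_upwards [hW] with z hz
      rw [B.anchorMatrix_apply hz, frameSection_apply hz]
    rw [h3.mvfderiv_eq]
    exact mvfderiv_clm_apply_const
      ((B.contMDiffAt_anchorMatrix hn).mdifferentiableAt (by simp)) u w
  rw [h, h2, h2, frameSection_apply hn, frameSection_apply hn]

/-- The derivative of the structure functions. -/
def structureDeriv (n₀ n : N) (a u v : F) : F :=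
  mvfderiv 𝓘(ℝ, E) (B.structureMap n₀) n (B.anchor n (frameVec F V n₀ n a)) u v

theorem mvfderiv_structureMap_apply {n₀ n : N} (hn : n ∈ frameNhd E F V n₀) (u v : F)
    (w : TangentSpace 𝓘(ℝ, E) n) :
    mvfderiv 𝓘(ℝ, E) (fun z ↦ B.structureMap n₀ z u v) n w =
      mvfderiv 𝓘(ℝ, E) (B.structureMap n₀) n w u v :=
  mvfderiv_clm_apply_apply_const
    ((B.contMDiffAt_structureMap hn).mdifferentiableAt (by simp)) u v w

/-- The Jacobi identity in a local frame. -/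
theorem structureMap_jacobi {n₀ n : N} (hn : n ∈ frameNhd E F V n₀) (u v w : F) :
    B.structureMap n₀ n u (B.structureMap n₀ n v w) + B.structureDeriv n₀ n u v w =
      B.structureMap n₀ n (B.structureMap n₀ n u v) w - B.structureDeriv n₀ n w u v +
      (B.structureMap n₀ n v (B.structureMap n₀ n u w) + B.structureDeriv n₀ n v u w) := by
  have hW := (isOpen_frameNhd (E := E) (F := F) (V := V) n₀).mem_nhds hn
  have h := congrArg (fun s : Cₛ^∞⟮𝓘(ℝ, E); F, V⟯ ↦ coord F V n₀ n (s n)) (B.jacobi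
    (frameSection E V n₀ u) (frameSection E V n₀ v) (frameSection E V n₀ w))
  have hadd : ∀ s t : Cₛ^∞⟮𝓘(ℝ, E); F, V⟯, (s + t) n = s n + t n := fun _ _ ↦ rfl
  have hd : ∀ (u v : F) (x : TangentSpace 𝓘(ℝ, E) n), mvfderiv 𝓘(ℝ, E) (fun z ↦ coord F V n₀ z
      (B.bracket (frameSection E V n₀ u) (frameSection E V n₀ v) z)) n x =
      mvfderiv 𝓘(ℝ, E) (B.structureMap n₀) n x u v := fun u v x ↦ by
    rw [← B.mvfderiv_structureMap_apply hn]
    refine congrArg (fun L ↦ L x) (Filter.EventuallyEq.mvfderiv_eq (G := F) ?_)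
    filter_upwards [hW] with z hz using (B.structureMap_eq_coord_bracket hz u v).symm
  simp only [hadd, map_add, B.coord_bracket hn (frameSection E V n₀ _) (B.bracket _ _),
    B.coord_bracket hn (B.bracket _ _) (frameSection E V n₀ _), hd,
    mvfderiv_coord_frameSection hn,
    ← B.structureMap_eq_coord_bracket hn, frameSection_apply hn] at h
  have hb := frameNhd_subset_baseSet n₀ hn
  simp only [structureDeriv]
  rw [sub_zero, add_zero, sub_zero, coord_frameVec hb, coord_frameVec hb, coord_frameVec hb] at h
  exact h

variable (F V) in
/-- The change of frame from `n₀` to `n₁`. -/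
def frameChange (n₀ n₁ n : N) : F →L[ℝ] F :=
  (coord F V n₁ n ∘ₗ frameVec F V n₀ n).toContinuousLinearMap

theorem frameChange_apply (n₀ n₁ n : N) (u : F) :
    frameChange F V n₀ n₁ n u = coord F V n₁ n (frameVec F V n₀ n u) := rfl

theorem frameChange_coord {n₀ n₁ n : N} (hn : n ∈ (trivializationAt F V n₀).baseSet) (v : V n) :
    frameChange F V n₀ n₁ n (coord F V n₀ n v) = coord F V n₁ n v :=
  congrArg (coord F V n₁ n) (frameVec_coord hn v)

theorem contMDiffAt_frameChange {n₀ n₁ n : N} (hn : n ∈ (trivializationAt F V n₀).baseSet)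
    (hn₁ : n ∈ (trivializationAt F V n₁).baseSet) :
    ContMDiffAt 𝓘(ℝ, E) 𝓘(ℝ, F →L[ℝ] F) ∞ (frameChange F V n₀ n₁) n := by
  refine ((contMDiffOn_coordChangeL (IB := 𝓘(ℝ, E)) (n := ∞) (trivializationAt F V n₀)
    (trivializationAt F V n₁)).contMDiffAt ((((trivializationAt F V n₀).open_baseSet.inter
    (trivializationAt F V n₁).open_baseSet)).mem_nhds ⟨hn, hn₁⟩)).congr_of_eventuallyEq ?_
  filter_upwards [(trivializationAt F V n₀).open_baseSet.mem_nhds hn,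
    (trivializationAt F V n₁).open_baseSet.mem_nhds hn₁] with z hz hz₁
  ext u
  rw [ContinuousLinearEquiv.coe_coe, Trivialization.coordChangeL_apply _ _ ⟨hz, hz₁⟩]
  rw [frameChange_apply, frameVec, Trivialization.coe_symmₗ _ hz]
  exact coord_eq hz₁ _

/-- The behaviour of the structure functions under a change of frame. -/
theorem structureMap_frameChange {n₀ n₁ n : N} (hn : n ∈ frameNhd E F V n₀)
    (hn₁ : n ∈ frameNhd E F V n₁) (u v : F) :
    B.structureMap n₁ n (frameChange F V n₀ n₁ n u) (frameChange F V n₀ n₁ n v) =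
      frameChange F V n₀ n₁ n (B.structureMap n₀ n u v) -
      mvfderiv 𝓘(ℝ, E) (frameChange F V n₀ n₁) n (B.anchor n (frameVec F V n₀ n u)) v +
      mvfderiv 𝓘(ℝ, E) (frameChange F V n₀ n₁) n (B.anchor n (frameVec F V n₀ n v)) u := by
  have hb := frameNhd_subset_baseSet n₀ hn
  have hb₁ := frameNhd_subset_baseSet n₁ hn₁
  have h := B.coord_bracket hn₁ (frameSection E V n₀ u) (frameSection E V n₀ v)
  have hd : ∀ (u : F) (x : TangentSpace 𝓘(ℝ, E) n),
      mvfderiv 𝓘(ℝ, E) (fun z ↦ coord F V n₁ z (frameSection E V n₀ u z)) n x =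
        mvfderiv 𝓘(ℝ, E) (frameChange F V n₀ n₁) n x u := fun u x ↦ by
    refine Eq.trans ?_ (mvfderiv_clm_apply_const
      ((contMDiffAt_frameChange hb hb₁).mdifferentiableAt (by simp)) u x)
    refine congrArg (fun L ↦ L x) (Filter.EventuallyEq.mvfderiv_eq (G := F) ?_)
    filter_upwards [(isOpen_frameNhd n₀).mem_nhds hn] with z hz
    rw [frameSection_apply hz]
    rfl
  rw [hd, hd, ← frameChange_coord hb, ← B.structureMap_eq_coord_bracket hn,
    frameSection_apply hn, frameSection_apply hn] at h
  rw [h]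
  change _ = B.structureMap n₁ n (frameChange F V n₀ n₁ n u) (frameChange F V n₀ n₁ n v) + _ - _
    - _ + _
  abel

end StructureEquations
end LieAlgebroid

/-! ### The bracket of a pullback Lie algebroid -/

namespace LieAlgebroid

section PullbackBracket

variable {E : Type*} [NormedAddCommGroup E] [NormedSpace ℝ E] [FiniteDimensional ℝ E]
  {N : Type*} [TopologicalSpace N] [T2Space N] [ChartedSpace E N] [IsManifold 𝓘(ℝ, E) ∞ N]
  {F : Type*} [NormedAddCommGroup F] [NormedSpace ℝ F] [FiniteDimensional ℝ F]
  {V : N → Type*} [TopologicalSpace (TotalSpace F V)]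
  [∀ x, AddCommGroup (V x)] [∀ x, Module ℝ (V x)] [∀ x, TopologicalSpace (V x)]
  [FiberBundle F V] [VectorBundle ℝ F V] [ContMDiffVectorBundle ∞ F V 𝓘(ℝ, E)]
  {B : LieAlgebroid 𝓘(ℝ, E) F V}
  {EP : Type*} [NormedAddCommGroup EP] [NormedSpace ℝ EP] [CompleteSpace EP]
  {HP : Type*} [TopologicalSpace HP] {IP : ModelWithCorners ℝ EP HP} [IP.Boundaryless]
  {P : Type*} [TopologicalSpace P] [ChartedSpace HP P] [IsManifold IP ∞ P]
  {f : P → N}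

theorem PullbackSection.mfderiv_fst (σ : B.PullbackSection IP f) (x : P) :
    mfderiv IP 𝓘(ℝ, E) f x (σ.fst x) = B.anchor (f x) (σ.snd x) := (σ.toFun x).2

theorem PullbackSection.contMDiff_fst (σ : B.PullbackSection IP f) :
    ContMDiff IP IP.tangent ∞ (fun x ↦ (⟨x, σ.fst x⟩ : TangentBundle IP P)) :=
  _root_.contMDiff_fst.comp σ.contMDiff_toFun

theorem PullbackSection.contMDiff_snd (σ : B.PullbackSection IP f) :
    ContMDiff IP (𝓘(ℝ, E).prod 𝓘(ℝ, F)) ∞ (fun x ↦ (⟨f x, σ.snd x⟩ : TotalSpace F V)) :=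
  _root_.contMDiff_snd.comp σ.contMDiff_toFun

/-- The components of the second component of a section of `f^{!!}B`, in the frame at `n₀`. -/
def PullbackSection.sndCoord (σ : B.PullbackSection IP f) (n₀ : N) (x : P) : F :=
  coord F V n₀ (f x) (σ.snd x)

theorem PullbackSection.contMDiffAt_sndCoord (σ : B.PullbackSection IP f) {n₀ : N} {x : P}
    (hx : f x ∈ frameNhd E F V n₀) : ContMDiffAt IP 𝓘(ℝ, F) ∞ (σ.sndCoord n₀) x :=
  ((contMDiffAt_iff_coord (frameNhd_subset_baseSet n₀ hx)).1 (σ.contMDiff_snd x)).2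

/-- The components, in the frame at `n₀`, of the second component of the bracket of two sections of
`f^{!!}B`. -/
def PullbackSection.bracketCoord (σ τ : B.PullbackSection IP f) (n₀ : N) (x : P) : F :=
  B.structureMap n₀ (f x) (σ.sndCoord n₀ x) (τ.sndCoord n₀ x)
    + mvfderiv IP (τ.sndCoord n₀) x (σ.fst x) - mvfderiv IP (σ.sndCoord n₀) x (τ.fst x)

theorem PullbackSection.IsDecomposition.mvfderiv_sndCoord {σ : B.PullbackSection IP f} {x : P}
    {n : ℕ} {h : Fin n → P → ℝ} {b : Fin n → Cₛ^∞⟮𝓘(ℝ, E); F, V⟯} (hσ : σ.IsDecomposition x h b)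
    (hf : MDifferentiableAt IP 𝓘(ℝ, E) f x) {n₀ : N} (hx : f x ∈ frameNhd E F V n₀)
    (v : TangentSpace IP x) :
    mvfderiv IP (σ.sndCoord n₀) x v =
      ∑ i, (mvfderiv IP (h i) x v • coord F V n₀ (f x) (b i (f x)) +
        h i x • mvfderiv 𝓘(ℝ, E) (fun z ↦ coord F V n₀ z (b i z)) (f x)
          (mfderiv IP 𝓘(ℝ, E) f x v)) := by
  have h1 : σ.sndCoord n₀ =ᶠ[𝓝 x] fun z ↦ ∑ i, h i z • coord F V n₀ (f z) (b i (f z)) := by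
    filter_upwards [hσ.2] with z hz
    rw [PullbackSection.sndCoord, hz, map_sum]
    simp only [map_smul]
  have hh : ∀ i, MDifferentiableAt IP 𝓘(ℝ, ℝ) (h i) x := fun i ↦
    (hσ.1 i).mdifferentiableAt (by simp)
  have hb : ∀ i, MDifferentiableAt 𝓘(ℝ, E) 𝓘(ℝ, F) (fun z ↦ coord F V n₀ z (b i z)) (f x) :=
    fun i ↦ (contMDiffAt_coord_section (frameNhd_subset_baseSet n₀ hx) (b i)).mdifferentiableAt
      (by simp)
  have hbf : ∀ i, MDifferentiableAt IP 𝓘(ℝ, F) (fun z ↦ coord F V n₀ (f z) (b i (f z))) x :=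
    fun i ↦ (hb i).comp x hf
  have hs : ∀ i, MDifferentiableAt IP 𝓘(ℝ, F)
      (fun z ↦ h i z • coord F V n₀ (f z) (b i (f z))) x := fun i ↦ (hh i).smul (hbf i)
  rw [h1.mvfderiv_eq, mvfderiv_sum _ fun i _ ↦ hs i]
  refine Finset.sum_congr rfl fun i _ ↦ ?_
  have h2 := mvfderiv_clm_apply (A := fun z ↦ ContinuousLinearMap.lsmul ℝ ℝ (h i z) (E := F))
    ((ContinuousLinearMap.lsmul ℝ ℝ (E := F)).mdifferentiableAt.comp x (hh i)) (hbf i) v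
  rw [mvfderiv_clm_comp (ContinuousLinearMap.lsmul ℝ ℝ (E := F)) (hh i),
    mvfderiv_comp_vec (hb i) hf] at h2
  exact h2

/-- The formula that defines the bracket of a pullback Lie algebroid, in a local frame. In
particular it does not depend on the decompositions of the two sections. -/
theorem PullbackSection.coord_bracket_eq {σ τ : B.PullbackSection IP f} {x : P}
    (hf : MDifferentiableAt IP 𝓘(ℝ, E) f x) {n₀ : N} (hx : f x ∈ frameNhd E F V n₀)
    {n m : ℕ} {h : Fin n → P → ℝ} {b : Fin n → Cₛ^∞⟮𝓘(ℝ, E); F, V⟯}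
    {g : Fin m → P → ℝ} {c : Fin m → Cₛ^∞⟮𝓘(ℝ, E); F, V⟯}
    (hσ : σ.IsDecomposition x h b) (hτ : τ.IsDecomposition x g c) :
    coord F V n₀ (f x) (∑ i, ∑ j, (h i x * g j x) • B.bracket (b i) (c j) (f x)
        + ∑ j, mvfderiv IP (g j) x (σ.fst x) • c j (f x)
        - ∑ i, mvfderiv IP (h i) x (τ.fst x) • b i (f x)) = σ.bracketCoord τ n₀ x := by
  have h1 : σ.sndCoord n₀ x = ∑ i, h i x • coord F V n₀ (f x) (b i (f x)) := by
    rw [PullbackSection.sndCoord, hσ.2.self_of_nhds, map_sum]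
    simp only [map_smul]
  have h2 : τ.sndCoord n₀ x = ∑ i, g i x • coord F V n₀ (f x) (c i (f x)) := by
    rw [PullbackSection.sndCoord, hτ.2.self_of_nhds, map_sum]
    simp only [map_smul]
  have h3 : B.anchor (f x) (σ.snd x) = ∑ i, h i x • B.anchor (f x) (b i (f x)) := by
    rw [hσ.2.self_of_nhds, map_sum]
    simp only [map_smul]
  have h4 : B.anchor (f x) (τ.snd x) = ∑ i, g i x • B.anchor (f x) (c i (f x)) := by
    rw [hτ.2.self_of_nhds, map_sum]
    simp only [map_smul]
  rw [PullbackSection.bracketCoord, hσ.mvfderiv_sndCoord hf hx, hτ.mvfderiv_sndCoord hf hx,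
    σ.mfderiv_fst, τ.mfderiv_fst, h1, h2, h3, h4]
  simp only [map_add, map_sub, map_sum, map_smul, B.coord_bracket hx, sum_apply,
    _root_.smul_apply, Finset.sum_add_distrib, Finset.sum_sub_distrib, smul_add,
    smul_sub, Finset.smul_sum, smul_smul]
  have hc : ∀ A : Fin n → Fin m → F,
      ∑ j, ∑ i, (g j x * h i x) • A i j = ∑ i, ∑ j, (h i x * g j x) • A i j := fun A ↦ by
    rw [Finset.sum_comm]
    simp only [mul_comm]
  rw [hc fun i j ↦ B.structureMap n₀ (f x) (coord F V n₀ (f x) (b i (f x)))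
    (coord F V n₀ (f x) (c j (f x))), hc fun i j ↦ mvfderiv 𝓘(ℝ, E)
      (fun z ↦ coord F V n₀ z (c j z)) (f x) (B.anchor (f x) (b i (f x)))]
  abel

theorem PullbackSection.frameVec_bracketCoord (σ τ : B.PullbackSection IP f) {x : P}
    (hf : MDifferentiableAt IP 𝓘(ℝ, E) f x) {n₀ n₁ : N} (hx : f x ∈ frameNhd E F V n₀)
    (hx₁ : f x ∈ frameNhd E F V n₁) :
    frameVec F V n₀ (f x) (σ.bracketCoord τ n₀ x) =
      frameVec F V n₁ (f x) (σ.bracketCoord τ n₁ x) := by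
  obtain ⟨n, h, b, hσ⟩ := σ.exists_isDecomposition x
  obtain ⟨m, g, c, hτ⟩ := τ.exists_isDecomposition x
  rw [← coord_bracket_eq hf hx hσ hτ, ← coord_bracket_eq hf hx₁ hσ hτ,
    frameVec_coord (frameNhd_subset_baseSet n₀ hx), frameVec_coord (frameNhd_subset_baseSet n₁ hx₁)]

theorem PullbackSection.isPullbackBracket_of_coord {σ τ υ : B.PullbackSection IP f}
    (hf : MDifferentiable IP 𝓘(ℝ, E) f)
    (h1 : ∀ x, υ.fst x = VectorField.mlieBracket IP σ.fst τ.fst x)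
    (h2 : ∀ x, ∃ n₀, f x ∈ frameNhd E F V n₀ ∧ υ.sndCoord n₀ x = σ.bracketCoord τ n₀ x) :
    IsPullbackBracket σ τ υ := by
  refine fun x ↦ ⟨h1 x, fun n m h b g c hσ hτ ↦ ?_⟩
  obtain ⟨n₀, hx, h⟩ := h2 x
  apply coord_injective (frameNhd_subset_baseSet n₀ hx)
  rw [coord_bracket_eq (hf x) hx hσ hτ, ← h]
  rfl

theorem IsPullbackBracket.sndCoord_eq {σ τ υ : B.PullbackSection IP f}
    (h : IsPullbackBracket σ τ υ) (hf : MDifferentiable IP 𝓘(ℝ, E) f) {n₀ : N} {x : P}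
    (hx : f x ∈ frameNhd E F V n₀) : υ.sndCoord n₀ x = σ.bracketCoord τ n₀ x := by
  obtain ⟨n, k, b, hσ⟩ := σ.exists_isDecomposition x
  obtain ⟨m, g, c, hτ⟩ := τ.exists_isDecomposition x
  rw [← PullbackSection.coord_bracket_eq (hf x) hx hσ hτ, ← (h x).2 n m k b g c hσ hτ]
  rfl

theorem PullbackSection.contMDiffAt_bracketCoord (σ τ : B.PullbackSection IP f)
    (hf : ContMDiff IP 𝓘(ℝ, E) ∞ f) {n₀ : N} {x : P}
    (hx : f x ∈ frameNhd E F V n₀) : ContMDiffAt IP 𝓘(ℝ, F) ∞ (σ.bracketCoord τ n₀) x := by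
  unfold bracketCoord
  exact (((((B.contMDiffAt_structureMap hx).comp x hf.contMDiffAt).clm_apply
    (σ.contMDiffAt_sndCoord hx)).clm_apply (τ.contMDiffAt_sndCoord hx)).add
    ((τ.contMDiffAt_sndCoord hx).mvfderiv_apply (σ.contMDiff_fst x))).sub
    ((σ.contMDiffAt_sndCoord hx).mvfderiv_apply (τ.contMDiff_fst x))

theorem PullbackSection.mvfderiv_sndCoord_anchor (τ : B.PullbackSection IP f)
    (hf : ContMDiff IP 𝓘(ℝ, E) ∞ f) {n₀ : N} {x : P} (hx : f x ∈ frameNhd E F V n₀) :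
    mvfderiv IP (fun z ↦ extChartAt 𝓘(ℝ, E) n₀ (f z)) x (τ.fst x) =
      B.anchorMatrix n₀ (f x) (τ.sndCoord n₀ x) := by
  rw [mvfderiv_comp_vec (mdifferentiableAt_extChartAt (frameNhd_subset_source n₀ hx))
    (hf.mdifferentiableAt (by simp)), τ.mfderiv_fst, ← B.anchorMatrix_coord hx]
  rfl

theorem mvfderiv_extChartAt_injective {n₀ n : N} (hn : n ∈ (extChartAt 𝓘(ℝ, E) n₀).source)
    {v w : TangentSpace 𝓘(ℝ, E) n} (h : mvfderiv 𝓘(ℝ, E) (extChartAt 𝓘(ℝ, E) n₀) n v =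
      mvfderiv 𝓘(ℝ, E) (extChartAt 𝓘(ℝ, E) n₀) n w) : v = w := by
  have h1 : IsManifold 𝓘(ℝ, E) 1 N := .of_le (n := ∞) (by simp)
  rw [← trivializationAt_tangent_eq_mvfderiv hn, ← trivializationAt_tangent_eq_mvfderiv hn] at h
  have hb : n ∈ (trivializationAt E (TangentSpace 𝓘(ℝ, E)) n₀).baseSet := by
    rwa [extChartAt_source] at hn
  have h2 : (⟨n, v⟩ : TangentBundle 𝓘(ℝ, E) N) = ⟨n, w⟩ :=
    (trivializationAt E (TangentSpace 𝓘(ℝ, E)) n₀).injOn (by rwa [Trivialization.mem_source])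
      (by rwa [Trivialization.mem_source]) (Prod.ext
        ((Trivialization.coe_fst' _ hb).trans (Trivialization.coe_fst'
          (trivializationAt E (TangentSpace 𝓘(ℝ, E)) n₀) (x := ⟨n, w⟩) hb).symm) h)
  exact TotalSpace.mk_inj.1 h2

/-- The bracket of two sections of `f^{!!}B` takes its values in `f^{!!}B`. -/
theorem PullbackSection.mfderiv_mlieBracket (σ τ : B.PullbackSection IP f)
    (hf : ContMDiff IP 𝓘(ℝ, E) ∞ f) {n₀ : N} {x : P} (hx : f x ∈ frameNhd E F V n₀) :
    mfderiv IP 𝓘(ℝ, E) f x (VectorField.mlieBracket IP σ.fst τ.fst x) =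
      B.anchor (f x) (frameVec F V n₀ (f x) (σ.bracketCoord τ n₀ x)) := by
  have hs := frameNhd_subset_extChartAt_source (E := E) (F := F) (V := V) n₀
  have hb := frameNhd_subset_baseSet (E := E) (F := F) (V := V) n₀ hx
  have hW : ∀ᶠ z in 𝓝 x, f z ∈ frameNhd E F V n₀ :=
    hf.continuous.continuousAt.eventually_mem ((isOpen_frameNhd n₀).mem_nhds hx)
  have hκ : ContMDiffAt 𝓘(ℝ, E) 𝓘(ℝ, E) ∞ (extChartAt 𝓘(ℝ, E) n₀) (f x) :=
    contMDiffAt_extChartAt' (frameNhd_subset_source n₀ hx)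
  have hκf : ContMDiffAt IP 𝓘(ℝ, E) ∞ (fun z ↦ extChartAt 𝓘(ℝ, E) n₀ (f z)) x :=
    hκ.comp x hf.contMDiffAt
  apply mvfderiv_extChartAt_injective (hs hx)
  rw [← B.anchorMatrix_apply hx, ← mvfderiv_comp_vec (hκ.mdifferentiableAt (by simp))
    (hf.mdifferentiableAt (by simp)), mvfderiv_mlieBracket hκf
      (σ.contMDiff_fst x) (τ.contMDiff_fst x)]
  have key : ∀ (τ : B.PullbackSection IP f) (v : TangentSpace IP x),
      mvfderiv IP (fun z ↦ mvfderiv IP (fun y ↦ extChartAt 𝓘(ℝ, E) n₀ (f y)) z (τ.fst z)) x v =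
        mvfderiv 𝓘(ℝ, E) (B.anchorMatrix n₀) (f x) (mfderiv IP 𝓘(ℝ, E) f x v) (τ.sndCoord n₀ x) +
        B.anchorMatrix n₀ (f x) (mvfderiv IP (τ.sndCoord n₀) x v) := fun τ v ↦ by
    have h1 : (fun z ↦ mvfderiv IP (fun y ↦ extChartAt 𝓘(ℝ, E) n₀ (f y)) z (τ.fst z)) =ᶠ[𝓝 x]
        fun z ↦ B.anchorMatrix n₀ (f z) (τ.sndCoord n₀ z) := by
      filter_upwards [hW] with z hz using τ.mvfderiv_sndCoord_anchor hf hz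
    have hA := (B.contMDiffAt_anchorMatrix hx).mdifferentiableAt (n := ∞) (by simp)
    have hf' : MDifferentiableAt IP 𝓘(ℝ, E) f x := hf.mdifferentiableAt (by simp)
    rw [h1.mvfderiv_eq, mvfderiv_clm_apply (A := fun z ↦ B.anchorMatrix n₀ (f z))
      (hA.comp x hf') ((τ.contMDiffAt_sndCoord hx).mdifferentiableAt (by simp)),
      mvfderiv_comp_vec hA hf']
  rw [key, key, σ.mfderiv_fst, τ.mfderiv_fst, PullbackSection.bracketCoord, map_sub, map_add,
    B.anchorMatrix_structureMap hx]
  simp only [PullbackSection.sndCoord, frameVec_coord hb]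
  abel

/-- The bracket of two sections of `f^{!!}B`. -/
def PullbackSection.bracket (σ τ : B.PullbackSection IP f) (hf : ContMDiff IP 𝓘(ℝ, E) ∞ f) :
    B.PullbackSection IP f where
  toFun x := ⟨(VectorField.mlieBracket IP σ.fst τ.fst x,
    frameVec F V (f x) (f x) (σ.bracketCoord τ (f x) x)),
    σ.mfderiv_mlieBracket τ hf (mem_frameNhd_self (f x))⟩
  contMDiff_toFun x := by
    refine ContMDiffAt.prodMk ?_ ?_
    · have h1 : IsManifold IP (minSmoothness ℝ 2) P := .of_le (n := ∞) (by
        rw [minSmoothness_of_isRCLikeNormedField]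
        exact WithTop.coe_le_coe.2 (le_top : (2 : ℕ∞) ≤ ⊤))
      have h2 : IsManifold IP ((⊤ : ℕ∞) + 1) P := .of_le (n := ∞) le_rfl
      exact ContMDiffAt.mlieBracket_vectorField (m := ⊤) (n := ⊤) (σ.contMDiff_fst x)
        (τ.contMDiff_fst x) (by rw [minSmoothness_of_isRCLikeNormedField]; rfl)
    · have hx := mem_frameNhd_self (E := E) (F := F) (V := V) (f x)
      refine (contMDiffAt_iff_coord (frameNhd_subset_baseSet _ hx)).2 ⟨hf.contMDiffAt,
        (σ.contMDiffAt_bracketCoord τ hf hx).congr_of_eventuallyEq ?_⟩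
      filter_upwards [hf.continuous.continuousAt.eventually_mem
        ((isOpen_frameNhd (f x)).mem_nhds hx)] with z hz
      rw [σ.frameVec_bracketCoord τ (hf.mdifferentiableAt (by simp)) (mem_frameNhd_self (f z)) hz,
        coord_frameVec (frameNhd_subset_baseSet _ hz)]

theorem PullbackSection.isPullbackBracket_bracket (σ τ : B.PullbackSection IP f)
    (hf : ContMDiff IP 𝓘(ℝ, E) ∞ f) : IsPullbackBracket σ τ (σ.bracket τ hf) := by
  refine isPullbackBracket_of_coord (hf.mdifferentiable (by simp)) (fun _ ↦ rfl)
    fun x ↦ ⟨f x, mem_frameNhd_self _, ?_⟩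
  exact coord_frameVec (frameNhd_subset_baseSet (E := E) _ (mem_frameNhd_self _)) _

end PullbackBracket
end LieAlgebroid

/-! ### Calculus on the product of an open subset of the line with a manifold -/

section TimeCalculus

variable {J : Opens ℝ}
  {E' : Type*} [NormedAddCommGroup E'] [NormedSpace ℝ E'] [FiniteDimensional ℝ E']
  {M : Type*} [TopologicalSpace M] [ChartedSpace E' M] [IsManifold 𝓘(ℝ, E') ∞ M]
  {E : Type*} [NormedAddCommGroup E] [NormedSpace ℝ E]
  {N : Type*} [TopologicalSpace N] [ChartedSpace E N]
  {G : Type*} [NormedAddCommGroup G] [NormedSpace ℝ G]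

theorem extChartAt_opens (t : J) : (extChartAt 𝓘(ℝ, ℝ) t : J → ℝ) = Subtype.val := by
  funext r
  simp [extChartAt, OpenPartialHomeomorph.extend]
  rfl

theorem mem_extChartAt_opens_source (t r : J) : r ∈ (extChartAt 𝓘(ℝ, ℝ) t).source := by
  simp [extChartAt, OpenPartialHomeomorph.extend, Opens.chartAt_eq]
  exact Set.mem_univ _

/-- A map from the line to the open subset `J` that is the identity on `J`. -/
def timeProj (t : J) (r : ℝ) : J := (extChartAt 𝓘(ℝ, ℝ) t).symm r

theorem timeProj_of_mem (t : J) {r : ℝ} (hr : r ∈ J) : timeProj t r = ⟨r, hr⟩ := by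
  rw [timeProj, ← (extChartAt 𝓘(ℝ, ℝ) t).left_inv (mem_extChartAt_opens_source t ⟨r, hr⟩),
    extChartAt_opens]

theorem timeProj_coe (t r : J) : timeProj t r = r := timeProj_of_mem t r.2

theorem contMDiffAt_timeProj (t : J) {r : ℝ} (hr : r ∈ J) :
    ContMDiffAt 𝓘(ℝ, ℝ) 𝓘(ℝ, ℝ) ∞ (timeProj t) r := by
  have h : ContMDiffAt 𝓘(ℝ, ℝ) 𝓘(ℝ, ℝ) ∞ (timeProj (⟨r, hr⟩ : J)) r := by
    refine (contMDiffOn_extChartAt_symm (I := 𝓘(ℝ, ℝ)) (⟨r, hr⟩ : J)).contMDiffAt ?_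
    have h := extChartAt_target_mem_nhds (I := 𝓘(ℝ, ℝ)) (⟨r, hr⟩ : J)
    rwa [extChartAt_opens] at h
  refine h.congr_of_eventuallyEq ?_
  filter_upwards [J.isOpen.mem_nhds hr] with z hz
  rw [timeProj_of_mem _ hz, timeProj_of_mem _ hz]

/-- The tangent vector `∂/∂t` of `J` at `t`. -/
def timeUnit (t : J) : TangentSpace 𝓘(ℝ, ℝ) t := (1 : ℝ)

theorem mvfderiv_opens_val (t : J) :
    mvfderiv 𝓘(ℝ, ℝ) (Subtype.val : J → ℝ) t (timeUnit t) = 1 := by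
  have h := mvfderiv_extChartAt_self (IP := 𝓘(ℝ, ℝ)) t (timeUnit t)
  rwa [extChartAt_opens] at h

/-- The tangent vector of `J × M` with given components. -/
def tangentPair (p : J × M) (a : ℝ) (w : TangentSpace 𝓘(ℝ, E') p.2) :
    TangentSpace (𝓘(ℝ, ℝ).prod 𝓘(ℝ, E')) p := ((a, w) : ℝ × E')

theorem mdifferentiableAt_opens_val (t : J) :
    MDifferentiableAt 𝓘(ℝ, ℝ) 𝓘(ℝ, ℝ) (Subtype.val : J → ℝ) t :=
  contMDiff_subtype_val.contMDiffAt.mdifferentiableAt (n := 1) (by simp)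

/-- The derivative in time of a vector valued function on `J`, as an ordinary derivative. -/
theorem MDifferentiableAt.hasDerivAt_timeProj {g : J → G} {t : J} (t₀ : J)
    (hg : MDifferentiableAt 𝓘(ℝ, ℝ) 𝓘(ℝ, G) g t) :
    HasDerivAt (fun r ↦ g (timeProj t₀ r)) (mvfderiv 𝓘(ℝ, ℝ) g t (timeUnit t)) (t : ℝ) := by
  have h1 : MDifferentiableAt 𝓘(ℝ, ℝ) 𝓘(ℝ, ℝ) (timeProj t₀) (t : ℝ) :=
    (contMDiffAt_timeProj t₀ t.2).mdifferentiableAt (by simp)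
  have h2 : MDifferentiableAt 𝓘(ℝ, ℝ) 𝓘(ℝ, G) g (timeProj t₀ t) := by rwa [timeProj_coe]
  have h3 : DifferentiableAt ℝ (fun r ↦ g (timeProj t₀ r)) (t : ℝ) :=
    (h2.comp _ h1).differentiableAt
  have h4 := mvfderiv_eq_fderiv_comp_extChartAt_symm (x := t₀) (mem_extChartAt_opens_source t₀ t) hg
    (timeUnit t)
  rw [extChartAt_opens, mvfderiv_opens_val] at h4
  rw [h4]
  exact h3.hasDerivAt

theorem HasDerivAt.mvfderiv_opens {g : ℝ → G} {d : G} {t : J} (hg : HasDerivAt g d (t : ℝ)) :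
    mvfderiv 𝓘(ℝ, ℝ) (fun r : J ↦ g r) t (timeUnit t) = d := by
  rw [mvfderiv_comp_fderiv hg.differentiableAt (mdifferentiableAt_opens_val t), mvfderiv_opens_val]
  simp [hg.deriv]

/-- Uniqueness of solutions of a linear differential equation on an open interval. -/
theorem eq_zero_of_linear_ode_opens {K : Set ℝ} (hKo : IsOpen K) (hK : K.OrdConnected)
    (hKJ : K ⊆ J) {A : J → G →L[ℝ] G} {x : J → G}
    (hA : ∀ t : J, (t : ℝ) ∈ K → ContinuousAt A t)
    (hx : ∀ t : J, (t : ℝ) ∈ K → MDifferentiableAt 𝓘(ℝ, ℝ) 𝓘(ℝ, G) x t ∧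
      mvfderiv 𝓘(ℝ, ℝ) x t (timeUnit t) = A t (x t)) {s t : J} (hs : (s : ℝ) ∈ K)
    (ht : (t : ℝ) ∈ K) (h0 : x s = 0) : x t = 0 := by
  have h := eq_zero_of_linear_ode (x := fun r ↦ x (timeProj s r)) (B := fun r ↦ A (timeProj s r))
    hK hKo ?_ ?_ hs ht ?_
  · simpa only [timeProj_coe] using h
  · intro r hr
    lift r to J using hKJ hr
    refine ContinuousAt.continuousWithinAt ?_
    refine ContinuousAt.comp (g := A) ?_ (contMDiffAt_timeProj s r.2).continuousAt
    rw [timeProj_coe]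
    exact hA r hr
  · intro r hr
    lift r to J using hKJ hr
    have := (hx r hr).1.hasDerivAt_timeProj s
    rw [(hx r hr).2] at this
    simpa only [timeProj_coe] using this
  · simpa only [timeProj_coe] using h0

theorem extChartAt_prod_apply (x p : J × M) :
    extChartAt (𝓘(ℝ, ℝ).prod 𝓘(ℝ, E')) x p = ((p.1 : ℝ), extChartAt 𝓘(ℝ, E') x.2 p.2) := by
  rw [extChartAt_prod]
  exact Prod.ext (congrFun (extChartAt_opens x.1) p.1) rfl

theorem mem_extChartAt_prod_source {x p : J × M} (hp : p.2 ∈ (extChartAt 𝓘(ℝ, E') x.2).source) :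
    p ∈ (extChartAt (𝓘(ℝ, ℝ).prod 𝓘(ℝ, E')) x).source := by
  rw [extChartAt_prod]
  exact ⟨mem_extChartAt_opens_source x.1 p.1, hp⟩

theorem mvfderiv_extChartAt_prod {x p : J × M} (hp : p.2 ∈ (extChartAt 𝓘(ℝ, E') x.2).source)
    (a : ℝ) (w : TangentSpace 𝓘(ℝ, E') p.2) :
    mvfderiv (𝓘(ℝ, ℝ).prod 𝓘(ℝ, E')) (extChartAt (𝓘(ℝ, ℝ).prod 𝓘(ℝ, E')) x) p (tangentPair p a w) =
      (a, mvfderiv 𝓘(ℝ, E') (extChartAt 𝓘(ℝ, E') x.2) p.2 w) := by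
  have h0 : MDifferentiableAt (𝓘(ℝ, ℝ).prod 𝓘(ℝ, E')) 𝓘(ℝ, ℝ × E')
      (extChartAt (𝓘(ℝ, ℝ).prod 𝓘(ℝ, E')) x) p := by
    refine mdifferentiableAt_extChartAt ?_
    have h := mem_extChartAt_prod_source hp
    rwa [extChartAt_source] at h
  have h2 : MDifferentiableAt 𝓘(ℝ, E') 𝓘(ℝ, E') (extChartAt 𝓘(ℝ, E') x.2) p.2 :=
    mdifferentiableAt_extChartAt (by rwa [extChartAt_source] at hp)
  refine Prod.ext ?_ ?_
  · refine (mvfderiv_clm_comp (ContinuousLinearMap.fst ℝ ℝ E') h0 _).symm.trans ?_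
    rw [show (fun z ↦ ContinuousLinearMap.fst ℝ ℝ E' (extChartAt (𝓘(ℝ, ℝ).prod 𝓘(ℝ, E')) x z)) =
      fun z : J × M ↦ (z.1 : ℝ) from funext fun z ↦ congrArg Prod.fst (extChartAt_prod_apply x z),
      mvfderiv_comp_vec (f := Prod.fst) (mdifferentiableAt_opens_val p.1) mdifferentiableAt_fst,
      mfderiv_fst]
    have h := map_smul (mvfderiv 𝓘(ℝ, ℝ) (Subtype.val : J → ℝ) p.1) a (timeUnit p.1)
    rw [mvfderiv_opens_val, smul_eq_mul, mul_one] at h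
    refine Eq.trans (congrArg _ ?_) h
    exact (mul_one a).symm
  · refine (mvfderiv_clm_comp (ContinuousLinearMap.snd ℝ ℝ E') h0 _).symm.trans ?_
    rw [show (fun z ↦ ContinuousLinearMap.snd ℝ ℝ E' (extChartAt (𝓘(ℝ, ℝ).prod 𝓘(ℝ, E')) x z)) =
      fun z : J × M ↦ extChartAt 𝓘(ℝ, E') x.2 z.2 from
        funext fun z ↦ congrArg Prod.snd (extChartAt_prod_apply x z),
      mvfderiv_comp_vec (f := Prod.snd) h2 mdifferentiableAt_snd, mfderiv_snd]
    rfl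

theorem mfderiv_slice_right {f : J × M → N} {t : J} {m : M}
    (hf : MDifferentiableAt (𝓘(ℝ, ℝ).prod 𝓘(ℝ, E')) 𝓘(ℝ, E) f (t, m)) (w : TangentSpace 𝓘(ℝ, E') m) :
    mfderiv 𝓘(ℝ, E') 𝓘(ℝ, E) (fun z ↦ f (t, z)) m w =
      mfderiv (𝓘(ℝ, ℝ).prod 𝓘(ℝ, E')) 𝓘(ℝ, E) f (t, m) (tangentPair (t, m) 0 w) := by
  have h2 : MDifferentiableAt 𝓘(ℝ, E') (𝓘(ℝ, ℝ).prod 𝓘(ℝ, E')) (fun z : M ↦ (t, z)) m :=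
    mdifferentiableAt_const.prodMk mdifferentiableAt_id
  have h := mfderiv_comp_apply m hf h2 w
  rw [mfderiv_prod_right] at h
  exact h

theorem mvfderiv_slice_right {g : J × M → G} {t : J} {m : M}
    (hg : MDifferentiableAt (𝓘(ℝ, ℝ).prod 𝓘(ℝ, E')) 𝓘(ℝ, G) g (t, m)) (w : TangentSpace 𝓘(ℝ, E') m) :
    mvfderiv 𝓘(ℝ, E') (fun z ↦ g (t, z)) m w =
      mvfderiv (𝓘(ℝ, ℝ).prod 𝓘(ℝ, E')) g (t, m) (tangentPair (t, m) 0 w) := by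
  have h2 : MDifferentiableAt 𝓘(ℝ, E') (𝓘(ℝ, ℝ).prod 𝓘(ℝ, E')) (fun z : M ↦ (t, z)) m :=
    mdifferentiableAt_const.prodMk mdifferentiableAt_id
  rw [mvfderiv_comp_vec hg h2, mfderiv_prod_right]
  rfl

theorem mdifferentiableAt_slice_left (t : J) (m : M) :
    MDifferentiableAt 𝓘(ℝ, ℝ) (𝓘(ℝ, ℝ).prod 𝓘(ℝ, E')) (fun r : J ↦ (r, m)) t :=
  mdifferentiableAt_id.prodMk mdifferentiableAt_const

theorem mvfderiv_slice_left {g : J × M → G} {t : J} {m : M}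
    (hg : MDifferentiableAt (𝓘(ℝ, ℝ).prod 𝓘(ℝ, E')) 𝓘(ℝ, G) g (t, m)) :
    mvfderiv 𝓘(ℝ, ℝ) (fun r ↦ g (r, m)) t (timeUnit t) =
      mvfderiv (𝓘(ℝ, ℝ).prod 𝓘(ℝ, E')) g (t, m) (tangentPair (t, m) 1 0) := by
  rw [mvfderiv_comp_vec (f := fun r : J ↦ (r, m)) hg (mdifferentiableAt_slice_left t m),
    mfderiv_prod_left]
  rfl

theorem mfderiv_slice_left {f : J × M → N} {t : J} {m : M}
    (hf : MDifferentiableAt (𝓘(ℝ, ℝ).prod 𝓘(ℝ, E')) 𝓘(ℝ, E) f (t, m)) :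
    mfderiv 𝓘(ℝ, ℝ) 𝓘(ℝ, E) (fun r ↦ f (r, m)) t (timeUnit t) =
      mfderiv (𝓘(ℝ, ℝ).prod 𝓘(ℝ, E')) 𝓘(ℝ, E) f (t, m) (tangentPair (t, m) 1 0) := by
  have h := mfderiv_comp_apply t hf (mdifferentiableAt_slice_left t m) (timeUnit t)
  rw [mfderiv_prod_left] at h
  exact h

/-- A vector field on `J × M`, given by its two components, is smooth if its components are. -/
theorem contMDiffAt_prod_vectorField {x : J × M} {a : J × M → ℝ}
    {w : ∀ p : J × M, TangentSpace 𝓘(ℝ, E') p.2}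
    (ha : ContMDiffAt (𝓘(ℝ, ℝ).prod 𝓘(ℝ, E')) 𝓘(ℝ, ℝ) ∞ a x)
    (hw : ContMDiffAt (𝓘(ℝ, ℝ).prod 𝓘(ℝ, E')) 𝓘(ℝ, E') ∞
      (fun p ↦ mvfderiv 𝓘(ℝ, E') (extChartAt 𝓘(ℝ, E') x.2) p.2 (w p)) x) :
    ContMDiffAt (𝓘(ℝ, ℝ).prod 𝓘(ℝ, E')) (𝓘(ℝ, ℝ).prod 𝓘(ℝ, E')).tangent ∞
      (fun p ↦ (⟨p, tangentPair p (a p) (w p)⟩ : TangentBundle (𝓘(ℝ, ℝ).prod 𝓘(ℝ, E')) (J × M))) x := by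
  refine (contMDiffAt_section x).2 ?_
  refine (ha.prodMk_space hw).congr_of_eventuallyEq ?_
  have h1 : ∀ᶠ p in 𝓝 x, p.2 ∈ (extChartAt 𝓘(ℝ, E') x.2).source :=
    continuous_snd.continuousAt.eventually_mem (extChartAt_source_mem_nhds x.2)
  filter_upwards [h1] with p hp
  refine (trivializationAt_tangent_eq_mvfderiv (mem_extChartAt_prod_source hp) _).trans ?_
  exact mvfderiv_extChartAt_prod hp _ _

variable (J M) in
/-- The vector field `∂/∂t` on `J × M`. -/
def timeField (p : J × M) : TangentSpace (𝓘(ℝ, ℝ).prod 𝓘(ℝ, E')) p := tangentPair p 1 0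

/-- A vector field on `M`, seen as a vector field on `J × M`. -/
def spaceField (J : Opens ℝ) (X : ∀ m : M, TangentSpace 𝓘(ℝ, E') m) (p : J × M) :
    TangentSpace (𝓘(ℝ, ℝ).prod 𝓘(ℝ, E')) p := tangentPair p 0 (X p.2)

theorem contMDiffAt_timeField (x : J × M) :
    ContMDiffAt (𝓘(ℝ, ℝ).prod 𝓘(ℝ, E')) (𝓘(ℝ, ℝ).prod 𝓘(ℝ, E')).tangent ∞
      (fun p ↦ (⟨p, timeField J M p⟩ : TangentBundle (𝓘(ℝ, ℝ).prod 𝓘(ℝ, E')) (J × M))) x :=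
  contMDiffAt_prod_vectorField (a := fun _ ↦ 1) (w := fun _ ↦ 0) contMDiffAt_const (by
    simp only [map_zero]; exact contMDiffAt_const)

theorem contMDiffAt_spaceField {X : ∀ m : M, TangentSpace 𝓘(ℝ, E') m} {x : J × M}
    (hX : ContMDiffAt 𝓘(ℝ, E') 𝓘(ℝ, E').tangent ∞
      (fun m ↦ (⟨m, X m⟩ : TangentBundle 𝓘(ℝ, E') M)) x.2) :
    ContMDiffAt (𝓘(ℝ, ℝ).prod 𝓘(ℝ, E')) (𝓘(ℝ, ℝ).prod 𝓘(ℝ, E')).tangent ∞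
      (fun p ↦ (⟨p, spaceField J X p⟩ : TangentBundle (𝓘(ℝ, ℝ).prod 𝓘(ℝ, E')) (J × M))) x :=
  contMDiffAt_prod_vectorField (a := fun _ ↦ 0) (w := fun p ↦ X p.2) contMDiffAt_const
    ((contMDiffAt_mvfderiv_extChartAt hX).comp x contMDiffAt_snd)

theorem mvfderiv_extChartAt_spaceField (X : ∀ m : M, TangentSpace 𝓘(ℝ, E') m) (x : J × M) :
    (fun p ↦ mvfderiv (𝓘(ℝ, ℝ).prod 𝓘(ℝ, E')) (extChartAt (𝓘(ℝ, ℝ).prod 𝓘(ℝ, E')) x) p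
      (spaceField J X p)) =ᶠ[𝓝 x] fun p ↦
        ContinuousLinearMap.inr ℝ ℝ E' (mvfderiv 𝓘(ℝ, E') (extChartAt 𝓘(ℝ, E') x.2) p.2 (X p.2)) := by
  have h1 : ∀ᶠ p in 𝓝 x, p.2 ∈ (extChartAt 𝓘(ℝ, E') x.2).source :=
    continuous_snd.continuousAt.eventually_mem (extChartAt_source_mem_nhds x.2)
  filter_upwards [h1] with p hp using mvfderiv_extChartAt_prod hp _ _

theorem mvfderiv_extChartAt_timeField (x : J × M) :
    (fun p ↦ mvfderiv (𝓘(ℝ, ℝ).prod 𝓘(ℝ, E')) (extChartAt (𝓘(ℝ, ℝ).prod 𝓘(ℝ, E')) x) p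
      (timeField J M p)) =ᶠ[𝓝 x] fun _ ↦ ((1, 0) : ℝ × E') := by
  have h1 : ∀ᶠ p in 𝓝 x, p.2 ∈ (extChartAt 𝓘(ℝ, E') x.2).source :=
    continuous_snd.continuousAt.eventually_mem (extChartAt_source_mem_nhds x.2)
  filter_upwards [h1] with p hp
  refine (mvfderiv_extChartAt_prod hp _ _).trans ?_
  rw [map_zero]

theorem mvfderiv_mvfderiv_extChartAt_spaceField {X : ∀ m : M, TangentSpace 𝓘(ℝ, E') m} {x : J × M}
    (hX : ContMDiffAt 𝓘(ℝ, E') 𝓘(ℝ, E').tangent ∞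
      (fun m ↦ (⟨m, X m⟩ : TangentBundle 𝓘(ℝ, E') M)) x.2)
    (a : ℝ) (w : TangentSpace 𝓘(ℝ, E') x.2) :
    mvfderiv (𝓘(ℝ, ℝ).prod 𝓘(ℝ, E')) (fun p ↦ mvfderiv (𝓘(ℝ, ℝ).prod 𝓘(ℝ, E'))
      (extChartAt (𝓘(ℝ, ℝ).prod 𝓘(ℝ, E')) x) p (spaceField J X p)) x (tangentPair x a w) =
      ((0, mvfderiv 𝓘(ℝ, E') (fun m ↦ mvfderiv 𝓘(ℝ, E') (extChartAt 𝓘(ℝ, E') x.2) m (X m)) x.2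
        w) : ℝ × E') := by
  have h1 := (contMDiffAt_mvfderiv_extChartAt hX).mdifferentiableAt (n := ∞) (by simp)
  have h2 : MDifferentiableAt (𝓘(ℝ, ℝ).prod 𝓘(ℝ, E')) 𝓘(ℝ, E') (Prod.snd : J × M → M) x :=
    mdifferentiableAt_snd
  have h3 : MDifferentiableAt (𝓘(ℝ, ℝ).prod 𝓘(ℝ, E')) 𝓘(ℝ, E') (fun p : J × M ↦
    mvfderiv 𝓘(ℝ, E') (extChartAt 𝓘(ℝ, E') x.2) p.2 (X p.2)) x := h1.comp x h2
  rw [(mvfderiv_extChartAt_spaceField X x).mvfderiv_eq,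
    mvfderiv_clm_comp (ContinuousLinearMap.inr ℝ ℝ E') h3, mvfderiv_comp_vec h1 h2, mfderiv_snd]
  rfl

theorem mlieBracket_timeField_spaceField {X : ∀ m : M, TangentSpace 𝓘(ℝ, E') m} {x : J × M}
    (hX : ContMDiffAt 𝓘(ℝ, E') 𝓘(ℝ, E').tangent ∞
      (fun m ↦ (⟨m, X m⟩ : TangentBundle 𝓘(ℝ, E') M)) x.2) :
    VectorField.mlieBracket (𝓘(ℝ, ℝ).prod 𝓘(ℝ, E')) (timeField J M) (spaceField J X) x = 0 := by
  rw [mlieBracket_eq_mvfderiv_sub (contMDiffAt_timeField x) (contMDiffAt_spaceField hX), timeField,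
    mvfderiv_mvfderiv_extChartAt_spaceField hX, map_zero,
    (mvfderiv_extChartAt_timeField x).mvfderiv_eq, mvfderiv_const]
  exact sub_self _

theorem mlieBracket_spaceField {X Z : ∀ m : M, TangentSpace 𝓘(ℝ, E') m} {x : J × M}
    (hX : ContMDiffAt 𝓘(ℝ, E') 𝓘(ℝ, E').tangent ∞
      (fun m ↦ (⟨m, X m⟩ : TangentBundle 𝓘(ℝ, E') M)) x.2)
    (hZ : ContMDiffAt 𝓘(ℝ, E') 𝓘(ℝ, E').tangent ∞
      (fun m ↦ (⟨m, Z m⟩ : TangentBundle 𝓘(ℝ, E') M)) x.2) :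
    VectorField.mlieBracket (𝓘(ℝ, ℝ).prod 𝓘(ℝ, E')) (spaceField J X) (spaceField J Z) x =
      spaceField J (VectorField.mlieBracket 𝓘(ℝ, E') X Z) x := by
  have h1 := mvfderiv_mvfderiv_extChartAt_spaceField hX 0 (Z x.2)
  have h2 := mvfderiv_mvfderiv_extChartAt_spaceField hZ 0 (X x.2)
  rw [mlieBracket_eq_mvfderiv_sub (contMDiffAt_spaceField hX) (contMDiffAt_spaceField hZ)]
  refine (congrArg₂ (fun u v : ℝ × E' ↦ u - v) h2 h1).trans ?_
  exact Prod.ext (sub_self _) (mlieBracket_eq_mvfderiv_sub hX hZ).symm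

/-- The derivatives in time and in space commute. -/
theorem mvfderiv_timeField_comm {g : J × M → G} {X : ∀ m : M, TangentSpace 𝓘(ℝ, E') m} {x : J × M}
    (hg : ContMDiffAt (𝓘(ℝ, ℝ).prod 𝓘(ℝ, E')) 𝓘(ℝ, G) ∞ g x)
    (hX : ContMDiffAt 𝓘(ℝ, E') 𝓘(ℝ, E').tangent ∞
      (fun m ↦ (⟨m, X m⟩ : TangentBundle 𝓘(ℝ, E') M)) x.2) :
    mvfderiv (𝓘(ℝ, ℝ).prod 𝓘(ℝ, E')) (fun p ↦ mvfderiv (𝓘(ℝ, ℝ).prod 𝓘(ℝ, E')) g p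
      (spaceField J X p)) x (timeField J M x) =
    mvfderiv (𝓘(ℝ, ℝ).prod 𝓘(ℝ, E')) (fun p ↦ mvfderiv (𝓘(ℝ, ℝ).prod 𝓘(ℝ, E')) g p
      (timeField J M p)) x (spaceField J X x) := by
  have h := mvfderiv_mlieBracket hg (contMDiffAt_timeField x) (contMDiffAt_spaceField hX)
  rw [mlieBracket_timeField_spaceField hX, map_zero] at h
  exact sub_eq_zero.1 h.symm

/-- Every tangent vector extends to a vector field that is smooth near its base point. -/
theorem exists_vectorField (m : M) (w : TangentSpace 𝓘(ℝ, E') m) :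
    ∃ X : ∀ z : M, TangentSpace 𝓘(ℝ, E') z, X m = w ∧
      ContMDiffAt 𝓘(ℝ, E') 𝓘(ℝ, E').tangent ∞
        (fun z ↦ (⟨z, X z⟩ : TangentBundle 𝓘(ℝ, E') M)) m := by
  have h1 : IsManifold 𝓘(ℝ, E') 1 M := .of_le (n := ∞) (by simp)
  let e := trivializationAt E' (TangentSpace 𝓘(ℝ, E')) m
  have hm : m ∈ e.baseSet := mem_baseSet_trivializationAt _ _ _
  refine ⟨fun z ↦ e.symm z ((e ⟨m, w⟩).2), e.symm_apply_apply_mk hm w, ?_⟩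
  refine (contMDiffAt_section m).2 ((contMDiffAt_const (c := (e ⟨m, w⟩).2)).congr_of_eventuallyEq ?_)
  filter_upwards [e.open_baseSet.mem_nhds hm] with z hz
  change (e _).2 = (e ⟨m, w⟩).2
  rw [e.apply_mk_symm hz]

end TimeCalculus

/-! ### Gluing of local solutions over an interval -/

theorem isPreconnected_preimage_opens {J : Opens ℝ} {K : Set ℝ} (hK : K.OrdConnected)
    (hKJ : K ⊆ J) : IsPreconnected (Subtype.val ⁻¹' K : Set J) :=
  hK.isPreconnected.preimage_of_isOpenMap Subtype.val_injective J.isOpen.isOpenMap_subtype_val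
    (by rwa [Subtype.range_coe])

theorem eventually_exists_ordConnected {J : Opens ℝ} {t : J} {p : J → Prop}
    (hp : ∀ᶠ r in 𝓝 t, p r) : ∃ K : Set ℝ, IsOpen K ∧ K.OrdConnected ∧ K ⊆ J ∧ (t : ℝ) ∈ K ∧
      ∀ r : J, (r : ℝ) ∈ K → p r := by
  obtain ⟨ε, hε, h⟩ := Metric.eventually_nhds_iff_ball.1 hp
  obtain ⟨η, hη, h'⟩ := Metric.isOpen_iff.1 J.isOpen t t.2
  refine ⟨Metric.ball (t : ℝ) (min ε η), Metric.isOpen_ball, ?_,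
    (Metric.ball_subset_ball (min_le_right _ _)).trans h', Metric.mem_ball_self (lt_min hε hη),
    fun r hr ↦ h r (Metric.ball_subset_ball (min_le_left _ _) hr)⟩
  rw [Real.ball_eq_Ioo]
  exact Set.ordConnected_Ioo

theorem eventually_mem_opens {J : Opens ℝ} {K : Set ℝ} (hK : IsOpen K) {t : J} (ht : (t : ℝ) ∈ K) :
    ∀ᶠ r : J in 𝓝 t, (r : ℝ) ∈ K :=
  continuous_subtype_val.continuousAt.eventually_mem (hK.mem_nhds ht)

/-- Solutions of an initial value problem over an interval, with values in a family of sets `X t`,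
exist globally, if they are unique and exist locally on neighbourhoods that do not depend on the
initial value. The predicate `Fl c t` says that the curve `c` is a solution at time `t`, and
`Adm t x` says that `x` is an admissible initial value at time `t`. -/
theorem exists_global_solution {J : Opens ℝ} (hJ : (J : Set ℝ).OrdConnected) {X : J → Type*}
    {Fl : (∀ t, X t) → J → Prop} {Adm : ∀ t, X t → Prop}
    (hloc : ∀ {c c' : ∀ t, X t} {t : J}, (∀ᶠ r in 𝓝 t, c r = c' r) → Fl c t → Fl c' t)
    (hadm : ∀ {c t}, Fl c t → Adm t (c t))
    (hex : ∀ t₀ : J, ∃ K : Set ℝ, IsOpen K ∧ K.OrdConnected ∧ K ⊆ J ∧ (t₀ : ℝ) ∈ K ∧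
      ∀ s : J, (s : ℝ) ∈ K → ∀ x, Adm s x → ∃ c, c s = x ∧ ∀ t : J, (t : ℝ) ∈ K → Fl c t)
    (huniq : ∀ {K : Set ℝ}, IsOpen K → K.OrdConnected → K ⊆ J → ∀ {c c' : ∀ t, X t},
      (∀ t : J, (t : ℝ) ∈ K → Fl c t) → (∀ t : J, (t : ℝ) ∈ K → Fl c' t) →
      ∀ {s t : J}, (s : ℝ) ∈ K → (t : ℝ) ∈ K → c s = c' s → c t = c' t)
    (s : J) (x : X s) (hx : Adm s x) : ∃ c, c s = x ∧ ∀ t, Fl c t := by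
  classical
  have : PreconnectedSpace J := Subtype.preconnectedSpace hJ.isPreconnected
  have key : ∀ s t : J, ∀ x, Adm s x → ∃ K : Set ℝ, IsOpen K ∧ K.OrdConnected ∧ K ⊆ J ∧
      (s : ℝ) ∈ K ∧ (t : ℝ) ∈ K ∧ ∃ c, c s = x ∧ ∀ r : J, (r : ℝ) ∈ K → Fl c r := by
    refine PreconnectedSpace.induction₂' _ (fun t₀ ↦ ?_) ⟨fun s t u hst htu x hx ↦ ?_⟩
    · obtain ⟨K, hKo, hK, hKJ, htK, hc⟩ := hex t₀
      filter_upwards [eventually_mem_opens hKo htK] with r hr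
      exact ⟨fun x hx ↦ ⟨K, hKo, hK, hKJ, htK, hr, hc t₀ htK x hx⟩,
        fun x hx ↦ ⟨K, hKo, hK, hKJ, hr, htK, hc r hr x hx⟩⟩
    · obtain ⟨K, hKo, hK, hKJ, hsK, htK, c, hcs, hc⟩ := hst x hx
      obtain ⟨L, hLo, hL, hLJ, htL, huL, d, hdt, hd⟩ := htu (c t) (hadm (hc t htK))
      refine ⟨K ∪ L, hKo.union hLo,
        (hK.isPreconnected.union (t : ℝ) htK htL hL.isPreconnected).ordConnected,
        Set.union_subset hKJ hLJ, Or.inl hsK, Or.inr huL,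
        fun r ↦ if (r : ℝ) ∈ K then c r else d r, ?_, ?_⟩
      · exact (if_pos hsK).trans hcs
      · rintro r (hr | hr)
        · refine hloc ?_ (hc r hr)
          filter_upwards [eventually_mem_opens hKo hr] with z hz
          rw [if_pos hz]
        · refine hloc ?_ (hd r hr)
          filter_upwards [eventually_mem_opens hLo hr] with z hz
          split_ifs with hzK
          · exact huniq (hKo.inter hLo) (hK.inter hL) (Set.inter_subset_left.trans hKJ)
              (fun t ht ↦ hd t ht.2) (fun t ht ↦ hc t ht.1) ⟨htK, htL⟩ ⟨hzK, hz⟩ hdt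
          · rfl
  choose K hKo hK hKJ hsK htK c hcs hc using fun t ↦ key s t x hx
  refine ⟨fun t ↦ c t t, hcs s, fun t ↦ hloc ?_ (hc t t (htK t))⟩
  filter_upwards [eventually_mem_opens (hKo t) (htK t)] with r hr
  exact huniq ((hKo t).inter (hKo r)) ((hK t).inter (hK r)) (Set.inter_subset_left.trans (hKJ t))
    (fun z hz ↦ hc t z hz.1) (fun z hz ↦ hc r z hz.2) ⟨hsK t, hsK r⟩ ⟨hr, htK r⟩
    ((hcs t).trans (hcs r).symm)

/-! ### Flat curves -/

namespace LieAlgebroid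

section Flat

variable {E : Type*} [NormedAddCommGroup E] [NormedSpace ℝ E] [FiniteDimensional ℝ E]
  {N : Type*} [TopologicalSpace N] [T2Space N] [ChartedSpace E N] [IsManifold 𝓘(ℝ, E) ∞ N]
  {F : Type*} [NormedAddCommGroup F] [NormedSpace ℝ F] [FiniteDimensional ℝ F]
  {V : N → Type*} [TopologicalSpace (TotalSpace F V)]
  [∀ x, AddCommGroup (V x)] [∀ x, Module ℝ (V x)] [∀ x, TopologicalSpace (V x)]
  [FiberBundle F V] [VectorBundle ℝ F V] [ContMDiffVectorBundle ∞ F V 𝓘(ℝ, E)]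
  {B : LieAlgebroid 𝓘(ℝ, E) F V}
  {E' : Type*} [NormedAddCommGroup E'] [NormedSpace ℝ E'] [FiniteDimensional ℝ E']
  {M : Type*} [TopologicalSpace M] [ChartedSpace E' M] [IsManifold 𝓘(ℝ, E') ∞ M]
  {J : Opens ℝ} {φ : J × M → N} {m : M}

/-- A curve `c` in the fibres of `B` over `t ↦ φ (t, m)` solves, at time `t` and in the frame at
`n₀`, the equation `[y, (w, c)] = 0`, where `w` is constant in time. -/
def SolvesFlatEquation (y : B.PullbackSection (𝓘(ℝ, ℝ).prod 𝓘(ℝ, E')) φ)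
    (w : TangentSpace 𝓘(ℝ, E') m) (c : ∀ t : J, V (φ (t, m))) (t : J) (n₀ : N) : Prop :=
  MDifferentiableAt 𝓘(ℝ, ℝ) 𝓘(ℝ, F) (fun r ↦ coord F V n₀ (φ (r, m)) (c r)) t ∧
  mvfderiv 𝓘(ℝ, ℝ) (fun r ↦ coord F V n₀ (φ (r, m)) (c r)) t (timeUnit t) =
    mvfderiv (𝓘(ℝ, ℝ).prod 𝓘(ℝ, E')) (y.sndCoord n₀) (t, m) (tangentPair (t, m) 0 w) -
      B.structureMap n₀ (φ (t, m)) (y.sndCoord n₀ (t, m)) (coord F V n₀ (φ (t, m)) (c t))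

/-- A curve `c` in the fibres of `B` over `t ↦ φ (t, m)` is flat over the tangent vector `w` of `M`
at `m`, at time `t`, if `(w, c t)` belongs to the pullback of `B` along `φ (t, ·)` and the equation
`[y, (w, c)] = 0` is satisfied. -/
def IsFlatAt (y : B.PullbackSection (𝓘(ℝ, ℝ).prod 𝓘(ℝ, E')) φ)
    (w : TangentSpace 𝓘(ℝ, E') m) (c : ∀ t : J, V (φ (t, m))) (t : J) : Prop :=
  mfderiv 𝓘(ℝ, E') 𝓘(ℝ, E) (fun z ↦ φ (t, z)) m w = B.anchor (φ (t, m)) (c t) ∧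
  ∀ n₀, φ (t, m) ∈ frameNhd E F V n₀ → SolvesFlatEquation y w c t n₀

variable {y : B.PullbackSection (𝓘(ℝ, ℝ).prod 𝓘(ℝ, E')) φ}

theorem IsFlatAt.congr {w : TangentSpace 𝓘(ℝ, E') m} {c c' : ∀ t : J, V (φ (t, m))} {t : J}
    (h : ∀ᶠ r in 𝓝 t, c r = c' r) (hc : IsFlatAt y w c t) : IsFlatAt y w c' t := by
  refine ⟨by rw [← h.self_of_nhds]; exact hc.1, fun n₀ hn₀ ↦ ?_⟩
  have h1 : (fun r ↦ coord F V n₀ (φ (r, m)) (c' r)) =ᶠ[𝓝 t]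
      fun r ↦ coord F V n₀ (φ (r, m)) (c r) := by
    filter_upwards [h] with r hr
    rw [hr]
  obtain ⟨h2, h3⟩ := hc.2 n₀ hn₀
  refine ⟨h2.congr_of_eventuallyEq h1, ?_⟩
  rw [h1.mvfderiv_eq, h3, h.self_of_nhds]

theorem IsFlatAt.add {w w' : TangentSpace 𝓘(ℝ, E') m} {c c' : ∀ t : J, V (φ (t, m))} {t : J}
    (hc : IsFlatAt y w c t) (hc' : IsFlatAt y w' c' t) :
    IsFlatAt y (w + w') (fun r ↦ c r + c' r) t := by
  refine ⟨by rw [map_add, map_add, hc.1, hc'.1], fun n₀ hn₀ ↦ ?_⟩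
  obtain ⟨h1, h2⟩ := hc.2 n₀ hn₀
  obtain ⟨h1', h2'⟩ := hc'.2 n₀ hn₀
  have e : tangentPair (t, m) 0 (w + w') = tangentPair (t, m) 0 w + tangentPair (t, m) 0 w' :=
    Prod.ext (add_zero (0 : ℝ)).symm rfl
  simp only [SolvesFlatEquation, map_add, e]
  refine ⟨h1.add h1', ?_⟩
  rw [mvfderiv_fun_add h1 h1']
  refine (congrArg₂ (· + ·) h2 h2').trans ?_
  abel

theorem IsFlatAt.smul {w : TangentSpace 𝓘(ℝ, E') m} {c : ∀ t : J, V (φ (t, m))} {t : J}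
    (hc : IsFlatAt y w c t) (a : ℝ) : IsFlatAt y (a • w) (fun r ↦ a • c r) t := by
  refine ⟨by rw [map_smul, map_smul, hc.1], fun n₀ hn₀ ↦ ?_⟩
  obtain ⟨h1, h2⟩ := hc.2 n₀ hn₀
  have e : tangentPair (t, m) 0 (a • w) = a • tangentPair (t, m) 0 w :=
    Prod.ext (mul_zero a).symm rfl
  simp only [SolvesFlatEquation, map_smul, e]
  have h3 := mvfderiv_clm_comp (a • ContinuousLinearMap.id ℝ F) h1 (timeUnit t)
  rw [h2] at h3
  exact ⟨((a • ContinuousLinearMap.id ℝ F).differentiableAt.mdifferentiableAt.comp t h1 :),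
    h3.trans (smul_sub _ _ _)⟩

theorem mfderiv_timeField (hy : ∀ p, y.fst p = timeField J M p) (p : J × M) :
    mfderiv (𝓘(ℝ, ℝ).prod 𝓘(ℝ, E')) 𝓘(ℝ, E) φ p (timeField J M p) =
      B.anchor (φ p) (y.snd p) := by
  rw [← hy, y.mfderiv_fst]

/-- The flat equation does not depend on the frame. -/
theorem SolvesFlatEquation.isFlatAt (hφ : ContMDiff (𝓘(ℝ, ℝ).prod 𝓘(ℝ, E')) 𝓘(ℝ, E) ∞ φ)
    (hy : ∀ p, y.fst p = timeField J M p) {w : TangentSpace 𝓘(ℝ, E') m}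
    {c : ∀ t : J, V (φ (t, m))} {t : J} {n₀ : N} (hn₀ : φ (t, m) ∈ frameNhd E F V n₀)
    (hadm : mfderiv 𝓘(ℝ, E') 𝓘(ℝ, E) (fun z ↦ φ (t, z)) m w = B.anchor (φ (t, m)) (c t))
    (hc : SolvesFlatEquation y w c t n₀) : IsFlatAt y w c t := by
  refine ⟨hadm, fun n₁ hn₁ ↦ ?_⟩
  obtain ⟨h1, h2⟩ := hc
  have hb := frameNhd_subset_baseSet (E := E) (F := F) (V := V) n₀ hn₀
  have hb₁ := frameNhd_subset_baseSet (E := E) (F := F) (V := V) n₁ hn₁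
  have hφt : MDifferentiableAt (𝓘(ℝ, ℝ).prod 𝓘(ℝ, E')) 𝓘(ℝ, E) φ (t, m) :=
    hφ.mdifferentiableAt (by simp)
  have hφl : MDifferentiableAt 𝓘(ℝ, ℝ) 𝓘(ℝ, E) (fun r ↦ φ (r, m)) t :=
    hφt.comp t (mdifferentiableAt_slice_left t m)
  have hC : MDifferentiableAt 𝓘(ℝ, E) 𝓘(ℝ, F →L[ℝ] F) (frameChange F V n₀ n₁) (φ (t, m)) :=
    (contMDiffAt_frameChange hb hb₁).mdifferentiableAt (by simp)
  have hW : ∀ᶠ p in 𝓝 (t, m), φ p ∈ (trivializationAt F V n₀).baseSet :=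
    hφ.continuous.continuousAt.eventually_mem ((trivializationAt F V n₀).open_baseSet.mem_nhds hb)
  have hYd : MDifferentiableAt (𝓘(ℝ, ℝ).prod 𝓘(ℝ, E')) 𝓘(ℝ, F) (y.sndCoord n₀) (t, m) :=
    (y.contMDiffAt_sndCoord hn₀).mdifferentiableAt (by simp)
  have hc1 : (fun r ↦ coord F V n₁ (φ (r, m)) (c r)) =ᶠ[𝓝 t]
      fun r ↦ frameChange F V n₀ n₁ (φ (r, m)) (coord F V n₀ (φ (r, m)) (c r)) := by
    have h : ContinuousAt (fun r : J ↦ (r, m)) t := by fun_prop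
    filter_upwards [h.eventually hW] with r hr using (frameChange_coord hr _).symm
  have hy1 : y.sndCoord n₁ =ᶠ[𝓝 (t, m)] fun p ↦ frameChange F V n₀ n₁ (φ p) (y.sndCoord n₀ p) := by
    filter_upwards [hW] with p hp using (frameChange_coord hp _).symm
  have hCl : MDifferentiableAt 𝓘(ℝ, ℝ) 𝓘(ℝ, F →L[ℝ] F)
      (fun r ↦ frameChange F V n₀ n₁ (φ (r, m))) t :=
    MDifferentiableAt.comp (g := frameChange F V n₀ n₁) t hC hφl
  have hCp : MDifferentiableAt (𝓘(ℝ, ℝ).prod 𝓘(ℝ, E')) 𝓘(ℝ, F →L[ℝ] F)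
      (fun p ↦ frameChange F V n₀ n₁ (φ p)) (t, m) :=
    MDifferentiableAt.comp (g := frameChange F V n₀ n₁) (t, m) hC hφt
  refine ⟨(hCl.clm_apply h1).congr_of_eventuallyEq hc1, ?_⟩
  have hd : mfderiv 𝓘(ℝ, ℝ) 𝓘(ℝ, E) (fun r ↦ φ (r, m)) t (timeUnit t) =
      B.anchor (φ (t, m)) (y.snd (t, m)) :=
    (mfderiv_slice_left hφt).trans (mfderiv_timeField hy (t, m))
  have hd' : mfderiv (𝓘(ℝ, ℝ).prod 𝓘(ℝ, E')) 𝓘(ℝ, E) φ (t, m) (tangentPair (t, m) 0 w) =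
      B.anchor (φ (t, m)) (c t) := (mfderiv_slice_right hφt w).symm.trans hadm
  have hlaw := B.structureMap_frameChange hn₀ hn₁ (y.sndCoord n₀ (t, m))
    (coord F V n₀ (φ (t, m)) (c t))
  have hYv : frameVec F V n₀ (φ (t, m)) (y.sndCoord n₀ (t, m)) = y.snd (t, m) :=
    frameVec_coord hb _
  have hy2 : y.sndCoord n₁ (t, m) = frameChange F V n₀ n₁ (φ (t, m)) (y.sndCoord n₀ (t, m)) :=
    (frameChange_coord hb _).symm
  rw [hYv, frameVec_coord hb, frameChange_coord hb] at hlaw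
  rw [hc1.mvfderiv_eq, mvfderiv_clm_apply hCl h1, mvfderiv_comp_vec (f := fun r ↦ φ (r, m)) hC hφl, hd, h2,
    hy1.mvfderiv_eq, mvfderiv_clm_apply hCp hYd, mvfderiv_comp_vec hC hφt, hd',
    hy2, hlaw, map_sub]
  abel

theorem eq_of_isFlatAt (hφ : ContMDiff (𝓘(ℝ, ℝ).prod 𝓘(ℝ, E')) 𝓘(ℝ, E) ∞ φ)
    {w : TangentSpace 𝓘(ℝ, E') m} {K : Set ℝ} (hKo : IsOpen K) (hK : K.OrdConnected) (hKJ : K ⊆ J)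
    {c c' : ∀ t : J, V (φ (t, m))} (hc : ∀ t : J, (t : ℝ) ∈ K → IsFlatAt y w c t)
    (hc' : ∀ t : J, (t : ℝ) ∈ K → IsFlatAt y w c' t) {s t : J} (hs : (s : ℝ) ∈ K)
    (ht : (t : ℝ) ∈ K) (h0 : c s = c' s) : c t = c' t := by
  refine (isPreconnected_preimage_opens hK hKJ).induction₂ (fun s t ↦ c s = c' s ↔ c t = c' t)
    (fun t₀ ht₀ ↦ ?_) (fun _ _ _ _ _ _ ↦ Iff.trans) (fun _ _ _ _ ↦ Iff.symm) hs ht |>.1 h0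
  have hm : Continuous (fun r : J ↦ (r, m)) := by fun_prop
  have hφm : Continuous (fun r : J ↦ φ (r, m)) := hφ.continuous.comp hm
  obtain ⟨L, hLo, hL, hLJ, htL, hLW⟩ := eventually_exists_ordConnected
    (((hφm.continuousAt (x := t₀)).eventually_mem ((isOpen_frameNhd (E := E) (F := F) (V := V)
      (φ (t₀, m))).mem_nhds (mem_frameNhd_self _))).and (eventually_mem_opens hKo ht₀))
  refine mem_nhdsWithin_of_mem_nhds ?_
  set n₀ := φ (t₀, m)
  have hstep : ∀ s t : J, (s : ℝ) ∈ L → (t : ℝ) ∈ L → c s = c' s → c t = c' t := by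
    intro s t hs ht h0
    apply coord_injective (frameNhd_subset_baseSet (E := E) n₀ (hLW t ht).1)
    refine sub_eq_zero.1 (eq_zero_of_linear_ode_opens hLo hL hLJ
      (x := fun r ↦ coord F V n₀ (φ (r, m)) (c r) - coord F V n₀ (φ (r, m)) (c' r))
      (A := fun r ↦ -B.structureMap n₀ (φ (r, m)) (y.sndCoord n₀ (r, m))) (fun r hr ↦ ?_)
      (fun r hr ↦ ?_) hs ht (by rw [h0, sub_self]))
    · have h1 := (B.contMDiffAt_structureMap (hLW r hr).1).continuousAt
      have h2 := (y.contMDiffAt_sndCoord (hLW r hr).1).continuousAt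
      have h3 : ContinuousAt (fun r : J ↦ B.structureMap n₀ (φ (r, m))) r :=
        h1.comp (f := fun r : J ↦ φ (r, m)) hφm.continuousAt
      have h4 : ContinuousAt (fun r : J ↦ y.sndCoord n₀ (r, m)) r :=
        h2.comp (f := fun r : J ↦ (r, m)) hm.continuousAt
      exact (h3.clm_apply h4).neg
    · obtain ⟨h1, h2⟩ := (hc r (hLW r hr).2).2 n₀ (hLW r hr).1
      obtain ⟨h1', h2'⟩ := (hc' r (hLW r hr).2).2 n₀ (hLW r hr).1
      refine ⟨h1.sub h1', ?_⟩
      rw [mvfderiv_fun_sub h1 h1']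
      refine (congrArg₂ (· - ·) h2 h2').trans ?_
      rw [neg_apply, map_sub]
      abel
  filter_upwards [eventually_mem_opens hLo htL] with r hr
  exact ⟨hstep _ _ htL hr, hstep _ _ hr htL⟩

/-- The constraint on flat curves is preserved by the flat equation: the defect of the constraint
satisfies a linear differential equation. -/
theorem SolvesFlatEquation.isFlatAt_of_initial
    (hφ : ContMDiff (𝓘(ℝ, ℝ).prod 𝓘(ℝ, E')) 𝓘(ℝ, E) ∞ φ)
    (hy : ∀ p, y.fst p = timeField J M p) {w : TangentSpace 𝓘(ℝ, E') m} {n₀ : N}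
    {K : Set ℝ} (hKo : IsOpen K) (hK : K.OrdConnected) (hKJ : K ⊆ J)
    (hKW : ∀ t : J, (t : ℝ) ∈ K → φ (t, m) ∈ frameNhd E F V n₀)
    {c : ∀ t : J, V (φ (t, m))} (hc : ∀ t : J, (t : ℝ) ∈ K → SolvesFlatEquation y w c t n₀) {s : J}
    (hs : (s : ℝ) ∈ K)
    (hadm : mfderiv 𝓘(ℝ, E') 𝓘(ℝ, E) (fun z ↦ φ (s, z)) m w = B.anchor (φ (s, m)) (c s))
    {t : J} (ht : (t : ℝ) ∈ K) : IsFlatAt y w c t := by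
  refine (hc t ht).isFlatAt hφ hy (hKW t ht) ?_
  obtain ⟨X, rfl, hX⟩ := exists_vectorField m w
  have hm : Continuous (fun r : J ↦ (r, m)) := by fun_prop
  have hφm : Continuous (fun r : J ↦ φ (r, m)) := hφ.continuous.comp hm
  have hφd : MDifferentiable (𝓘(ℝ, ℝ).prod 𝓘(ℝ, E')) 𝓘(ℝ, E) φ := hφ.mdifferentiable (by simp)
  have hs' := frameNhd_subset_extChartAt_source (E := E) (F := F) (V := V) n₀
  set κ := extChartAt 𝓘(ℝ, E) n₀ with hκ
  let g : J × M → E := fun p ↦ κ (φ p)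
  have hκs : ∀ t : J, (t : ℝ) ∈ K → ContMDiffAt 𝓘(ℝ, E) 𝓘(ℝ, E) ∞ κ (φ (t, m)) := fun t ht ↦
    contMDiffAt_extChartAt' (frameNhd_subset_source n₀ (hKW t ht))
  have hg : ∀ t : J, (t : ℝ) ∈ K → ContMDiffAt (𝓘(ℝ, ℝ).prod 𝓘(ℝ, E')) 𝓘(ℝ, E) ∞ g (t, m) :=
    fun t ht ↦ (hκs t ht).comp (t, m) hφ.contMDiffAt
  -- the defect of the constraint, in the chart `κ`
  let δ : J → E := fun r ↦ mvfderiv (𝓘(ℝ, ℝ).prod 𝓘(ℝ, E')) g (r, m) (spaceField J X (r, m)) -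
    B.anchorMatrix n₀ (φ (r, m)) (coord F V n₀ (φ (r, m)) (c r))
  have hδ : ∀ r : J, (r : ℝ) ∈ K → δ r = mvfderiv 𝓘(ℝ, E) κ (φ (r, m))
      (mfderiv 𝓘(ℝ, E') 𝓘(ℝ, E) (fun z ↦ φ (r, z)) m (X m) - B.anchor (φ (r, m)) (c r)) := by
    intro r hr
    rw [map_sub, ← B.anchorMatrix_coord (hKW r hr), mfderiv_slice_right (hφd _),
      ← mvfderiv_comp_vec ((hκs r hr).mdifferentiableAt (by simp)) (hφd _)]
    rfl
  suffices h : δ t = 0 by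
    refine mvfderiv_extChartAt_injective (hs' (hKW t ht)) (sub_eq_zero.1 ?_)
    rw [← map_sub, ← hδ t ht, h]
  let L : E → E →L[ℝ] F →L[ℝ] E := fderiv ℝ (fun u ↦ B.anchorMatrix n₀ (κ.symm u))
  refine eq_zero_of_linear_ode_opens hKo hK hKJ
    (A := fun r ↦ (L (κ (φ (r, m)))).flip (y.sndCoord n₀ (r, m))) (fun r hr ↦ ?_) (fun r hr ↦ ?_)
    hs ht ?_
  · have h1 : ContinuousAt L (κ (φ (r, m))) := by
      have h2 : ContMDiffAt 𝓘(ℝ, E) 𝓘(ℝ, E) ∞ κ.symm (κ (φ (r, m))) :=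
        (contMDiffOn_extChartAt_symm n₀).contMDiffAt
          (extChartAt_target_mem_nhds' (κ.map_source (hs' (hKW r hr))))
      have h3 : ContMDiffAt 𝓘(ℝ, E) 𝓘(ℝ, F →L[ℝ] E) ∞ (fun u ↦ B.anchorMatrix n₀ (κ.symm u))
          (κ (φ (r, m))) := by
        refine ContMDiffAt.comp (g := B.anchorMatrix n₀) _ ?_ h2
        rw [κ.left_inv (hs' (hKW r hr))]
        exact B.contMDiffAt_anchorMatrix (hKW r hr)
      exact (h3.contDiffAt.fderiv_right (m := 0) (by simp)).continuousAt
    have h2 : ContinuousAt (fun r : J ↦ κ (φ (r, m))) r :=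
      (hκs r hr).continuousAt.comp (f := fun r : J ↦ φ (r, m)) hφm.continuousAt
    have h3 : ContinuousAt (fun r : J ↦ y.sndCoord n₀ (r, m)) r :=
      (y.contMDiffAt_sndCoord (hKW r hr)).continuousAt.comp (f := fun r : J ↦ (r, m)) hm.continuousAt
    have h4 : ContinuousAt (fun r : J ↦ (L (κ (φ (r, m)))).flip) r :=
      (ContinuousLinearMap.flipₗᵢ ℝ E F E).continuous.continuousAt.comp
        (h1.comp (f := fun r : J ↦ κ (φ (r, m))) h2)
    exact h4.clm_apply h3
  · obtain ⟨h1, h2⟩ := hc r hr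
    have hφl : MDifferentiableAt 𝓘(ℝ, ℝ) 𝓘(ℝ, E) (fun r ↦ φ (r, m)) r :=
      (hφd _).comp r (mdifferentiableAt_slice_left r m)
    have hAd : MDifferentiableAt 𝓘(ℝ, E) 𝓘(ℝ, F →L[ℝ] E) (B.anchorMatrix n₀) (φ (r, m)) :=
      (B.contMDiffAt_anchorMatrix (hKW r hr)).mdifferentiableAt (by simp)
    have hAl : MDifferentiableAt 𝓘(ℝ, ℝ) 𝓘(ℝ, F →L[ℝ] E)
        (fun r ↦ B.anchorMatrix n₀ (φ (r, m))) r :=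
      MDifferentiableAt.comp (g := B.anchorMatrix n₀) r hAd hφl
    have hAp : MDifferentiableAt (𝓘(ℝ, ℝ).prod 𝓘(ℝ, E')) 𝓘(ℝ, F →L[ℝ] E)
        (fun p ↦ B.anchorMatrix n₀ (φ p)) (r, m) :=
      MDifferentiableAt.comp (g := B.anchorMatrix n₀) (r, m) hAd (hφd _)
    have hYd : MDifferentiableAt (𝓘(ℝ, ℝ).prod 𝓘(ℝ, E')) 𝓘(ℝ, F) (y.sndCoord n₀) (r, m) :=
      (y.contMDiffAt_sndCoord (hKW r hr)).mdifferentiableAt (by simp)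
    have hgX : MDifferentiableAt (𝓘(ℝ, ℝ).prod 𝓘(ℝ, E')) 𝓘(ℝ, E)
        (fun p ↦ mvfderiv (𝓘(ℝ, ℝ).prod 𝓘(ℝ, E')) g p (spaceField J X p)) (r, m) :=
      ((hg r hr).mvfderiv_apply (contMDiffAt_spaceField hX)).mdifferentiableAt (by simp)
    have h3 : MDifferentiableAt 𝓘(ℝ, ℝ) 𝓘(ℝ, E) (fun r ↦
        mvfderiv (𝓘(ℝ, ℝ).prod 𝓘(ℝ, E')) g (r, m) (spaceField J X (r, m))) r :=
      MDifferentiableAt.comp (f := fun r : J ↦ (r, m)) r hgX (mdifferentiableAt_slice_left r m)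
    have h4 := hAl.clm_apply h1
    refine ⟨h3.sub h4, ?_⟩
    have hyt : (fun p ↦ mvfderiv (𝓘(ℝ, ℝ).prod 𝓘(ℝ, E')) g p (timeField J M p)) =ᶠ[𝓝 (r, m)]
        fun p ↦ B.anchorMatrix n₀ (φ p) (y.sndCoord n₀ p) := by
      filter_upwards [hφ.continuous.continuousAt.eventually_mem
        ((isOpen_frameNhd n₀).mem_nhds (hKW r hr))] with p hp
      rw [← hy, y.mvfderiv_sndCoord_anchor hφ hp]
    have h5 : mvfderiv 𝓘(ℝ, ℝ) (fun r ↦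
        mvfderiv (𝓘(ℝ, ℝ).prod 𝓘(ℝ, E')) g (r, m) (spaceField J X (r, m))) r (timeUnit r) =
        mvfderiv 𝓘(ℝ, E) (B.anchorMatrix n₀) (φ (r, m))
          (mfderiv (𝓘(ℝ, ℝ).prod 𝓘(ℝ, E')) 𝓘(ℝ, E) φ (r, m) (spaceField J X (r, m)))
          (y.sndCoord n₀ (r, m)) + B.anchorMatrix n₀ (φ (r, m))
          (mvfderiv (𝓘(ℝ, ℝ).prod 𝓘(ℝ, E')) (y.sndCoord n₀) (r, m) (spaceField J X (r, m))) := by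
      refine (mvfderiv_slice_left hgX).trans ((mvfderiv_timeField_comm (hg r hr) hX).trans ?_)
      rw [hyt.mvfderiv_eq, mvfderiv_clm_apply hAp hYd, mvfderiv_comp_vec hAd (hφd _)]
    have hd : mfderiv 𝓘(ℝ, ℝ) 𝓘(ℝ, E) (fun r ↦ φ (r, m)) r (timeUnit r) =
        B.anchor (φ (r, m)) (y.snd (r, m)) :=
      (mfderiv_slice_left (hφd _)).trans (mfderiv_timeField hy (r, m))
    have h6 := mvfderiv_clm_apply hAl h1 (timeUnit r)
    rw [mvfderiv_comp_vec (f := fun r ↦ φ (r, m)) hAd hφl, hd, h2, map_sub, B.anchorMatrix_structureMap (hKW r hr)] at h6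
    have hb := frameNhd_subset_baseSet (E := E) (F := F) (V := V) n₀ (hKW r hr)
    have hYv : frameVec F V n₀ (φ (r, m)) (y.sndCoord n₀ (r, m)) = y.snd (r, m) :=
      frameVec_coord hb _
    rw [hYv, frameVec_coord hb] at h6
    have h7 : (L (κ (φ (r, m)))).flip (y.sndCoord n₀ (r, m)) (δ r) =
        mvfderiv 𝓘(ℝ, E) (B.anchorMatrix n₀) (φ (r, m)) (mfderiv 𝓘(ℝ, E') 𝓘(ℝ, E)
          (fun z ↦ φ (r, z)) m (X m) - B.anchor (φ (r, m)) (c r)) (y.sndCoord n₀ (r, m)) := by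
      rw [mvfderiv_eq_fderiv_comp_extChartAt_symm (hs' (hKW r hr)) hAd, ← hκ, ← hδ r hr]
      rfl
    rw [h7, mvfderiv_fun_sub h3 h4]
    refine (congrArg₂ (· - ·) h5 h6).trans ?_
    rw [map_sub, mfderiv_slice_right (hφd _), sub_apply]
    simp only [spaceField]
    abel
  · rw [hδ s hs, hadm, sub_self, map_zero]

end Flat

end LieAlgebroid

/-! ### Existence of flat curves and parallel transport -/

namespace LieAlgebroid

section Transport

variable {E : Type*} [NormedAddCommGroup E] [NormedSpace ℝ E] [FiniteDimensional ℝ E]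
  {N : Type*} [TopologicalSpace N] [T2Space N] [ChartedSpace E N] [IsManifold 𝓘(ℝ, E) ∞ N]
  {F : Type*} [NormedAddCommGroup F] [NormedSpace ℝ F] [FiniteDimensional ℝ F]
  {V : N → Type*} [TopologicalSpace (TotalSpace F V)]
  [∀ x, AddCommGroup (V x)] [∀ x, Module ℝ (V x)] [∀ x, TopologicalSpace (V x)]
  [FiberBundle F V] [VectorBundle ℝ F V] [ContMDiffVectorBundle ∞ F V 𝓘(ℝ, E)]
  {B : LieAlgebroid 𝓘(ℝ, E) F V}
  {E' : Type*} [NormedAddCommGroup E'] [NormedSpace ℝ E'] [FiniteDimensional ℝ E']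
  {M : Type*} [TopologicalSpace M] [ChartedSpace E' M] [IsManifold 𝓘(ℝ, E') ∞ M]
  {J : Opens ℝ} {φ : J × M → N} {m : M}

/-- The section `y` of `φ^{!!}B` is of the form `(∂/∂t, y)`, where `φ : J × M → N` is smooth and `J`
is an interval. -/
structure IsTimeSection (y : B.PullbackSection (𝓘(ℝ, ℝ).prod 𝓘(ℝ, E')) φ) : Prop where
  ordConnected : (J : Set ℝ).OrdConnected
  contMDiff : ContMDiff (𝓘(ℝ, ℝ).prod 𝓘(ℝ, E')) 𝓘(ℝ, E) ∞ φ
  fst_eq : ∀ p, y.fst p = timeField J M p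

/-- The generator of the flat equation in the frame at `φ x₀` and the chart at `x₀`: it acts on the
components `(w, c)`, and the component `w` does not change. -/
def flatGenerator (y : B.PullbackSection (𝓘(ℝ, ℝ).prod 𝓘(ℝ, E')) φ) (x₀ : J × M) (q : ℝ × E') :
    (E' × F) →L[ℝ] (E' × F) :=
  let κ := extChartAt (𝓘(ℝ, ℝ).prod 𝓘(ℝ, E')) x₀
  (ContinuousLinearMap.inr ℝ E' F).comp
    (((fderiv ℝ (fun q ↦ y.sndCoord (φ x₀) (κ.symm q)) q).comp
        ((ContinuousLinearMap.inr ℝ ℝ E').comp (ContinuousLinearMap.fst ℝ E' F)))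
      - (B.structureMap (φ x₀) (φ (κ.symm q)) (y.sndCoord (φ x₀) (κ.symm q))).comp
        (ContinuousLinearMap.snd ℝ E' F))

variable {y : B.PullbackSection (𝓘(ℝ, ℝ).prod 𝓘(ℝ, E')) φ}

theorem contDiffAt_flatGenerator (hφ : ContMDiff (𝓘(ℝ, ℝ).prod 𝓘(ℝ, E')) 𝓘(ℝ, E) ∞ φ)
    {x₀ : J × M} {q : ℝ × E'} (hq : q ∈ (extChartAt (𝓘(ℝ, ℝ).prod 𝓘(ℝ, E')) x₀).target)
    (hW : φ ((extChartAt (𝓘(ℝ, ℝ).prod 𝓘(ℝ, E')) x₀).symm q) ∈ frameNhd E F V (φ x₀)) :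
    ContDiffAt ℝ ∞ (flatGenerator y x₀) q := by
  set κ := extChartAt (𝓘(ℝ, ℝ).prod 𝓘(ℝ, E')) x₀
  have hκ : ContMDiffAt 𝓘(ℝ, ℝ × E') (𝓘(ℝ, ℝ).prod 𝓘(ℝ, E')) ∞ κ.symm q :=
    (contMDiffOn_extChartAt_symm x₀).contMDiffAt (extChartAt_target_mem_nhds' hq)
  have hφκ : ContMDiffAt 𝓘(ℝ, ℝ × E') 𝓘(ℝ, E) ∞ (fun q ↦ φ (κ.symm q)) q :=
    hφ.contMDiffAt.comp q hκ
  have hY : ContDiffAt ℝ ∞ (fun q ↦ y.sndCoord (φ x₀) (κ.symm q)) q :=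
    ((y.contMDiffAt_sndCoord hW).comp q hκ).contDiffAt
  have hS : ContDiffAt ℝ ∞ (fun q ↦ B.structureMap (φ x₀) (φ (κ.symm q))) q :=
    (ContMDiffAt.comp (g := B.structureMap (φ x₀)) q (B.contMDiffAt_structureMap hW)
      hφκ).contDiffAt
  have h1 := hY.fderiv_right (m := ∞) (by simp)
  have h2 := hS.clm_apply hY
  exact contDiffAt_const.clm_comp ((h1.clm_comp contDiffAt_const).sub
    (h2.clm_comp contDiffAt_const))

/-- Near every point, the flat equation has a smooth fundamental solution. -/
theorem exists_fundamentalSolution (hφ : ContMDiff (𝓘(ℝ, ℝ).prod 𝓘(ℝ, E')) 𝓘(ℝ, E) ∞ φ)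
    (y : B.PullbackSection (𝓘(ℝ, ℝ).prod 𝓘(ℝ, E')) φ) (x₀ : J × M) :
    ∃ (K : Set ℝ) (O : Set M) (R : J × M → (E' × F) →L[ℝ] (E' × F)),
      IsOpen K ∧ K.OrdConnected ∧ K ⊆ J ∧ (x₀.1 : ℝ) ∈ K ∧ IsOpen O ∧ x₀.2 ∈ O ∧
      O ⊆ (extChartAt 𝓘(ℝ, E') x₀.2).source ∧ ∀ t : J, (t : ℝ) ∈ K → ∀ m ∈ O,
        φ (t, m) ∈ frameNhd E F V (φ x₀) ∧
        ContMDiffAt (𝓘(ℝ, ℝ).prod 𝓘(ℝ, E')) 𝓘(ℝ, (E' × F) →L[ℝ] (E' × F)) ∞ R (t, m) ∧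
        IsUnit (R (t, m)) ∧
        mvfderiv 𝓘(ℝ, ℝ) (fun r ↦ R (r, m)) t (timeUnit t) =
          flatGenerator y x₀ (extChartAt (𝓘(ℝ, ℝ).prod 𝓘(ℝ, E')) x₀ (t, m)) * R (t, m) := by
  have : CompleteSpace (E' × F) := FiniteDimensional.complete ℝ _
  set κ := extChartAt (𝓘(ℝ, ℝ).prod 𝓘(ℝ, E')) x₀
  let U : Set (ℝ × E') := κ.target ∩ κ.symm ⁻¹' (φ ⁻¹' frameNhd E F V (φ x₀))
  have hU : IsOpen U := (continuousOn_extChartAt_symm x₀).isOpen_inter_preimage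
    (isOpen_extChartAt_target x₀) ((isOpen_frameNhd _).preimage hφ.continuous)
  have hx₀ : κ x₀ = ((x₀.1 : ℝ), extChartAt 𝓘(ℝ, E') x₀.2 x₀.2) := extChartAt_prod_apply x₀ x₀
  have h0 : ((x₀.1 : ℝ), extChartAt 𝓘(ℝ, E') x₀.2 x₀.2) ∈ U := by
    rw [← hx₀]
    refine ⟨mem_extChartAt_target x₀, ?_⟩
    rw [Set.mem_preimage, κ.left_inv (mem_extChartAt_source x₀)]
    exact mem_frameNhd_self _
  obtain ⟨δ, hδ, hδU, R, hR⟩ := exists_smooth_fundamental_solution_of_contDiffOn hU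
    (fun q hq ↦ (contDiffAt_flatGenerator (y := y) hφ hq.1 hq.2).contDiffWithinAt) h0
  have hball : ∀ r ∈ Metric.ball (x₀.1 : ℝ) δ, r ∈ J := fun r hr ↦ by
    have h1 := κ.right_inv (hδU (Set.mk_mem_prod hr (Metric.mem_ball_self hδ))).1
    rw [show κ (κ.symm _) = _ from extChartAt_prod_apply x₀ _] at h1
    have h2 := congrArg Prod.fst h1
    dsimp only at h2
    rw [← h2]
    exact Subtype.coe_prop _
  refine ⟨Metric.ball x₀.1 δ, (extChartAt 𝓘(ℝ, E') x₀.2).source ∩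
    extChartAt 𝓘(ℝ, E') x₀.2 ⁻¹' Metric.ball (extChartAt 𝓘(ℝ, E') x₀.2 x₀.2) δ,
    fun p ↦ R (κ p), Metric.isOpen_ball, ?_, hball, Metric.mem_ball_self hδ, ?_,
    ⟨mem_extChartAt_source _, Metric.mem_ball_self hδ⟩, Set.inter_subset_left, ?_⟩
  · rw [Real.ball_eq_Ioo]
    exact Set.ordConnected_Ioo
  · exact (continuousOn_extChartAt x₀.2).isOpen_inter_preimage (isOpen_extChartAt_source x₀.2)
      Metric.isOpen_ball
  · rintro t ht m ⟨hm, hm'⟩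
    have hs : (t, m) ∈ κ.source := mem_extChartAt_prod_source hm
    have hκ : ∀ r : J, κ (r, m) = ((r : ℝ), extChartAt 𝓘(ℝ, E') x₀.2 m) := fun r ↦
      extChartAt_prod_apply x₀ (r, m)
    obtain ⟨hR1, hR2, hR3⟩ := hR t ht _ hm'
    refine ⟨?_, ?_, ?_, ?_⟩
    · have h1 := (hδU (Set.mk_mem_prod ht (Set.mem_preimage.1 hm'))).2
      rw [← hκ t, Set.mem_preimage, κ.left_inv hs] at h1
      exact h1
    · rw [← hκ t] at hR1
      refine ContMDiffAt.comp (g := R) (t, m) hR1.contMDiffAt (contMDiffAt_extChartAt' ?_)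
      rwa [← extChartAt_source (𝓘(ℝ, ℝ).prod 𝓘(ℝ, E'))]
    · change IsUnit (R (κ (t, m)))
      rwa [hκ]
    · simp only [hκ]
      exact hR3.mvfderiv_opens

/-- Near every point, the flat equation is solved by a smooth propagator `T`. -/
theorem IsTimeSection.exists_propagator (h : IsTimeSection y) (x₀ : J × M) :
    ∃ (K : Set ℝ) (O : Set M) (T : J × J × M → (E' × F) →L[ℝ] F),
      IsOpen K ∧ K.OrdConnected ∧ K ⊆ J ∧ (x₀.1 : ℝ) ∈ K ∧ IsOpen O ∧ x₀.2 ∈ O ∧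
      O ⊆ (extChartAt 𝓘(ℝ, E') x₀.2).source ∧ ∀ s : J, (s : ℝ) ∈ K → ∀ m ∈ O,
        φ (s, m) ∈ frameNhd E F V (φ x₀) ∧
        (∀ t : J, (t : ℝ) ∈ K → ContMDiffAt (𝓘(ℝ, ℝ).prod (𝓘(ℝ, ℝ).prod 𝓘(ℝ, E')))
          𝓘(ℝ, (E' × F) →L[ℝ] F) ∞ T (s, t, m)) ∧
        ∀ (w : TangentSpace 𝓘(ℝ, E') m) (b : V (φ (s, m))),
          mfderiv 𝓘(ℝ, E') 𝓘(ℝ, E) (fun z ↦ φ (s, z)) m w = B.anchor (φ (s, m)) b →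
          let c : ∀ t : J, V (φ (t, m)) := fun t ↦ frameVec F V (φ x₀) (φ (t, m))
            (T (s, t, m) (mvfderiv 𝓘(ℝ, E') (extChartAt 𝓘(ℝ, E') x₀.2) m w,
              coord F V (φ x₀) (φ (s, m)) b))
          c s = b ∧ ∀ t : J, (t : ℝ) ∈ K → IsFlatAt y w c t := by
  have : CompleteSpace (E' × F) := FiniteDimensional.complete ℝ _
  obtain ⟨K, O, R, hKo, hK, hKJ, hxK, hO, hxO, hOs, hR⟩ := exists_fundamentalSolution h.contMDiff y x₀
  refine ⟨K, O, fun p ↦ (ContinuousLinearMap.snd ℝ E' F).comp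
    (R (p.2.1, p.2.2) * Ring.inverse (R (p.1, p.2.2))), hKo, hK, hKJ, hxK, hO, hxO, hOs,
    fun s hs m hm ↦ ⟨(hR s hs m hm).1, fun t ht ↦ ?_, fun w b hwb ↦ ?_⟩⟩
  · obtain ⟨u, hu⟩ := (hR s hs m hm).2.2.1
    have h1 : ContMDiffAt (𝓘(ℝ, ℝ).prod (𝓘(ℝ, ℝ).prod 𝓘(ℝ, E')))
        𝓘(ℝ, (E' × F) →L[ℝ] (E' × F)) ∞ (fun p : J × J × M ↦ R (p.2.1, p.2.2)) (s, t, m) :=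
      ContMDiffAt.comp (g := R) (s, t, m) (hR t ht m hm).2.1 contMDiffAt_snd
    have h2 : ContMDiffAt (𝓘(ℝ, ℝ).prod (𝓘(ℝ, ℝ).prod 𝓘(ℝ, E')))
        𝓘(ℝ, (E' × F) →L[ℝ] (E' × F)) ∞ (fun p : J × J × M ↦ R (p.1, p.2.2)) (s, t, m) :=
      ContMDiffAt.comp (g := R) (s, t, m) (hR s hs m hm).2.1
        (contMDiffAt_fst.prodMk (contMDiffAt_snd.comp (s, t, m) contMDiffAt_snd))
    have h3 : ContDiffAt ℝ ∞ Ring.inverse (R (s, m)) := hu ▸ contDiffAt_ringInverse ℝ u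
    have h4 : ContMDiffAt (𝓘(ℝ, ℝ).prod (𝓘(ℝ, ℝ).prod 𝓘(ℝ, E')))
        𝓘(ℝ, (E' × F) →L[ℝ] (E' × F)) ∞ (fun p : J × J × M ↦ Ring.inverse (R (p.1, p.2.2)))
          (s, t, m) :=
      ContMDiffAt.comp (g := Ring.inverse) (s, t, m) h3.contMDiffAt h2
    exact contMDiffAt_const.clm_comp (h1.clm_comp h4)
  · intro c
    set n₀ := φ x₀
    set w' : E' := mvfderiv 𝓘(ℝ, E') (extChartAt 𝓘(ℝ, E') x₀.2) m w with hw'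
    set v : E' × F := Ring.inverse (R (s, m)) (w', coord F V n₀ (φ (s, m)) b) with hv
    have hb : ∀ t : J, (t : ℝ) ∈ K → φ (t, m) ∈ (trivializationAt F V n₀).baseSet :=
      fun t ht ↦ frameNhd_subset_baseSet (E := E) n₀ (hR t ht m hm).1
    let ξ : J → E' × F := fun t ↦ R (t, m) v
    have hξs : ξ s = (w', coord F V n₀ (φ (s, m)) b) :=
      congrArg (fun L : (E' × F) →L[ℝ] (E' × F) ↦ L (w', coord F V n₀ (φ (s, m)) b))
        (Ring.mul_inverse_cancel _ (hR s hs m hm).2.2.1)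
    have hξd : ∀ t : J, (t : ℝ) ∈ K → MDifferentiableAt 𝓘(ℝ, ℝ) 𝓘(ℝ, E' × F) ξ t ∧
        mvfderiv 𝓘(ℝ, ℝ) ξ t (timeUnit t) =
          flatGenerator y x₀ (extChartAt (𝓘(ℝ, ℝ).prod 𝓘(ℝ, E')) x₀ (t, m)) (ξ t) := by
      intro t ht
      obtain ⟨-, h1, -, h2⟩ := hR t ht m hm
      have h3 : MDifferentiableAt 𝓘(ℝ, ℝ) 𝓘(ℝ, (E' × F) →L[ℝ] (E' × F)) (fun r ↦ R (r, m)) t :=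
        MDifferentiableAt.comp (f := fun r : J ↦ (r, m)) t (h1.mdifferentiableAt (by simp))
          (mdifferentiableAt_slice_left t m)
      refine ⟨h3.clm_apply mdifferentiableAt_const, ?_⟩
      rw [mvfderiv_clm_apply_const h3, h2]
      rfl
    have hξ1 : ∀ t : J, (t : ℝ) ∈ K → (ξ t).1 = w' := by
      intro t ht
      refine sub_eq_zero.1 (eq_zero_of_linear_ode_opens hKo hK hKJ (x := fun t ↦ (ξ t).1 - w')
        (A := fun _ ↦ 0) (fun r _ ↦ continuousAt_const) (fun r hr ↦ ?_) hs ht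
        (by rw [hξs, sub_self]))
      have h1 : MDifferentiableAt 𝓘(ℝ, ℝ) 𝓘(ℝ, E') (fun t ↦ (ξ t).1) r :=
        MDifferentiableAt.comp (g := ContinuousLinearMap.fst ℝ E' F) r
          (ContinuousLinearMap.fst ℝ E' F).differentiableAt.mdifferentiableAt (hξd r hr).1
      refine ⟨h1.sub mdifferentiableAt_const, ?_⟩
      rw [mvfderiv_fun_sub h1 mdifferentiableAt_const, mvfderiv_const, sub_zero]
      refine (mvfderiv_clm_comp (ContinuousLinearMap.fst ℝ E' F) (hξd r hr).1 _).trans ?_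
      rw [(hξd r hr).2]
      rfl
    have hc : ∀ t : J, (t : ℝ) ∈ K → coord F V n₀ (φ (t, m)) (c t) = (ξ t).2 := fun t ht ↦
      coord_frameVec (hb t ht) _
    have hcs : c s = b := by
      apply coord_injective (hb s hs)
      rw [hc s hs, hξs]
    refine ⟨hcs, fun t ht ↦ SolvesFlatEquation.isFlatAt_of_initial h.contMDiff h.fst_eq hKo hK hKJ
      (fun t ht ↦ (hR t ht m hm).1) (fun t ht ↦ ?_) hs (by rw [hcs, hwb]) ht⟩
    have h1 : (fun r ↦ coord F V n₀ (φ (r, m)) (c r)) =ᶠ[𝓝 t] fun r ↦ (ξ r).2 := by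
      filter_upwards [eventually_mem_opens hKo ht] with r hr using hc r hr
    have h2 : MDifferentiableAt 𝓘(ℝ, ℝ) 𝓘(ℝ, F) (fun t ↦ (ξ t).2) t :=
      MDifferentiableAt.comp (g := ContinuousLinearMap.snd ℝ E' F) t
        (ContinuousLinearMap.snd ℝ E' F).differentiableAt.mdifferentiableAt (hξd t ht).1
    refine ⟨h2.congr_of_eventuallyEq h1, ?_⟩
    have hsrc : ((t, m) : J × M) ∈ (extChartAt (𝓘(ℝ, ℝ).prod 𝓘(ℝ, E')) x₀).source :=
      mem_extChartAt_prod_source (hOs hm)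
    have hYd : MDifferentiableAt (𝓘(ℝ, ℝ).prod 𝓘(ℝ, E')) 𝓘(ℝ, F) (y.sndCoord n₀) (t, m) :=
      (y.contMDiffAt_sndCoord (hR t ht m hm).1).mdifferentiableAt (by simp)
    rw [h1.mvfderiv_eq, hc t ht, mvfderiv_eq_fderiv_comp_extChartAt_symm hsrc hYd,
      mvfderiv_extChartAt_prod (hOs hm)]
    refine (mvfderiv_clm_comp (ContinuousLinearMap.snd ℝ E' F) (hξd t ht).1 _).trans ?_
    rw [(hξd t ht).2, flatGenerator]
    dsimp only
    rw [PartialEquiv.left_inv _ hsrc]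
    have h3 : (mvfderiv 𝓘(ℝ, E') (extChartAt 𝓘(ℝ, E') x₀.2) m w : E') = (ξ t).1 :=
      (hξ1 t ht).symm
    rw [h3]
    rfl

/-- Flat curves exist globally in time. -/
theorem IsTimeSection.exists_isFlatAt (h : IsTimeSection y) (s : J) (w : TangentSpace 𝓘(ℝ, E') m)
    (b : V (φ (s, m)))
    (hb : mfderiv 𝓘(ℝ, E') 𝓘(ℝ, E) (fun z ↦ φ (s, z)) m w = B.anchor (φ (s, m)) b) :
    ∃ c : ∀ t : J, V (φ (t, m)), c s = b ∧ ∀ t, IsFlatAt y w c t := by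
  refine exists_global_solution h.ordConnected (Fl := IsFlatAt y w) (Adm := fun t b ↦
    mfderiv 𝓘(ℝ, E') 𝓘(ℝ, E) (fun z ↦ φ (t, z)) m w = B.anchor (φ (t, m)) b)
    (fun hcc hc ↦ hc.congr hcc) (fun hc ↦ hc.1) (fun t₀ ↦ ?_)
    (fun hKo hK hKJ _ _ hc hc' _ _ hs ht h0 ↦ eq_of_isFlatAt h.contMDiff hKo hK hKJ hc hc' hs ht h0)
    s b hb
  obtain ⟨K, O, T, hKo, hK, hKJ, hxK, hO, hxO, hOs, hT⟩ := h.exists_propagator (t₀, m)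
  exact ⟨K, hKo, hK, hKJ, hxK, fun s hs b hb ↦ by
    have h1 := (hT s hs m hxO).2.2 w b hb
    exact ⟨_, h1.1, h1.2⟩⟩

open Classical in
/-- Parallel transport from time `s` to time `t` along flat curves over the tangent vector `w`. It
is `0` by convention if `(w, b)` does not belong to the pullback of `B` along `φ (s, ·)`. -/
def transport (y : B.PullbackSection (𝓘(ℝ, ℝ).prod 𝓘(ℝ, E')) φ) (s t : J) (m : M)
    (w : TangentSpace 𝓘(ℝ, E') m) (b : V (φ (s, m))) : V (φ (t, m)) :=
  if h : ∃ c : ∀ t : J, V (φ (t, m)), c s = b ∧ ∀ t, IsFlatAt y w c t then h.choose t else 0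

theorem IsTimeSection.transport_eq_of_mem (h : IsTimeSection y) {w : TangentSpace 𝓘(ℝ, E') m}
    {K : Set ℝ} (hKo : IsOpen K) (hK : K.OrdConnected) (hKJ : K ⊆ J)
    {c : ∀ t : J, V (φ (t, m))} (hc : ∀ t : J, (t : ℝ) ∈ K → IsFlatAt y w c t) {s t : J}
    (hs : (s : ℝ) ∈ K) (ht : (t : ℝ) ∈ K) : transport y s t m w (c s) = c t := by
  have h1 := h.exists_isFlatAt s w (c s) (hc s hs).1
  rw [transport, dif_pos h1]
  exact eq_of_isFlatAt h.contMDiff hKo hK hKJ (fun t _ ↦ h1.choose_spec.2 t) hc hs ht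
    h1.choose_spec.1

theorem IsTimeSection.transport_eq (h : IsTimeSection y) {w : TangentSpace 𝓘(ℝ, E') m}
    {c : ∀ t : J, V (φ (t, m))} (hc : ∀ t : J, IsFlatAt y w c t) (s t : J) :
    transport y s t m w (c s) = c t :=
  h.transport_eq_of_mem J.isOpen h.ordConnected subset_rfl (fun t _ ↦ hc t) s.2 t.2

theorem IsTimeSection.isFlatAt_transport (h : IsTimeSection y) {s : J}
    {w : TangentSpace 𝓘(ℝ, E') m} {b : V (φ (s, m))}
    (hb : mfderiv 𝓘(ℝ, E') 𝓘(ℝ, E) (fun z ↦ φ (s, z)) m w = B.anchor (φ (s, m)) b) (t : J) :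
    IsFlatAt y w (fun t ↦ transport y s t m w b) t := by
  obtain ⟨c, rfl, hc⟩ := h.exists_isFlatAt s w b hb
  simp only [h.transport_eq hc]
  exact hc t

theorem IsTimeSection.transport_self (h : IsTimeSection y) {s : J}
    {w : TangentSpace 𝓘(ℝ, E') m} {b : V (φ (s, m))}
    (hb : mfderiv 𝓘(ℝ, E') 𝓘(ℝ, E) (fun z ↦ φ (s, z)) m w = B.anchor (φ (s, m)) b) :
    transport y s s m w b = b := by
  obtain ⟨c, rfl, hc⟩ := h.exists_isFlatAt s w b hb
  exact h.transport_eq hc s s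

theorem IsTimeSection.transport_transport (h : IsTimeSection y) {s : J}
    {w : TangentSpace 𝓘(ℝ, E') m} {b : V (φ (s, m))}
    (hb : mfderiv 𝓘(ℝ, E') 𝓘(ℝ, E) (fun z ↦ φ (s, z)) m w = B.anchor (φ (s, m)) b) (t u : J) :
    transport y t u m w (transport y s t m w b) = transport y s u m w b :=
  h.transport_eq (h.isFlatAt_transport hb) t u

variable {EQ : Type*} [NormedAddCommGroup EQ] [NormedSpace ℝ EQ]
  {HQ : Type*} [TopologicalSpace HQ] {IQ : ModelWithCorners ℝ EQ HQ}
  {Q : Type*} [TopologicalSpace Q] [ChartedSpace HQ Q]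

/-- Parallel transport is smooth in all its arguments. -/
theorem IsTimeSection.contMDiffWithinAt_transport (h : IsTimeSection y) {S : Set Q} {q₀ : Q}
    (hq₀ : q₀ ∈ S) {μ : Q → M} {w : ∀ q, TangentSpace 𝓘(ℝ, E') (μ q)}
    (hw : ContMDiffWithinAt IQ 𝓘(ℝ, E').tangent ∞
      (fun q ↦ (⟨μ q, w q⟩ : TangentBundle 𝓘(ℝ, E') M)) S q₀)
    {τ τ' : Q → J} (hτ : ContMDiffWithinAt IQ 𝓘(ℝ, ℝ) ∞ τ S q₀)
    (hτ' : ContMDiffWithinAt IQ 𝓘(ℝ, ℝ) ∞ τ' S q₀) {b : ∀ q, V (φ (τ q, μ q))}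
    (hb : ContMDiffWithinAt IQ (𝓘(ℝ, E).prod 𝓘(ℝ, F)) ∞
      (fun q ↦ (⟨φ (τ q, μ q), b q⟩ : TotalSpace F V)) S q₀)
    (hadm : ∀ q ∈ S, mfderiv 𝓘(ℝ, E') 𝓘(ℝ, E) (fun z ↦ φ (τ q, z)) (μ q) (w q) =
      B.anchor (φ (τ q, μ q)) (b q)) :
    ContMDiffWithinAt IQ (𝓘(ℝ, E).prod 𝓘(ℝ, F)) ∞ (fun q ↦ (⟨φ (τ' q, μ q),
      transport y (τ q) (τ' q) (μ q) (w q) (b q)⟩ : TotalSpace F V)) S q₀ := by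
  have : PreconnectedSpace J := Subtype.preconnectedSpace h.ordConnected.isPreconnected
  have hμ : ContMDiffWithinAt IQ 𝓘(ℝ, E') ∞ μ S q₀ := (contMDiffWithinAt_totalSpace.1 hw).1
  let P : J → J → Prop := fun s t ↦ ∀ (τ τ' : Q → J), ContMDiffWithinAt IQ 𝓘(ℝ, ℝ) ∞ τ S q₀ →
    ContMDiffWithinAt IQ 𝓘(ℝ, ℝ) ∞ τ' S q₀ → ∀ b : ∀ q, V (φ (τ q, μ q)),
    ContMDiffWithinAt IQ (𝓘(ℝ, E).prod 𝓘(ℝ, F)) ∞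
      (fun q ↦ (⟨φ (τ q, μ q), b q⟩ : TotalSpace F V)) S q₀ →
    (∀ q ∈ S, mfderiv 𝓘(ℝ, E') 𝓘(ℝ, E) (fun z ↦ φ (τ q, z)) (μ q) (w q) =
      B.anchor (φ (τ q, μ q)) (b q)) → τ q₀ = s → τ' q₀ = t →
    ContMDiffWithinAt IQ (𝓘(ℝ, E).prod 𝓘(ℝ, F)) ∞ (fun q ↦ (⟨φ (τ' q, μ q),
      transport y (τ q) (τ' q) (μ q) (w q) (b q)⟩ : TotalSpace F V)) S q₀
  suffices hP : ∀ s t, P s t from hP _ _ τ τ' hτ hτ' b hb hadm rfl rfl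
  refine PreconnectedSpace.induction₂' P (fun t₀ ↦ ?_) ⟨fun s t u hst htu ↦ ?_⟩
  · obtain ⟨K, O, T, hKo, hK, hKJ, hxK, hO, hxO, hOs, hT⟩ := h.exists_propagator (t₀, μ q₀)
    suffices hloc : ∀ s t : J, (s : ℝ) ∈ K → (t : ℝ) ∈ K → P s t by
      filter_upwards [eventually_mem_opens hKo hxK] with r hr
      exact ⟨hloc _ _ hxK hr, hloc _ _ hr hxK⟩
    rintro s t hs ht τ τ' hτ hτ' b hb hadm rfl rfl
    set n₀ := φ (t₀, μ q₀)
    have hbs := frameNhd_subset_baseSet (E := E) (F := F) (V := V) n₀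
    have h1 : ContMDiffWithinAt IQ 𝓘(ℝ, E) ∞ (fun q ↦ φ (τ' q, μ q)) S q₀ :=
      ContMDiffAt.comp_contMDiffWithinAt (g := φ) q₀ h.contMDiff.contMDiffAt (hτ'.prodMk hμ)
    refine (contMDiffWithinAt_iff_coord (f := fun q ↦ φ (τ' q, μ q))
      (hbs (hT _ ht _ hxO).1)).2 ⟨h1, ?_⟩
    have hb' := ((contMDiffWithinAt_iff_coord (f := fun q ↦ φ (τ q, μ q))
      (hbs (hT _ hs _ hxO).1)).1 hb).2
    have hw1 := (contMDiffWithinAt_totalSpace.1 hw).2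
    have hT1 : ContMDiffWithinAt IQ 𝓘(ℝ, (E' × F) →L[ℝ] F) ∞ (fun q ↦ T (τ q, τ' q, μ q)) S q₀ :=
      ContMDiffAt.comp_contMDiffWithinAt (g := T) q₀ ((hT _ hs _ hxO).2.1 _ ht)
        (hτ.prodMk (hτ'.prodMk hμ))
    have hKS : ∀ τ : Q → J, ContMDiffWithinAt IQ 𝓘(ℝ, ℝ) ∞ τ S q₀ → (τ q₀ : ℝ) ∈ K →
        ∀ᶠ q in 𝓝[S] q₀, (τ q : ℝ) ∈ K := fun τ hτ h0 ↦
      hτ.continuousWithinAt.eventually (eventually_mem_opens hKo h0)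
    have hOS : ∀ᶠ q in 𝓝[S] q₀, μ q ∈ O := hμ.continuousWithinAt.eventually_mem (hO.mem_nhds hxO)
    have hev : ∀ q ∈ S, (τ q : ℝ) ∈ K → (τ' q : ℝ) ∈ K → μ q ∈ O →
        coord F V n₀ (φ (τ' q, μ q)) (transport y (τ q) (τ' q) (μ q) (w q) (b q)) =
          T (τ q, τ' q, μ q) ((trivializationAt E' (TangentSpace 𝓘(ℝ, E')) (μ q₀) ⟨μ q, w q⟩).2,
            coord F V n₀ (φ (τ q, μ q)) (b q)) := by
      intro q hqS hq hq' hqO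
      obtain ⟨hc1, hc2⟩ := (hT _ hq _ hqO).2.2 (w q) (b q) (hadm q hqS)
      have h2 : transport y (τ q) (τ' q) (μ q) (w q) (b q) = frameVec F V n₀ (φ (τ' q, μ q)) _ :=
        (congrArg (transport y (τ q) (τ' q) (μ q) (w q)) hc1).symm.trans
          (h.transport_eq_of_mem hKo hK hKJ hc2 hq hq')
      rw [h2, coord_frameVec (hbs (hT _ hq' _ hqO).1)]
      congr 2
      exact (trivializationAt_tangent_eq_mvfderiv (hOs hqO) _).symm
    refine (hT1.clm_apply (hw1.prodMk_space hb')).congr_of_eventuallyEq ?_ (hev q₀ hq₀ hs ht hxO)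
    filter_upwards [hKS τ hτ hs, hKS τ' hτ' ht, hOS, self_mem_nhdsWithin] with q hq hq' hqO hqS
      using hev q hqS hq hq' hqO
  · rintro τ τ' hτ hτ' b hb hadm hs hu
    have h1 := hst τ (fun _ ↦ t) hτ contMDiffWithinAt_const b hb hadm hs rfl
    have h2 := htu (fun _ ↦ t) τ' contMDiffWithinAt_const hτ' _ h1
      (fun q hq ↦ (h.isFlatAt_transport (hadm q hq) t).1) rfl hu
    refine h2.congr (fun q hq ↦ ?_) ?_
    · rw [h.transport_transport (hadm q hq)]
    · rw [h.transport_transport (hadm q₀ hq₀)]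

end Transport

end LieAlgebroid

/-! ### Flat sections and the isomorphisms given by parallel transport -/

namespace LieAlgebroid

section Flat

variable {E : Type*} [NormedAddCommGroup E] [NormedSpace ℝ E] [FiniteDimensional ℝ E]
  {N : Type*} [TopologicalSpace N] [T2Space N] [ChartedSpace E N] [IsManifold 𝓘(ℝ, E) ∞ N]
  {F : Type*} [NormedAddCommGroup F] [NormedSpace ℝ F] [FiniteDimensional ℝ F]
  {V : N → Type*} [TopologicalSpace (TotalSpace F V)]
  [∀ x, AddCommGroup (V x)] [∀ x, Module ℝ (V x)] [∀ x, TopologicalSpace (V x)]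
  [FiberBundle F V] [VectorBundle ℝ F V] [ContMDiffVectorBundle ∞ F V 𝓘(ℝ, E)]
  {B : LieAlgebroid 𝓘(ℝ, E) F V}
  {E' : Type*} [NormedAddCommGroup E'] [NormedSpace ℝ E'] [FiniteDimensional ℝ E']
  {M : Type*} [TopologicalSpace M] [ChartedSpace E' M] [IsManifold 𝓘(ℝ, E') ∞ M]
  {J : Opens ℝ} {φ : J × M → N} {m : M}
  {y : B.PullbackSection (𝓘(ℝ, ℝ).prod 𝓘(ℝ, E')) φ}

theorem IsTimeSection.contMDiff_slice (h : IsTimeSection y) (t : J) :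
    ContMDiff 𝓘(ℝ, E') 𝓘(ℝ, E) ∞ (fun m ↦ φ (t, m)) :=
  h.contMDiff.comp (contMDiff_const.prodMk contMDiff_id)

/-- Parallel transport from time `s` to time `t`, as a linear isomorphism between the fibres of the
pullbacks of `B` along `φ (s, ·)` and `φ (t, ·)`. -/
def IsTimeSection.transportEquiv (h : IsTimeSection y) (s t : J) (m : M) :
    B.pullbackFiber 𝓘(ℝ, E') (fun m ↦ φ (s, m)) m ≃ₗ[ℝ]
      B.pullbackFiber 𝓘(ℝ, E') (fun m ↦ φ (t, m)) m where
  toFun e := ⟨(e.1.1, transport y s t m e.1.1 e.1.2), (h.isFlatAt_transport e.2 t).1⟩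
  invFun e := ⟨(e.1.1, transport y t s m e.1.1 e.1.2), (h.isFlatAt_transport e.2 s).1⟩
  map_add' e e' := by
    refine Subtype.ext (Prod.ext rfl ?_)
    have h1 := h.transport_eq (fun r ↦ (h.isFlatAt_transport e.2 r).add
      (h.isFlatAt_transport e'.2 r)) s t
    rw [h.transport_self e.2, h.transport_self e'.2] at h1
    exact h1
  map_smul' a e := by
    refine Subtype.ext (Prod.ext rfl ?_)
    have h1 := h.transport_eq (fun r ↦ (h.isFlatAt_transport e.2 r).smul a) s t
    rw [h.transport_self e.2] at h1
    exact h1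
  left_inv e := by
    refine Subtype.ext (Prod.ext rfl ?_)
    exact (h.transport_transport e.2 t s).trans (h.transport_self e.2)
  right_inv e := by
    refine Subtype.ext (Prod.ext rfl ?_)
    exact (h.transport_transport e.2 s t).trans (h.transport_self e.2)

open Classical in
theorem IsTimeSection.isSmoothFamily_transportEquiv (h : IsTimeSection y) (s t : J) :
    IsSmoothFamily (B := B) (IP := 𝓘(ℝ, E')) (f := fun m ↦ φ (s, m)) (g := fun m ↦ φ (t, m))
      (fun m ↦ h.transportEquiv s t m) := by
  let b : ∀ q : TangentBundle 𝓘(ℝ, E') M × TotalSpace F V, V (φ (s, q.1.proj)) := fun q ↦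
    if hq : q.2.proj = φ (s, q.1.proj) then hq ▸ q.2.2 else 0
  have hb : ∀ (z : M) (w : TangentSpace 𝓘(ℝ, E') z) (v : V (φ (s, z))),
      b (⟨z, w⟩, ⟨φ (s, z), v⟩) = v := fun z w v ↦ dif_pos rfl
  have hS : ∀ q ∈ B.pullbackTotal 𝓘(ℝ, E') (fun m ↦ φ (s, m)),
      (⟨φ (s, q.1.proj), b q⟩ : TotalSpace F V) = q.2 ∧
      mfderiv 𝓘(ℝ, E') 𝓘(ℝ, E) (fun z ↦ φ (s, z)) q.1.proj q.1.2 =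
        B.anchor (φ (s, q.1.proj)) (b q) := by
    rintro ⟨⟨z, w⟩, ⟨n, v⟩⟩ hq
    obtain rfl : φ (s, z) = n := congrArg TotalSpace.proj hq
    rw [hb]
    exact ⟨rfl, TotalSpace.mk_inj.1 hq⟩
  refine ⟨fun q ↦ (q.1, ⟨φ (t, q.1.proj), transport y s t q.1.proj q.1.2 (b q)⟩), fun q hq ↦ ?_,
    fun z e ↦ ?_⟩
  · refine contMDiffWithinAt_fst.prodMk ?_
    refine h.contMDiffWithinAt_transport (τ := fun _ ↦ s) (τ' := fun _ ↦ t) (w := fun q ↦ q.1.2) hq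
      contMDiffWithinAt_fst contMDiffWithinAt_const contMDiffWithinAt_const ?_ (fun q hq ↦ (hS q hq).2)
    exact contMDiffWithinAt_snd.congr (fun q hq ↦ (hS q hq).1) (hS q hq).1
  · exact Prod.ext rfl (congrArg (TotalSpace.mk (φ (t, z)))
      (congrArg (transport y s t z e.1.1) (hb z e.1.1 e.1.2)))

/-- The section `σ` of `φ^{!!}B` is flat, i.e. `[y, σ] = 0`, and projects to the vector field `X` of
`M`. -/
structure IsFlatSection (y : B.PullbackSection (𝓘(ℝ, ℝ).prod 𝓘(ℝ, E')) φ)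
    (X : ∀ m : M, TangentSpace 𝓘(ℝ, E') m)
    (σ : B.PullbackSection (𝓘(ℝ, ℝ).prod 𝓘(ℝ, E')) φ) : Prop where
  fst_eq : σ.fst = spaceField J X
  mvfderiv_eq : ∀ n₀ p, φ p ∈ frameNhd E F V n₀ →
    mvfderiv (𝓘(ℝ, ℝ).prod 𝓘(ℝ, E')) (σ.sndCoord n₀) p (timeField J M p) =
      mvfderiv (𝓘(ℝ, ℝ).prod 𝓘(ℝ, E')) (y.sndCoord n₀) p (spaceField J X p) -
        B.structureMap n₀ (φ p) (y.sndCoord n₀ p) (σ.sndCoord n₀ p)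

theorem IsFlatSection.isFlatAt (h : IsTimeSection y) {X : ∀ m : M, TangentSpace 𝓘(ℝ, E') m}
    {σ : B.PullbackSection (𝓘(ℝ, ℝ).prod 𝓘(ℝ, E')) φ} (hσ : IsFlatSection y X σ) (m : M) (t : J) :
    IsFlatAt y (X m) (fun t ↦ σ.snd (t, m)) t := by
  have h1 := σ.mfderiv_fst (t, m)
  rw [hσ.fst_eq] at h1
  refine ⟨(mfderiv_slice_right (h.contMDiff.mdifferentiableAt (by simp)) _).trans h1,
    fun n₀ hn₀ ↦ ?_⟩
  have h2 : MDifferentiableAt (𝓘(ℝ, ℝ).prod 𝓘(ℝ, E')) 𝓘(ℝ, F) (σ.sndCoord n₀) (t, m) :=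
    (σ.contMDiffAt_sndCoord hn₀).mdifferentiableAt (by simp)
  exact ⟨MDifferentiableAt.comp (g := σ.sndCoord n₀) (f := fun r : J ↦ (r, m)) t h2
    (mdifferentiableAt_slice_left t m),
    (mvfderiv_slice_left h2).trans (hσ.mvfderiv_eq n₀ (t, m) hn₀)⟩

theorem IsFlatSection.transport_snd (h : IsTimeSection y) {X : ∀ m : M, TangentSpace 𝓘(ℝ, E') m}
    {σ : B.PullbackSection (𝓘(ℝ, ℝ).prod 𝓘(ℝ, E')) φ} (hσ : IsFlatSection y X σ) (m : M) (s t : J) :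
    transport y s t m (X m) (σ.snd (s, m)) = σ.snd (t, m) :=
  h.transport_eq (hσ.isFlatAt h m) s t

/-- The section of `φ^{!!}B` that is obtained from a section at time `s` by parallel transport. -/
def IsTimeSection.flatExtension (h : IsTimeSection y) {s : J}
    (σ : B.PullbackSection 𝓘(ℝ, E') (fun m ↦ φ (s, m))) :
    B.PullbackSection (𝓘(ℝ, ℝ).prod 𝓘(ℝ, E')) φ where
  toFun p := ⟨(spaceField J σ.fst p, transport y s p.1 p.2 (σ.fst p.2) (σ.snd p.2)),
    (mfderiv_slice_right (h.contMDiff.mdifferentiableAt (by simp)) _).symm.trans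
      (h.isFlatAt_transport (σ.mfderiv_fst p.2) p.1).1⟩
  contMDiff_toFun x := by
    refine ContMDiffAt.prodMk (contMDiffAt_spaceField (σ.contMDiff_fst x.2)) ?_
    refine h.contMDiffWithinAt_transport (S := Set.univ) (τ := fun _ ↦ s)
      (τ' := fun p : J × M ↦ p.1) (μ := fun p : J × M ↦ p.2) (w := fun p ↦ σ.fst p.2)
      (b := fun p ↦ σ.snd p.2) (Set.mem_univ x) ?_ contMDiffWithinAt_const contMDiffWithinAt_fst ?_
      (fun p _ ↦ σ.mfderiv_fst p.2)
    · exact (σ.contMDiff_fst.comp contMDiff_snd).contMDiffAt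
    · exact (σ.contMDiff_snd.comp contMDiff_snd).contMDiffAt

theorem IsTimeSection.isFlatSection_flatExtension (h : IsTimeSection y) {s : J}
    (σ : B.PullbackSection 𝓘(ℝ, E') (fun m ↦ φ (s, m))) :
    IsFlatSection y σ.fst (h.flatExtension σ) := by
  refine ⟨rfl, fun n₀ p hp ↦ ?_⟩
  have h1 := ((h.isFlatAt_transport (σ.mfderiv_fst p.2) p.1).2 n₀ hp).2
  exact (mvfderiv_slice_left (((h.flatExtension σ).contMDiffAt_sndCoord hp).mdifferentiableAt
    (by simp))).symm.trans h1

theorem PullbackSection.mvfderiv_structureMap_fst (σ τ υ : B.PullbackSection (𝓘(ℝ, ℝ).prod 𝓘(ℝ, E')) φ)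
    (hφ : ContMDiff (𝓘(ℝ, ℝ).prod 𝓘(ℝ, E')) 𝓘(ℝ, E) ∞ φ) {n₀ : N} {p : J × M}
    (hp : φ p ∈ frameNhd E F V n₀) :
    mvfderiv (𝓘(ℝ, ℝ).prod 𝓘(ℝ, E'))
      (fun z ↦ B.structureMap n₀ (φ z) (σ.sndCoord n₀ z) (τ.sndCoord n₀ z)) p (υ.fst p) =
      B.structureDeriv n₀ (φ p) (υ.sndCoord n₀ p) (σ.sndCoord n₀ p) (τ.sndCoord n₀ p) +
      B.structureMap n₀ (φ p) (mvfderiv (𝓘(ℝ, ℝ).prod 𝓘(ℝ, E')) (σ.sndCoord n₀) p (υ.fst p))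
        (τ.sndCoord n₀ p) +
      B.structureMap n₀ (φ p) (σ.sndCoord n₀ p)
        (mvfderiv (𝓘(ℝ, ℝ).prod 𝓘(ℝ, E')) (τ.sndCoord n₀) p (υ.fst p)) := by
  have hA := (B.contMDiffAt_structureMap hp).mdifferentiableAt (n := ∞) (by simp)
  have hυ : frameVec F V n₀ (φ p) (υ.sndCoord n₀ p) = υ.snd p :=
    frameVec_coord (frameNhd_subset_baseSet (E := E) n₀ hp) _
  have hφ' : MDifferentiableAt (𝓘(ℝ, ℝ).prod 𝓘(ℝ, E')) 𝓘(ℝ, E) φ p :=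
    hφ.mdifferentiableAt (by simp)
  rw [mvfderiv_clm_apply_apply (A := fun z ↦ B.structureMap n₀ (φ z)) (hA.comp p hφ')
    ((σ.contMDiffAt_sndCoord hp).mdifferentiableAt (by simp))
    ((τ.contMDiffAt_sndCoord hp).mdifferentiableAt (by simp)), mvfderiv_comp_vec hA hφ',
    υ.mfderiv_fst, structureDeriv, hυ]

/-- The bracket of two flat sections is flat, by the Jacobi identity. -/
theorem IsFlatSection.bracket (h : IsTimeSection y) {X Z : ∀ m : M, TangentSpace 𝓘(ℝ, E') m}
    {σ τ : B.PullbackSection (𝓘(ℝ, ℝ).prod 𝓘(ℝ, E')) φ}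
    (hX : ContMDiff 𝓘(ℝ, E') 𝓘(ℝ, E').tangent ∞ (fun m ↦ (⟨m, X m⟩ : TangentBundle 𝓘(ℝ, E') M)))
    (hZ : ContMDiff 𝓘(ℝ, E') 𝓘(ℝ, E').tangent ∞ (fun m ↦ (⟨m, Z m⟩ : TangentBundle 𝓘(ℝ, E') M)))
    (hσ : IsFlatSection y X σ) (hτ : IsFlatSection y Z τ) [CompleteSpace E'] :
    IsFlatSection y (VectorField.mlieBracket 𝓘(ℝ, E') X Z) (σ.bracket τ h.contMDiff) := by
  have hfst : (σ.bracket τ h.contMDiff).fst =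
      spaceField J (VectorField.mlieBracket 𝓘(ℝ, E') X Z) := by
    funext p
    refine Eq.trans ?_ (mlieBracket_spaceField (hX p.2) (hZ p.2))
    rw [← hσ.fst_eq, ← hτ.fst_eq]
    rfl
  refine ⟨hfst, fun n₀ p hp ↦ ?_⟩
  have hbr : ∀ {z}, φ z ∈ frameNhd E F V n₀ →
      (σ.bracket τ h.contMDiff).sndCoord n₀ z = σ.bracketCoord τ n₀ z := fun hz ↦
    (σ.isPullbackBracket_bracket τ h.contMDiff).sndCoord_eq
      (h.contMDiff.mdifferentiable (by simp)) hz
  have hW : ∀ᶠ z in 𝓝 p, φ z ∈ frameNhd E F V n₀ :=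
    h.contMDiff.continuous.continuousAt.eventually_mem ((isOpen_frameNhd n₀).mem_nhds hp)
  have hbr' : (σ.bracket τ h.contMDiff).sndCoord n₀ =ᶠ[𝓝 p] σ.bracketCoord τ n₀ :=
    hW.mono fun z hz ↦ hbr hz
  have hS := fun σ : B.PullbackSection (𝓘(ℝ, ℝ).prod 𝓘(ℝ, E')) φ ↦ σ.contMDiffAt_sndCoord hp
  have hD : ∀ {g : J × M → F}, ContMDiffAt (𝓘(ℝ, ℝ).prod 𝓘(ℝ, E')) 𝓘(ℝ, F) ∞ g p →
      MDifferentiableAt (𝓘(ℝ, ℝ).prod 𝓘(ℝ, E')) 𝓘(ℝ, F) g p := fun hg ↦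
    hg.mdifferentiableAt (by simp)
  have hstr : ∀ σ τ : B.PullbackSection (𝓘(ℝ, ℝ).prod 𝓘(ℝ, E')) φ,
      ContMDiffAt (𝓘(ℝ, ℝ).prod 𝓘(ℝ, E')) 𝓘(ℝ, F) ∞
        (fun z ↦ B.structureMap n₀ (φ z) (σ.sndCoord n₀ z) (τ.sndCoord n₀ z)) p := fun σ τ ↦
    (((B.contMDiffAt_structureMap hp).comp p h.contMDiff.contMDiffAt).clm_apply (hS σ)).clm_apply
      (hS τ)
  have hder : ∀ σ τ : B.PullbackSection (𝓘(ℝ, ℝ).prod 𝓘(ℝ, E')) φ,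
      ContMDiffAt (𝓘(ℝ, ℝ).prod 𝓘(ℝ, E')) 𝓘(ℝ, F) ∞
        (fun z ↦ mvfderiv (𝓘(ℝ, ℝ).prod 𝓘(ℝ, E')) (τ.sndCoord n₀) z (σ.fst z)) p := fun σ τ ↦
    (hS τ).mvfderiv_apply (σ.contMDiff_fst p)
  -- The derivative along `X` of the time derivative of the components of `τ`.
  have key : ∀ {X Z : ∀ m : M, TangentSpace 𝓘(ℝ, E') m}
      {σ τ : B.PullbackSection (𝓘(ℝ, ℝ).prod 𝓘(ℝ, E')) φ},
      ContMDiff 𝓘(ℝ, E') 𝓘(ℝ, E').tangent ∞ (fun m ↦ (⟨m, X m⟩ : TangentBundle 𝓘(ℝ, E') M)) →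
      IsFlatSection y X σ → IsFlatSection y Z τ →
      mvfderiv (𝓘(ℝ, ℝ).prod 𝓘(ℝ, E')) (fun z ↦ mvfderiv (𝓘(ℝ, ℝ).prod 𝓘(ℝ, E')) (τ.sndCoord n₀) z
        (σ.fst z)) p (y.fst p) =
      mvfderiv (𝓘(ℝ, ℝ).prod 𝓘(ℝ, E')) (fun z ↦ mvfderiv (𝓘(ℝ, ℝ).prod 𝓘(ℝ, E')) (y.sndCoord n₀) z
        (τ.fst z)) p (σ.fst p) -
      mvfderiv (𝓘(ℝ, ℝ).prod 𝓘(ℝ, E')) (fun z ↦ B.structureMap n₀ (φ z) (y.sndCoord n₀ z)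
        (τ.sndCoord n₀ z)) p (σ.fst p) := by
    intro X Z σ τ hX hσ hτ
    have h1 : (fun z ↦ mvfderiv (𝓘(ℝ, ℝ).prod 𝓘(ℝ, E')) (τ.sndCoord n₀) z (timeField J M z)) =ᶠ[𝓝 p]
        fun z ↦ mvfderiv (𝓘(ℝ, ℝ).prod 𝓘(ℝ, E')) (y.sndCoord n₀) z (τ.fst z) -
          B.structureMap n₀ (φ z) (y.sndCoord n₀ z) (τ.sndCoord n₀ z) := by
      filter_upwards [hW] with z hz
      rw [hτ.mvfderiv_eq n₀ z hz, hτ.fst_eq]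
    rw [h.fst_eq]
    simp only [hσ.fst_eq]
    rw [mvfderiv_timeField_comm (hS τ) (hX p.2), h1.mvfderiv_eq,
      mvfderiv_fun_sub (hD (hder τ y)) (hD (hstr y τ))]
    rfl
  have hσeq := hσ.mvfderiv_eq n₀ p hp
  have hτeq := hτ.mvfderiv_eq n₀ p hp
  rw [← h.fst_eq, ← hσ.fst_eq] at hσeq
  rw [← h.fst_eq, ← hτ.fst_eq] at hτeq
  have e1 : mvfderiv (𝓘(ℝ, ℝ).prod 𝓘(ℝ, E')) (σ.bracketCoord τ n₀) p (y.fst p) =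
      mvfderiv (𝓘(ℝ, ℝ).prod 𝓘(ℝ, E')) (fun z ↦ B.structureMap n₀ (φ z) (σ.sndCoord n₀ z)
        (τ.sndCoord n₀ z)) p (y.fst p) +
      mvfderiv (𝓘(ℝ, ℝ).prod 𝓘(ℝ, E')) (fun z ↦ mvfderiv (𝓘(ℝ, ℝ).prod 𝓘(ℝ, E')) (τ.sndCoord n₀) z
        (σ.fst z)) p (y.fst p) -
      mvfderiv (𝓘(ℝ, ℝ).prod 𝓘(ℝ, E')) (fun z ↦ mvfderiv (𝓘(ℝ, ℝ).prod 𝓘(ℝ, E')) (σ.sndCoord n₀) z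
        (τ.fst z)) p (y.fst p) := by
    refine (congrFun (congrArg DFunLike.coe (mvfderiv_fun_sub
      (hD ((hstr σ τ).add (hder σ τ))) (hD (hder τ σ)))) (y.fst p)).trans ?_
    exact congrArg (· - mvfderiv (𝓘(ℝ, ℝ).prod 𝓘(ℝ, E')) (fun z ↦ mvfderiv (𝓘(ℝ, ℝ).prod 𝓘(ℝ, E'))
      (σ.sndCoord n₀) z (τ.fst z)) p (y.fst p)) (congrFun (congrArg DFunLike.coe (mvfderiv_fun_add
        (hD (hstr σ τ)) (hD (hder σ τ)))) (y.fst p))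
  have e2 : mvfderiv (𝓘(ℝ, ℝ).prod 𝓘(ℝ, E')) (y.sndCoord n₀) p
      (spaceField J (VectorField.mlieBracket 𝓘(ℝ, E') X Z) p) =
      mvfderiv (𝓘(ℝ, ℝ).prod 𝓘(ℝ, E')) (fun z ↦ mvfderiv (𝓘(ℝ, ℝ).prod 𝓘(ℝ, E')) (y.sndCoord n₀) z
        (τ.fst z)) p (σ.fst p) -
      mvfderiv (𝓘(ℝ, ℝ).prod 𝓘(ℝ, E')) (fun z ↦ mvfderiv (𝓘(ℝ, ℝ).prod 𝓘(ℝ, E')) (y.sndCoord n₀) z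
        (σ.fst z)) p (τ.fst p) := by
    rw [← hfst]
    exact mvfderiv_mlieBracket (hS y) (σ.contMDiff_fst p) (τ.contMDiff_fst p)
  rw [hbr'.mvfderiv_eq, hbr hp, e2, ← h.fst_eq, e1, key hX hσ hτ, key hZ hτ hσ,
    σ.mvfderiv_structureMap_fst τ y h.contMDiff hp, y.mvfderiv_structureMap_fst τ σ h.contMDiff hp,
    y.mvfderiv_structureMap_fst σ τ h.contMDiff hp, hσeq, hτeq, PullbackSection.bracketCoord]
  have hJ := B.structureMap_jacobi hp (y.sndCoord n₀ p) (σ.sndCoord n₀ p) (τ.sndCoord n₀ p)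
  rw [← eq_sub_iff_add_eq'] at hJ
  simp only [map_add, map_sub, sub_apply]
  rw [hJ, B.structureMap_swap n₀ (φ p) (σ.sndCoord n₀ p)
    (mvfderiv (𝓘(ℝ, ℝ).prod 𝓘(ℝ, E')) (y.sndCoord n₀) p (τ.fst p))]
  abel

/-- The components of the bracket at time `t` are computed from extensions to all times. -/
theorem PullbackSection.bracketCoord_slice {t : J}
    {σ τ : B.PullbackSection 𝓘(ℝ, E') (fun m ↦ φ (t, m))}
    {σ' τ' : B.PullbackSection (𝓘(ℝ, ℝ).prod 𝓘(ℝ, E')) φ}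
    (hσ : ∀ m, σ'.fst (t, m) = spaceField J σ.fst (t, m)) (hσ' : ∀ m, σ'.snd (t, m) = σ.snd m)
    (hτ : ∀ m, τ'.fst (t, m) = spaceField J τ.fst (t, m)) (hτ' : ∀ m, τ'.snd (t, m) = τ.snd m)
    {n₀ : N} (hm : φ (t, m) ∈ frameNhd E F V n₀) :
    σ.bracketCoord τ n₀ m = σ'.bracketCoord τ' n₀ (t, m) := by
  have h1 : σ.sndCoord n₀ = fun z ↦ σ'.sndCoord n₀ (t, z) := funext fun z ↦ by
    rw [PullbackSection.sndCoord, PullbackSection.sndCoord, hσ']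
  have h2 : τ.sndCoord n₀ = fun z ↦ τ'.sndCoord n₀ (t, z) := funext fun z ↦ by
    rw [PullbackSection.sndCoord, PullbackSection.sndCoord, hτ']
  rw [PullbackSection.bracketCoord, PullbackSection.bracketCoord, hσ, hτ, h1, h2,
    mvfderiv_slice_right ((σ'.contMDiffAt_sndCoord hm).mdifferentiableAt (by simp)),
    mvfderiv_slice_right ((τ'.contMDiffAt_sndCoord hm).mdifferentiableAt (by simp))]
  rfl

/-- Parallel transport is an isomorphism of Lie algebroids. -/
def IsTimeSection.transportIso (h : IsTimeSection y) (s t : J) :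
    B.PullbackIso 𝓘(ℝ, E') (fun m ↦ φ (s, m)) (fun m ↦ φ (t, m)) where
  toEquiv m := h.transportEquiv s t m
  smooth := h.isSmoothFamily_transportEquiv s t
  smooth_symm := h.isSmoothFamily_transportEquiv t s
  anchor_eq _ _ := rfl
  map_bracket σ τ := by
    have : CompleteSpace E' := FiniteDimensional.complete ℝ E'
    refine ⟨σ.bracket τ (h.contMDiff_slice s), σ.isPullbackBracket_bracket τ _, ?_⟩
    have hfl := (h.isFlatSection_flatExtension σ).bracket h σ.contMDiff_fst τ.contMDiff_fst
      (h.isFlatSection_flatExtension τ)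
    -- `υ` is flat and restricts at all times to the bracket of the transported sections; hence it is
    -- the transport of its value at time `s`, which is `[σ, τ]`.
    set υ := (h.flatExtension σ).bracket (h.flatExtension τ) h.contMDiff
    have hυ : ∀ {n₀ p}, φ p ∈ frameNhd E F V n₀ → υ.sndCoord n₀ p =
        (h.flatExtension σ).bracketCoord (h.flatExtension τ) n₀ p := fun hp ↦
      ((h.flatExtension σ).isPullbackBracket_bracket (h.flatExtension τ) h.contMDiff).sndCoord_eq
        (h.contMDiff.mdifferentiable (by simp)) hp
    have hs : ∀ m, υ.snd (s, m) = (σ.bracket τ (h.contMDiff_slice s)).snd m := fun m ↦ by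
      have hm := mem_frameNhd_self (E := E) (F := F) (V := V) (φ (s, m))
      apply coord_injective (frameNhd_subset_baseSet (E := E) (φ (s, m)) hm)
      refine (hυ hm).trans (Eq.trans ?_ ((σ.isPullbackBracket_bracket τ (h.contMDiff_slice s)).sndCoord_eq
        ((h.contMDiff_slice s).mdifferentiable (by simp)) hm).symm)
      exact (PullbackSection.bracketCoord_slice (σ := σ) (τ := τ) (σ' := h.flatExtension σ)
        (τ' := h.flatExtension τ) (fun _ ↦ rfl) (fun m ↦ h.transport_self (σ.mfderiv_fst m)) (fun _ ↦ rfl)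
        (fun m ↦ h.transport_self (τ.mfderiv_fst m)) hm).symm
    refine PullbackSection.isPullbackBracket_of_coord
      ((h.contMDiff_slice t).mdifferentiable (by simp)) (fun m ↦ rfl)
      fun m ↦ ⟨φ (t, m), mem_frameNhd_self _, ?_⟩
    have hm := mem_frameNhd_self (E := E) (F := F) (V := V) (φ (t, m))
    have h1 := hfl.transport_snd h m s t
    rw [hs m] at h1
    refine (congrArg (coord F V (φ (t, m)) (φ (t, m))) h1).trans ((hυ hm).trans ?_)
    exact (PullbackSection.bracketCoord_slice (fun _ ↦ rfl) (fun _ ↦ rfl) (fun _ ↦ rfl)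
      (fun _ ↦ rfl) hm).symm

end Flat

end LieAlgebroid

/-! ### Derivatives of maps into `TP × B` -/

section TotalDerivative

variable {E : Type*} [NormedAddCommGroup E] [NormedSpace ℝ E] [FiniteDimensional ℝ E]
  {N : Type*} [TopologicalSpace N] [T2Space N] [ChartedSpace E N] [IsManifold 𝓘(ℝ, E) ∞ N]
  {F : Type*} [NormedAddCommGroup F] [NormedSpace ℝ F] [FiniteDimensional ℝ F]
  {V : N → Type*} [TopologicalSpace (TotalSpace F V)]
  [∀ x, AddCommGroup (V x)] [∀ x, Module ℝ (V x)] [∀ x, TopologicalSpace (V x)]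
  [FiberBundle F V] [VectorBundle ℝ F V] [ContMDiffVectorBundle ∞ F V 𝓘(ℝ, E)]
  {EP : Type*} [NormedAddCommGroup EP] [NormedSpace ℝ EP]
  {HP : Type*} [TopologicalSpace HP] {IP : ModelWithCorners ℝ EP HP} [IP.Boundaryless]
  {P : Type*} [TopologicalSpace P] [ChartedSpace HP P] [IsManifold IP ∞ P]
  {EQ : Type*} [NormedAddCommGroup EQ] [NormedSpace ℝ EQ]
  {HQ : Type*} [TopologicalSpace HQ] {IQ : ModelWithCorners ℝ EQ HQ}
  {Q : Type*} [TopologicalSpace Q] [ChartedSpace HQ Q]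

/-- The components of the derivative of a map into `TP × B`, in the model space of this manifold. -/
theorem mfderiv_tangentBundle_prod_totalSpace {p : Q → P} {v : ∀ z, TangentSpace IP (p z)}
    {n : Q → N} {b : ∀ z, V (n z)} {z₀ : Q}
    (hc : MDifferentiableAt IQ (IP.tangent.prod (𝓘(ℝ, E).prod 𝓘(ℝ, F)))
      (fun z ↦ ((⟨p z, v z⟩ : TangentBundle IP P), (⟨n z, b z⟩ : TotalSpace F V))) z₀)
    (u : TangentSpace IQ z₀) :
    (mfderiv IQ (IP.tangent.prod (𝓘(ℝ, E).prod 𝓘(ℝ, F)))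
      (fun z ↦ ((⟨p z, v z⟩ : TangentBundle IP P), (⟨n z, b z⟩ : TotalSpace F V))) z₀ u :
        (EP × EP) × (E × F)) =
    ((mvfderiv IQ (fun z ↦ extChartAt IP (p z₀) (p z)) z₀ u,
      mvfderiv IQ (fun z ↦ mvfderiv IP (extChartAt IP (p z₀)) (p z) (v z)) z₀ u),
     (mvfderiv IQ (fun z ↦ extChartAt 𝓘(ℝ, E) (n z₀) (n z)) z₀ u,
      mvfderiv IQ (fun z ↦ LieAlgebroid.coord F V (n z₀) (n z) (b z)) z₀ u)) := by
  have hP : IsManifold IP 1 P := .of_le (n := ∞) (by simp)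
  have hN : IsManifold 𝓘(ℝ, E) 1 N := .of_le (n := ∞) (by simp)
  set c : Q → TangentBundle IP P × TotalSpace F V := fun z ↦ (⟨p z, v z⟩, ⟨n z, b z⟩) with hcdef
  have hbdl : (IP.tangent.prod (𝓘(ℝ, E).prod 𝓘(ℝ, F))).Boundaryless := inferInstance
  have h0 : IsManifold (IP.tangent.prod (𝓘(ℝ, E).prod 𝓘(ℝ, F))) ∞
      (TangentBundle IP P × TotalSpace F V) := inferInstance
  have h1 : IsManifold (IP.tangent.prod (𝓘(ℝ, E).prod 𝓘(ℝ, F))) 1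
      (TangentBundle IP P × TotalSpace F V) := .of_le (n := ∞) (by simp)
  set K := extChartAt (IP.tangent.prod (𝓘(ℝ, E).prod 𝓘(ℝ, F))) (c z₀) with hK
  have hKd : MDifferentiableAt (IP.tangent.prod (𝓘(ℝ, E).prod 𝓘(ℝ, F)))
      𝓘(ℝ, (EP × EP) × (E × F)) K (c z₀) := mdifferentiableAt_extChartAt (mem_chart_source _ _)
  have hKc : MDifferentiableAt IQ 𝓘(ℝ, (EP × EP) × (E × F)) (fun z ↦ K (c z)) z₀ := hKd.comp z₀ hc
  have hp : ContinuousAt p z₀ :=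
    (FiberBundle.continuous_proj EP (TangentSpace IP)).continuousAt.comp
      (continuous_fst.continuousAt.comp hc.continuousAt)
  have hn : ContinuousAt n z₀ :=
    (FiberBundle.continuous_proj F V).continuousAt.comp
      (continuous_snd.continuousAt.comp hc.continuousAt)
  have hev : (fun z ↦ K (c z)) =ᶠ[𝓝 z₀] fun z ↦
      ((extChartAt IP (p z₀) (p z), mvfderiv IP (extChartAt IP (p z₀)) (p z) (v z)),
        (extChartAt 𝓘(ℝ, E) (n z₀) (n z), LieAlgebroid.coord F V (n z₀) (n z) (b z))) := by
    filter_upwards [hp.eventually_mem (extChartAt_source_mem_nhds (I := IP) (p z₀)),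
      hn.eventually_mem ((trivializationAt F V (n z₀)).open_baseSet.mem_nhds
        (mem_baseSet_trivializationAt F V (n z₀)))] with z hz hz'
    have hz1 : p z ∈ (trivializationAt EP (TangentSpace IP) (p z₀)).baseSet := by
      rwa [extChartAt_source] at hz
    rw [hK, extChartAt_prod, FiberBundle.extChartAt, FiberBundle.extChartAt]
    rw [← trivializationAt_tangent_eq_mvfderiv hz, LieAlgebroid.coord_eq hz']
    refine Prod.ext (Prod.ext ?_ rfl) (Prod.ext ?_ rfl)
    · exact congrArg (extChartAt IP (p z₀)) (Trivialization.coe_fst'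
        (trivializationAt EP (TangentSpace IP) (p z₀)) (x := (⟨p z, v z⟩ : TangentBundle IP P)) hz1)
    · exact congrArg (extChartAt 𝓘(ℝ, E) (n z₀)) (Trivialization.coe_fst'
        (trivializationAt F V (n z₀)) (x := (⟨n z, b z⟩ : TotalSpace F V)) hz')
  have hd := hKc.congr_of_eventuallyEq hev.symm
  refine (mvfderiv_extChartAt_self (IP := IP.tangent.prod (𝓘(ℝ, E).prod 𝓘(ℝ, F)))
    (c z₀) _).symm.trans ?_
  rw [← mvfderiv_comp_vec hKd hc, hev.mvfderiv_eq]
  refine Prod.ext (Prod.ext ?_ ?_) (Prod.ext ?_ ?_)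
  · exact (mvfderiv_clm_comp ((ContinuousLinearMap.fst ℝ EP EP).comp
      (ContinuousLinearMap.fst ℝ (EP × EP) (E × F))) hd u).symm
  · exact (mvfderiv_clm_comp ((ContinuousLinearMap.snd ℝ EP EP).comp
      (ContinuousLinearMap.fst ℝ (EP × EP) (E × F))) hd u).symm
  · exact (mvfderiv_clm_comp ((ContinuousLinearMap.fst ℝ E F).comp
      (ContinuousLinearMap.snd ℝ (EP × EP) (E × F))) hd u).symm
  · exact (mvfderiv_clm_comp ((ContinuousLinearMap.snd ℝ E F).comp
      (ContinuousLinearMap.snd ℝ (EP × EP) (E × F))) hd u).symm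

/-- The curve `r ↦ s + r` in `J` has the velocity `∂/∂t`. -/
theorem mfderiv_timeProj_add {J : Opens ℝ} (s : J) {r : ℝ} (hr : s + r ∈ J) :
    MDifferentiableAt 𝓘(ℝ, ℝ) 𝓘(ℝ, ℝ) (fun r : ℝ ↦ timeProj s (s + r)) r ∧
    mfderiv 𝓘(ℝ, ℝ) 𝓘(ℝ, ℝ) (fun r : ℝ ↦ timeProj s (s + r)) r (1 : ℝ) =
      timeUnit (timeProj s (s + r)) := by
  let u : TangentSpace 𝓘(ℝ, ℝ) r := (1 : ℝ)
  have h1 : MDifferentiableAt 𝓘(ℝ, ℝ) 𝓘(ℝ, ℝ) (fun r : ℝ ↦ timeProj s (s + r)) r :=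
    MDifferentiableAt.comp (g := timeProj s) (f := fun r : ℝ ↦ (s : ℝ) + r) r
      ((contMDiffAt_timeProj s hr).mdifferentiableAt (by simp))
      (differentiableAt_id.const_add (s : ℝ)).mdifferentiableAt
  refine ⟨h1, ?_⟩
  have h2 := mvfderiv_extChartAt_self (IP := 𝓘(ℝ, ℝ)) (timeProj s (s + r))
    (mfderiv 𝓘(ℝ, ℝ) 𝓘(ℝ, ℝ) (fun r : ℝ ↦ timeProj s (s + r)) r u)
  rw [extChartAt_opens] at h2
  refine h2.symm.trans ((mvfderiv_comp_vec (f := fun r : ℝ ↦ timeProj s (s + r))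
    (mdifferentiableAt_opens_val _) h1 u).symm.trans ?_)
  have h3 : (fun r : ℝ ↦ ((timeProj s (s + r) : J) : ℝ)) =ᶠ[𝓝 r] fun r ↦ s + r := by
    filter_upwards [(continuous_const.add continuous_id).continuousAt.eventually_mem
      (J.isOpen.mem_nhds hr)] with z hz
    exact congrArg Subtype.val (timeProj_of_mem s hz)
  rw [h3.mvfderiv_eq, mvfderiv_eq_fderiv, fderiv_const_add, fderiv_fun_id]
  rfl

theorem mvfderiv_affine {G : Type*} [NormedAddCommGroup G] [NormedSpace ℝ G] (c d : G) :
    mvfderiv 𝓘(ℝ, ℝ) (fun r : ℝ ↦ c + r • d) 0 (1 : ℝ) = d := by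
  rw [mvfderiv_eq_fderiv]
  have h := ((hasDerivAt_id (0 : ℝ)).smul_const d).const_add c
  rw [one_smul] at h
  change fderiv ℝ (fun r : ℝ ↦ c + r • d) (0 : ℝ) (1 : ℝ) = d
  exact fderiv_apply_one_eq_deriv.trans h.deriv

theorem contMDiffAt_affine {G : Type*} [NormedAddCommGroup G] [NormedSpace ℝ G] (c d : G) :
    ContMDiffAt 𝓘(ℝ, ℝ) 𝓘(ℝ, G) ∞ (fun r : ℝ ↦ c + r • d) 0 :=
  (contDiff_const.add (contDiff_id.smul contDiff_const)).contMDiff.contMDiffAt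

/-- A vertical lift has no component along the base. -/
theorem LieAlgebroid.verticalLift_eq {B : LieAlgebroid 𝓘(ℝ, E) F V} {f : P → N} {x : P}
    (e d : B.pullbackFiber IP f x) : (verticalLift e d : (EP × EP) × (E × F)) =
      ((0, d.1.1), (0, coord F V (f x) (f x) d.1.2)) := by
  have hx := mem_baseSet_trivializationAt F V (f x)
  have h1 : (fun r : ℝ ↦ mvfderiv IP (extChartAt IP x) x (e.1.1 + r • d.1.1)) =
      fun r ↦ (e.1.1 : EP) + r • (d.1.1 : EP) := by
    funext r
    exact mvfderiv_extChartAt_self x _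
  have h2 : (fun r : ℝ ↦ coord F V (f x) (f x) (e.1.2 + r • d.1.2)) =
      fun r ↦ coord F V (f x) (f x) e.1.2 + r • coord F V (f x) (f x) d.1.2 := by
    funext r
    rw [map_add, map_smul]
  have hc : ContMDiffAt 𝓘(ℝ, ℝ) (IP.tangent.prod (𝓘(ℝ, E).prod 𝓘(ℝ, F))) ∞ (fun r : ℝ ↦
      ((⟨x, e.1.1 + r • d.1.1⟩ : TangentBundle IP P),
        (⟨f x, e.1.2 + r • d.1.2⟩ : TotalSpace F V))) 0 := by
    refine ContMDiffAt.prodMk ?_ ?_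
    · refine contMDiffAt_totalSpace.2 ⟨contMDiffAt_const, ?_⟩
      simp only [trivializationAt_tangent_eq_mvfderiv (mem_extChartAt_source x)]
      rw [h1]
      exact contMDiffAt_affine _ _
    · refine (contMDiffAt_iff_coord (f := fun _ ↦ f x) hx).2 ⟨contMDiffAt_const, ?_⟩
      rw [h2]
      exact contMDiffAt_affine _ _
  refine (mfderiv_tangentBundle_prod_totalSpace (hc.mdifferentiableAt (by simp)) (1 : ℝ)).trans ?_
  rw [h1, h2, mvfderiv_const, mvfderiv_const]
  refine Prod.ext (Prod.ext rfl ?_) (Prod.ext rfl ?_)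
  · exact mvfderiv_affine _ _
  · exact mvfderiv_affine _ _

end TotalDerivative

namespace LieAlgebroid

section Flow

variable {E : Type*} [NormedAddCommGroup E] [NormedSpace ℝ E] [FiniteDimensional ℝ E]
  {N : Type*} [TopologicalSpace N] [T2Space N] [ChartedSpace E N] [IsManifold 𝓘(ℝ, E) ∞ N]
  {F : Type*} [NormedAddCommGroup F] [NormedSpace ℝ F] [FiniteDimensional ℝ F]
  {V : N → Type*} [TopologicalSpace (TotalSpace F V)]
  [∀ x, AddCommGroup (V x)] [∀ x, Module ℝ (V x)] [∀ x, TopologicalSpace (V x)]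
  [FiberBundle F V] [VectorBundle ℝ F V] [ContMDiffVectorBundle ∞ F V 𝓘(ℝ, E)]
  {B : LieAlgebroid 𝓘(ℝ, E) F V}
  {E' : Type*} [NormedAddCommGroup E'] [NormedSpace ℝ E'] [FiniteDimensional ℝ E']
  {M : Type*} [TopologicalSpace M] [ChartedSpace E' M] [IsManifold 𝓘(ℝ, E') ∞ M]
  {J : Opens ℝ} {φ : J × M → N} {m : M}
  {y : B.PullbackSection (𝓘(ℝ, ℝ).prod 𝓘(ℝ, E')) φ}

/-! ### The pullbacks at fixed times -/

/-- The embedding `(w, b) ↦ (0, w, b)` of the fibre of the pullback at time `t`. -/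
def IsTimeSection.sliceInclusion (h : IsTimeSection y) (t : J) (m : M) :
    B.pullbackFiber 𝓘(ℝ, E') (fun m ↦ φ (t, m)) m →ₗ[ℝ]
      B.pullbackFiber (𝓘(ℝ, ℝ).prod 𝓘(ℝ, E')) φ (t, m) where
  toFun e := ⟨(tangentPair (t, m) 0 e.1.1, e.1.2),
    (mfderiv_slice_right (h.contMDiff.mdifferentiableAt (by simp)) _).symm.trans e.2⟩
  map_add' _ _ := Subtype.ext (Prod.ext (Prod.ext (add_zero (0 : ℝ)).symm rfl) rfl)
  map_smul' a _ := Subtype.ext (Prod.ext (Prod.ext (mul_zero a).symm rfl) rfl)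

/-- The component `w` of a tangent vector `(a, w)` of `J × M`. -/
def spaceComp {p : J × M} (v : TangentSpace (𝓘(ℝ, ℝ).prod 𝓘(ℝ, E')) p) :
    TangentSpace 𝓘(ℝ, E') p.2 := Prod.snd (α := ℝ) (β := E') v

/-- The component `a` of a tangent vector `(a, w)` of `J × M`. -/
def timeComp {p : J × M} (v : TangentSpace (𝓘(ℝ, ℝ).prod 𝓘(ℝ, E')) p) : ℝ :=
  Prod.fst (α := ℝ) (β := E') v

theorem tangentPair_eq_sub {p : J × M} (v : TangentSpace (𝓘(ℝ, ℝ).prod 𝓘(ℝ, E')) p) :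
    tangentPair p 0 (spaceComp v) = v - timeComp v • timeField J M p := by
  refine Prod.ext ?_ ?_
  · exact ((sub_eq_zero.2 (mul_one (timeComp v)).symm) :
      timeComp v - timeComp v * 1 = 0).symm
  · exact ((congrArg (spaceComp v - ·) (smul_zero (timeComp v))).trans (sub_zero _)).symm

/-- Subtracting the right multiple of `y` from an element of `φ^{!!}B` gives an element of the
pullback at a fixed time. -/
theorem IsTimeSection.mfderiv_spaceComp (h : IsTimeSection y) {p : J × M}
    (e : B.pullbackFiber (𝓘(ℝ, ℝ).prod 𝓘(ℝ, E')) φ p) :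
    mfderiv 𝓘(ℝ, E') 𝓘(ℝ, E) (fun z ↦ φ (p.1, z)) p.2 (spaceComp e.1.1) =
      B.anchor (φ p) (e.1.2 - timeComp e.1.1 • y.snd p) := by
  rw [mfderiv_slice_right (h.contMDiff.mdifferentiableAt (by simp)), tangentPair_eq_sub, map_sub,
    map_smul, map_sub, map_smul, ← mfderiv_timeField h.fst_eq]
  exact congrArg (· - _) e.2

theorem IsTimeSection.hasPullback_slice (h : IsTimeSection y)
    (hφ : B.HasPullback (𝓘(ℝ, ℝ).prod 𝓘(ℝ, E')) φ) (t : J) :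
    B.HasPullback 𝓘(ℝ, E') (fun m ↦ φ (t, m)) := by
  obtain ⟨r, hr⟩ := hφ
  refine ⟨r - 1, fun m ↦ ?_⟩
  have hV : FiniteDimensional ℝ (V (φ (t, m))) := by
    refine FiniteDimensional.of_injective (coord F V (φ (t, m)) (φ (t, m)))
      (coord_injective (mem_baseSet_trivializationAt F V (φ (t, m))))
  have hT : FiniteDimensional ℝ (TangentSpace 𝓘(ℝ, E') m) :=
    inferInstanceAs (FiniteDimensional ℝ E')
  let L : (ℝ × B.pullbackFiber 𝓘(ℝ, E') (fun m ↦ φ (t, m)) m) →ₗ[ℝ]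
      B.pullbackFiber (𝓘(ℝ, ℝ).prod 𝓘(ℝ, E')) φ (t, m) :=
    (LinearMap.toSpanSingleton ℝ _ (y.toFun (t, m))).coprod (h.sliceInclusion t m)
  have hL : ∀ a e, L (a, e) = a • y.toFun (t, m) + h.sliceInclusion t m e := fun a e ↦ rfl
  have hinj : Function.Injective L := by
    rw [← LinearMap.ker_eq_bot, LinearMap.ker_eq_bot']
    rintro ⟨a, e⟩ hae
    rw [hL] at hae
    have h1 : a * timeComp (y.fst (t, m)) + 0 = 0 := congrArg
      (fun e : B.pullbackFiber (𝓘(ℝ, ℝ).prod 𝓘(ℝ, E')) φ (t, m) ↦ timeComp e.1.1) hae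
    rw [h.fst_eq] at h1
    obtain rfl : a = 0 := by
      change a * 1 + 0 = 0 at h1
      rwa [mul_one, add_zero] at h1
    rw [zero_smul, zero_add] at hae
    have h2 : e = 0 := Subtype.ext (Prod.ext
      (congrArg (fun e : B.pullbackFiber (𝓘(ℝ, ℝ).prod 𝓘(ℝ, E')) φ (t, m) ↦ spaceComp e.1.1) hae)
      (congrArg (fun e : B.pullbackFiber (𝓘(ℝ, ℝ).prod 𝓘(ℝ, E')) φ (t, m) ↦ e.1.2) hae))
    rw [h2]
    rfl
  have hsurj : Function.Surjective L := fun e ↦ by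
    refine ⟨(timeComp e.1.1, ⟨(spaceComp e.1.1, e.1.2 - timeComp e.1.1 • y.snd (t, m)),
      h.mfderiv_spaceComp e⟩), ?_⟩
    rw [hL]
    refine Subtype.ext (Prod.ext ?_ ?_)
    · change timeComp e.1.1 • y.fst (t, m) + tangentPair (t, m) 0 (spaceComp e.1.1) = e.1.1
      rw [tangentPair_eq_sub, h.fst_eq, add_sub_cancel]
    · change timeComp e.1.1 • y.snd (t, m) + (e.1.2 - timeComp e.1.1 • y.snd (t, m)) = e.1.2
      rw [add_sub_cancel]
  have h3 := (LinearEquiv.ofBijective L ⟨hinj, hsurj⟩).finrank_eq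
  rw [hr, Module.finrank_prod, Module.finrank_self] at h3
  rw [← h3]
  exact (Nat.add_sub_cancel_left _ _).symm

/-! ### The linear vector field of the derivation `[y, ·]` -/

/-- The integral curve, parametrized by the time, of the linear vector field of `[y, ·]` through
the element `(v, b)` of the fibre over `x`. It is the sum of a multiple of `y`, which is flat, and
a curve of elements of the pullbacks at fixed times, which is given by parallel transport. -/
def flowCurve (y : B.PullbackSection (𝓘(ℝ, ℝ).prod 𝓘(ℝ, E')) φ) (x : J × M)
    (v : TangentSpace (𝓘(ℝ, ℝ).prod 𝓘(ℝ, E')) x) (b : V (φ x)) (r : J) :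
    TangentBundle (𝓘(ℝ, ℝ).prod 𝓘(ℝ, E')) (J × M) × TotalSpace F V :=
  (⟨(r, x.2), tangentPair (r, x.2) (timeComp v) (spaceComp v)⟩,
    ⟨φ (r, x.2), timeComp v • y.snd (r, x.2) +
      transport y x.1 r x.2 (spaceComp v) (b - timeComp v • y.snd x)⟩)

open Classical in
/-- The linear vector field of the derivation `[y, ·]`. Only its values at the points of `φ^{!!}B`
are meaningful. -/
def flowField (y : B.PullbackSection (𝓘(ℝ, ℝ).prod 𝓘(ℝ, E')) φ)
    (q : TangentBundle (𝓘(ℝ, ℝ).prod 𝓘(ℝ, E')) (J × M) × TotalSpace F V) :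
    TangentSpace ((𝓘(ℝ, ℝ).prod 𝓘(ℝ, E')).tangent.prod (𝓘(ℝ, E).prod 𝓘(ℝ, F))) q :=
  id (mfderiv 𝓘(ℝ, ℝ) ((𝓘(ℝ, ℝ).prod 𝓘(ℝ, E')).tangent.prod (𝓘(ℝ, E).prod 𝓘(ℝ, F)))
    (flowCurve y q.1.proj q.1.2 (if hq : q.2.proj = φ q.1.proj then hq ▸ q.2.2 else 0))
    q.1.proj.1 (timeUnit q.1.proj.1) : ((ℝ × E') × (ℝ × E')) × (E × F))

theorem flowField_mk (x : J × M) (v : TangentSpace (𝓘(ℝ, ℝ).prod 𝓘(ℝ, E')) x) (b : V (φ x)) :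
    (flowField y (⟨x, v⟩, ⟨φ x, b⟩) : ((ℝ × E') × (ℝ × E')) × (E × F)) =
      mfderiv 𝓘(ℝ, ℝ) ((𝓘(ℝ, ℝ).prod 𝓘(ℝ, E')).tangent.prod (𝓘(ℝ, E).prod 𝓘(ℝ, F)))
        (flowCurve y x v b) x.1 (timeUnit x.1) :=
  congrArg (fun b ↦ (id (mfderiv 𝓘(ℝ, ℝ) ((𝓘(ℝ, ℝ).prod 𝓘(ℝ, E')).tangent.prod
    (𝓘(ℝ, E).prod 𝓘(ℝ, F))) (flowCurve y x v b) x.1 (timeUnit x.1)) :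
      ((ℝ × E') × (ℝ × E')) × (E × F))) (dif_pos rfl)

theorem IsTimeSection.contMDiff_flowCurve (h : IsTimeSection y) {x : J × M}
    (e : B.pullbackFiber (𝓘(ℝ, ℝ).prod 𝓘(ℝ, E')) φ x) :
    ContMDiff 𝓘(ℝ, ℝ) ((𝓘(ℝ, ℝ).prod 𝓘(ℝ, E')).tangent.prod (𝓘(ℝ, E).prod 𝓘(ℝ, F))) ∞
      (flowCurve y x e.1.1 e.1.2) := by
  intro r
  have hx : ContMDiff 𝓘(ℝ, ℝ) (𝓘(ℝ, ℝ).prod 𝓘(ℝ, E')) ∞ (fun r : J ↦ (r, x.2)) :=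
    contMDiff_id.prodMk contMDiff_const
  refine ContMDiffAt.prodMk ?_ ?_
  · obtain ⟨X, hX, hX'⟩ := exists_vectorField x.2 (spaceComp e.1.1)
    have h1 := contMDiffAt_prod_vectorField (x := (r, x.2)) (a := fun _ ↦ timeComp e.1.1)
      (w := fun p ↦ X p.2) contMDiffAt_const
      ((contMDiffAt_mvfderiv_extChartAt hX').comp (r, x.2) contMDiffAt_snd)
    have h2 := h1.comp r hx.contMDiffAt
    change ContMDiffAt 𝓘(ℝ, ℝ) (𝓘(ℝ, ℝ).prod 𝓘(ℝ, E')).tangent ∞ (fun r : J ↦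
      (⟨(r, x.2), tangentPair (r, x.2) (timeComp e.1.1) (spaceComp (p := x) e.1.1)⟩ :
        TangentBundle (𝓘(ℝ, ℝ).prod 𝓘(ℝ, E')) (J × M))) r
    rw [← hX]
    exact h2
  · have hr := mem_baseSet_trivializationAt F V (φ (r, x.2))
    have h1 : ContMDiffAt 𝓘(ℝ, ℝ) (𝓘(ℝ, E).prod 𝓘(ℝ, F)) ∞ (fun r ↦ (⟨φ (r, x.2),
        transport y x.1 r x.2 (spaceComp e.1.1) (e.1.2 - timeComp e.1.1 • y.snd x)⟩ :
          TotalSpace F V)) r :=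
      h.contMDiffWithinAt_transport (S := Set.univ) (τ := fun _ ↦ x.1) (τ' := fun r ↦ r)
        (μ := fun _ ↦ x.2) (w := fun _ ↦ spaceComp e.1.1)
        (b := fun _ ↦ e.1.2 - timeComp e.1.1 • y.snd x) (Set.mem_univ r) contMDiffWithinAt_const
        contMDiffWithinAt_const contMDiffWithinAt_id contMDiffWithinAt_const
        (fun _ _ ↦ h.mfderiv_spaceComp e)
    have h2 : ContMDiffAt 𝓘(ℝ, ℝ) (𝓘(ℝ, E).prod 𝓘(ℝ, F)) ∞ (fun r ↦ (⟨φ (r, x.2),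
        y.snd (r, x.2)⟩ : TotalSpace F V)) r := (y.contMDiff_snd.comp hx).contMDiffAt
    rw [contMDiffAt_iff_coord (f := fun r ↦ φ (r, x.2)) hr] at h1 h2
    refine (contMDiffAt_iff_coord (f := fun r ↦ φ (r, x.2)) hr).2 ⟨h1.1, ?_⟩
    simp only [map_add, map_smul]
    exact ((timeComp e.1.1 • ContinuousLinearMap.id ℝ F).contMDiff.contMDiffAt.comp r h2.2).add h1.2

/-- The velocity of the flow satisfies the equation that characterizes the linear vector field of
the derivation `[y, ·]`. -/
theorem IsTimeSection.isLinearVectorField_flowField (h : IsTimeSection y) [CompleteSpace E'] :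
    IsLinearVectorField (fun e ↦ y.bracket e h.contMDiff) y.fst (flowField y) := by
  intro e x
  have hx := mem_frameNhd_self (E := E) (F := F) (V := V) (φ x)
  have hxb := frameNhd_subset_baseSet (E := E) (φ x) hx
  have hm : x.2 ∈ (extChartAt 𝓘(ℝ, E') x.2).source := mem_extChartAt_source x.2
  have hYd : MDifferentiableAt (𝓘(ℝ, ℝ).prod 𝓘(ℝ, E')) 𝓘(ℝ, F) (y.sndCoord (φ x)) x :=
    (y.contMDiffAt_sndCoord hx).mdifferentiableAt (by simp)
  have hsl : MDifferentiableAt 𝓘(ℝ, ℝ) (𝓘(ℝ, ℝ).prod 𝓘(ℝ, E')) (fun r : J ↦ (r, x.2)) x.1 :=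
    mdifferentiableAt_slice_left x.1 x.2
  set a := timeComp (e.fst x) with ha
  set w := spaceComp (e.fst x) with hw
  have h1 := mfderiv_tangentBundle_prod_totalSpace (IP := 𝓘(ℝ, ℝ).prod 𝓘(ℝ, E')) (F := F)
    (p := fun r : J ↦ (r, x.2)) (v := fun r ↦ tangentPair (r, x.2) a w)
    (n := fun r ↦ φ (r, x.2)) (b := fun r ↦ a • y.snd (r, x.2) +
      transport y x.1 r x.2 w (e.snd x - a • y.snd x))
    ((h.contMDiff_flowCurve (e.toFun x)).mdifferentiableAt (x := x.1) (by simp)) (timeUnit x.1)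
  have h2 := mfderiv_tangentBundle_prod_totalSpace (IP := 𝓘(ℝ, ℝ).prod 𝓘(ℝ, E')) (F := F)
    (p := fun z : J × M ↦ z) (v := e.fst) (n := φ) (b := e.snd)
    (e.contMDiff_toFun.mdifferentiableAt (x := x) (by simp)) (y.fst x)
  have h3 := verticalLift_eq (e.toFun x) (-(y.bracket e h.contMDiff).toFun x)
  refine (flowField_mk x (e.fst x) (e.snd x)).trans (h1.trans (Eq.trans ?_ (congrArg₂
    (fun u v : ((ℝ × E') × (ℝ × E')) × (E × F) ↦ u + v) h2 h3).symm))
  -- The components belong to the base point in `J × M`, the tangent vector, the base point in `N`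
  -- and the vector of the fibre of `B`.
  refine Prod.ext (Prod.ext ?_ ?_) (Prod.ext ?_ ?_)
  · have e1 : MDifferentiableAt (𝓘(ℝ, ℝ).prod 𝓘(ℝ, E')) 𝓘(ℝ, ℝ × E')
        (extChartAt (𝓘(ℝ, ℝ).prod 𝓘(ℝ, E')) x) x := mdifferentiableAt_extChartAt (mem_chart_source _ _)
    refine (mvfderiv_slice_left (t := x.1) (m := x.2) e1).trans ?_
    rw [h.fst_eq]
    exact (add_zero _).symm
  · have e1 : (fun r : J ↦ mvfderiv (𝓘(ℝ, ℝ).prod 𝓘(ℝ, E'))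
        (extChartAt (𝓘(ℝ, ℝ).prod 𝓘(ℝ, E')) x) (r, x.2) (tangentPair (r, x.2) a w)) =
        fun _ ↦ (a, mvfderiv 𝓘(ℝ, E') (extChartAt 𝓘(ℝ, E') x.2) x.2 w) := by
      funext r
      exact mvfderiv_extChartAt_prod (p := (r, x.2)) hm a w
    have e2 := mlieBracket_eq_mvfderiv_sub (y.contMDiff_fst x) (e.contMDiff_fst x)
    have e3 : (fun z ↦ mvfderiv (𝓘(ℝ, ℝ).prod 𝓘(ℝ, E')) (extChartAt (𝓘(ℝ, ℝ).prod 𝓘(ℝ, E')) x) z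
        (y.fst z)) =ᶠ[𝓝 x] fun _ ↦ ((1, 0) : ℝ × E') := by
      filter_upwards [mvfderiv_extChartAt_timeField (E' := E') x] with z hz
      rw [h.fst_eq, hz]
    rw [e3.mvfderiv_eq, mvfderiv_const] at e2
    have e4 := congrArg (fun g : J → ℝ × E' ↦ mvfderiv 𝓘(ℝ, ℝ) g x.1 (timeUnit x.1)) e1
    refine e4.trans ?_
    simp only [mvfderiv_const]
    refine Eq.trans ?_ (congrArg (fun v : ℝ × E' ↦ mvfderiv (𝓘(ℝ, ℝ).prod 𝓘(ℝ, E')) (fun z ↦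
      mvfderiv (𝓘(ℝ, ℝ).prod 𝓘(ℝ, E')) (extChartAt (𝓘(ℝ, ℝ).prod 𝓘(ℝ, E')) x) z (e.fst z)) x
        (y.fst x) + -v) e2).symm
    refine ((congrArg (_ + -·) (sub_zero _)).trans (add_neg_cancel _)).symm
  · have e1 : MDifferentiableAt (𝓘(ℝ, ℝ).prod 𝓘(ℝ, E')) 𝓘(ℝ, E)
        (fun z ↦ extChartAt 𝓘(ℝ, E) (φ x) (φ z)) x :=
      (mdifferentiableAt_extChartAt (mem_chart_source _ _)).comp x
        (h.contMDiff.mdifferentiableAt (by simp))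
    refine (mvfderiv_slice_left (t := x.1) (m := x.2) e1).trans ?_
    rw [h.fst_eq]
    exact (add_zero _).symm
  · have hadm := h.mfderiv_spaceComp (e.toFun x)
    obtain ⟨e1, e2⟩ := (h.isFlatAt_transport hadm x.1).2 (φ x) hx
    have e3 : MDifferentiableAt 𝓘(ℝ, ℝ) 𝓘(ℝ, F) (fun r : J ↦ y.sndCoord (φ x) (r, x.2)) x.1 :=
      MDifferentiableAt.comp (g := y.sndCoord (φ x)) (f := fun r : J ↦ (r, x.2)) x.1 hYd hsl
    have e4 : (fun r : J ↦ coord F V (φ x) (φ (r, x.2)) (a • y.snd (r, x.2) +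
        transport y x.1 r x.2 w (e.snd x - a • y.snd x))) = fun r ↦
        (a • ContinuousLinearMap.id ℝ F) (y.sndCoord (φ x) (r, x.2)) +
          coord F V (φ x) (φ (r, x.2))
            (transport y x.1 r x.2 w (e.snd x - a • y.snd x)) := by
      funext r
      rw [map_add, map_smul]
      rfl
    have e5 : MDifferentiableAt 𝓘(ℝ, ℝ) 𝓘(ℝ, F)
        (fun r : J ↦ (a • ContinuousLinearMap.id ℝ F) (y.sndCoord (φ x) (r, x.2))) x.1 :=
      (a • ContinuousLinearMap.id ℝ F).differentiableAt.mdifferentiableAt.comp x.1 e3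
    have e6 : coord F V (φ x) (φ x) (transport y x.1 x.1 x.2 w (e.snd x - a • y.snd x)) =
        e.sndCoord (φ x) x - a • y.sndCoord (φ x) x := by
      refine (congrArg _ (h.transport_self hadm)).trans ?_
      rw [map_sub, map_smul]
      rfl
    have e8 : B.structureMap (φ x) (φ x) (y.sndCoord (φ x) x) (y.sndCoord (φ x) x) = 0 := by
      have e7 := B.structureMap_swap (φ x) (φ x) (y.sndCoord (φ x) x) (y.sndCoord (φ x) x)
      rw [eq_neg_iff_add_eq_zero, ← two_smul ℝ] at e7
      exact (smul_eq_zero.1 e7).resolve_left two_ne_zero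
    have e9 : coord F V (φ x) (φ x) ((y.bracket e h.contMDiff).snd x) =
      y.bracketCoord e (φ x) x := coord_frameVec hxb _
    have e10 : e.fst x = a • timeField J M x + tangentPair x 0 w := by
      rw [hw, tangentPair_eq_sub, add_sub_cancel]
    have e11 := congrArg (fun g : J → F ↦ mvfderiv 𝓘(ℝ, ℝ) g x.1 (timeUnit x.1)) e4
    refine e11.trans ?_
    refine (congrFun (congrArg DFunLike.coe (mvfderiv_fun_add e5 e1)) (timeUnit x.1)).trans ?_
    have e12 := (mvfderiv_clm_comp (a • ContinuousLinearMap.id ℝ F) e3 (timeUnit x.1)).trans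
      (congrArg (a • ContinuousLinearMap.id ℝ F) (mvfderiv_slice_left (t := x.1) (m := x.2) hYd))
    refine (congrArg₂ (· + ·) e12 e2).trans ?_
    have e13 : coord F V (φ x) (φ x) ((-(y.bracket e h.contMDiff).toFun x).1.2) =
      -y.bracketCoord e (φ x) x := (map_neg _ _).trans (congrArg _ e9)
    refine Eq.trans ?_ (congrArg (mvfderiv (𝓘(ℝ, ℝ).prod 𝓘(ℝ, E')) (e.sndCoord (φ x)) x (y.fst x)
      + ·) e13).symm
    rw [PullbackSection.bracketCoord, e10, map_add, map_smul]
    have e14 : B.structureMap (φ x) (φ x) (y.sndCoord (φ x) x)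
        (coord F V (φ x) (φ x) (transport y x.1 x.1 x.2 w (e.snd x - a • y.snd x))) =
        B.structureMap (φ x) (φ x) (y.sndCoord (φ x) x) (e.sndCoord (φ x) x) := by
      rw [e6, map_sub, map_smul, e8, smul_zero, sub_zero]
    refine (congrArg (fun v : F ↦ a • mvfderiv (𝓘(ℝ, ℝ).prod 𝓘(ℝ, E')) (y.sndCoord (φ x)) x
      (timeField J M x) + (mvfderiv (𝓘(ℝ, ℝ).prod 𝓘(ℝ, E')) (y.sndCoord (φ x)) x
        (tangentPair x 0 w) - v)) e14).trans ?_
    abel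

/-- Curves in the pullbacks at fixed times that are given by parallel transport are integral curves
of the linear vector field of `[y, ·]`. -/
theorem IsTimeSection.isMIntegralCurveOn_flowField (h : IsTimeSection y) (s : J)
    (w : TangentSpace 𝓘(ℝ, E') m) (b : V (φ (s, m)))
    (hb : mfderiv 𝓘(ℝ, E') 𝓘(ℝ, E) (fun z ↦ φ (s, z)) m w = B.anchor (φ (s, m)) b) :
    IsMIntegralCurveOn (I := (𝓘(ℝ, ℝ).prod 𝓘(ℝ, E')).tangent.prod (𝓘(ℝ, E).prod 𝓘(ℝ, F)))
      (fun r : ℝ ↦ ((⟨(timeProj s (s + r), m), tangentPair (timeProj s (s + r), m) 0 w⟩ :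
          TangentBundle (𝓘(ℝ, ℝ).prod 𝓘(ℝ, E')) (J × M)),
        (⟨φ (timeProj s (s + r), m), transport y s (timeProj s (s + r)) m w b⟩ : TotalSpace F V)))
      (flowField y) {r : ℝ | s + r ∈ J} := by
  intro r hr
  set c : J → TangentBundle (𝓘(ℝ, ℝ).prod 𝓘(ℝ, E')) (J × M) × TotalSpace F V := fun t ↦
    (⟨(t, m), tangentPair (t, m) 0 w⟩, ⟨φ (t, m), transport y s t m w b⟩) with hc
  have hflow : ∀ t : J, flowCurve y (t, m) (tangentPair (t, m) 0 w) (transport y s t m w b) = c := by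
    intro t
    funext r
    refine Prod.ext rfl (congrArg (TotalSpace.mk (φ (r, m))) ?_)
    change (0 : ℝ) • y.snd (r, m) + transport y t r m w (transport y s t m w b -
      (0 : ℝ) • y.snd (t, m)) = transport y s r m w b
    rw [zero_smul, zero_smul, sub_zero, zero_add, h.transport_transport hb]
  obtain ⟨h1, h2⟩ := mfderiv_timeProj_add s hr
  set t := timeProj s (s + r)
  have hcd : MDifferentiableAt 𝓘(ℝ, ℝ) ((𝓘(ℝ, ℝ).prod 𝓘(ℝ, E')).tangent.prod
      (𝓘(ℝ, E).prod 𝓘(ℝ, F))) c t := by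
    have h3 := h.contMDiff_flowCurve (x := (s, m)) (h.sliceInclusion s m ⟨(w, b), hb⟩)
    have h4 := hflow s
    rw [h.transport_self hb] at h4
    exact (h4 ▸ h3 : ContMDiff 𝓘(ℝ, ℝ) ((𝓘(ℝ, ℝ).prod 𝓘(ℝ, E')).tangent.prod
      (𝓘(ℝ, E).prod 𝓘(ℝ, F))) ∞ c).mdifferentiableAt (by simp)
  have h5 := (hcd.hasMFDerivAt.comp r h1.hasMFDerivAt).hasMFDerivWithinAt
    (s := {r : ℝ | s + r ∈ J})
  refine h5.congr_mfderiv ?_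
  refine ContinuousLinearMap.ext_ring ?_
  refine (congrArg (mfderiv 𝓘(ℝ, ℝ) ((𝓘(ℝ, ℝ).prod 𝓘(ℝ, E')).tangent.prod
      (𝓘(ℝ, E).prod 𝓘(ℝ, F))) c t) h2).trans ?_
  refine Eq.trans ?_ (one_smul ℝ _).symm
  refine Eq.trans ?_ (flowField_mk (t, m) (tangentPair (t, m) 0 w) (transport y s t m w b)).symm
  rw [hflow]

end Flow

end LieAlgebroid

end

theorem proposition3p15
    {E : Type*} [NormedAddCommGroup E] [NormedSpace ℝ E] [FiniteDimensional ℝ E]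
    {N : Type*} [TopologicalSpace N] [T2Space N] [SecondCountableTopology N]
    [ChartedSpace E N] [IsManifold 𝓘(ℝ, E) ∞ N]
    {F : Type*} [NormedAddCommGroup F] [NormedSpace ℝ F] [FiniteDimensional ℝ F]
    {V : N → Type*} [TopologicalSpace (TotalSpace F V)]
    [∀ x, AddCommGroup (V x)] [∀ x, Module ℝ (V x)] [∀ x, TopologicalSpace (V x)]
    [FiberBundle F V] [VectorBundle ℝ F V] [ContMDiffVectorBundle ∞ F V 𝓘(ℝ, E)]
    (B : LieAlgebroid 𝓘(ℝ, E) F V)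
    {E' : Type*} [NormedAddCommGroup E'] [NormedSpace ℝ E'] [FiniteDimensional ℝ E']
    {M : Type*} [TopologicalSpace M] [T2Space M] [SecondCountableTopology M]
    [ChartedSpace E' M] [IsManifold 𝓘(ℝ, E') ∞ M]
    (J : Opens ℝ) (hJ : (J : Set ℝ).OrdConnected)
    (φ : J × M → N) (hφ : ContMDiff (𝓘(ℝ, ℝ).prod 𝓘(ℝ, E')) 𝓘(ℝ, E) ∞ φ)
    (hpull : B.HasPullback (𝓘(ℝ, ℝ).prod 𝓘(ℝ, E')) φ)
    (y : B.PullbackSection (𝓘(ℝ, ℝ).prod 𝓘(ℝ, E')) φ)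
    (hy : ∀ p, y.fst p = ((1, 0) : ℝ × E')) :
    (∀ t : J, B.HasPullback 𝓘(ℝ, E') (fun m ↦ φ (t, m))) ∧
    ∃ (D : B.PullbackSection (𝓘(ℝ, ℝ).prod 𝓘(ℝ, E')) φ →
          B.PullbackSection (𝓘(ℝ, ℝ).prod 𝓘(ℝ, E')) φ)
      (χ : ∀ q : TangentBundle (𝓘(ℝ, ℝ).prod 𝓘(ℝ, E')) (J × M) × TotalSpace F V,
        TangentSpace ((𝓘(ℝ, ℝ).prod 𝓘(ℝ, E')).tangent.prod (𝓘(ℝ, E).prod 𝓘(ℝ, F))) q)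
      (Ψ : ∀ s t : J, B.PullbackIso 𝓘(ℝ, E') (fun m ↦ φ (s, m)) (fun m ↦ φ (t, m))),
      (∀ e, LieAlgebroid.IsPullbackBracket y e (D e)) ∧
      LieAlgebroid.IsLinearVectorField D y.fst χ ∧
      ∀ (s : J) (m : M) (e : B.pullbackFiber 𝓘(ℝ, E') (fun m ↦ φ (s, m)) m),
        ∃ γ : ℝ → TangentBundle (𝓘(ℝ, ℝ).prod 𝓘(ℝ, E')) (J × M) × TotalSpace F V,
          γ 0 = (⟨(s, m), ((0, e.1.1) : ℝ × E')⟩, ⟨φ (s, m), e.1.2⟩) ∧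
          IsMIntegralCurveOn γ χ {r : ℝ | s + r ∈ J} ∧
          ∀ t : J, γ (t - s) =
            (⟨(t, m), ((0, ((Ψ s t).toEquiv m e).1.1) : ℝ × E')⟩,
              ⟨φ (t, m), ((Ψ s t).toEquiv m e).1.2⟩) := by
  have : CompleteSpace E' := FiniteDimensional.complete ℝ E'
  have h : LieAlgebroid.IsTimeSection y := ⟨hJ, hφ, hy⟩
  refine ⟨h.hasPullback_slice hpull, fun e ↦ y.bracket e hφ, LieAlgebroid.flowField y,
    h.transportIso, fun e ↦ y.isPullbackBracket_bracket e hφ, h.isLinearVectorField_flowField,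
    fun s m e ↦ ⟨_, ?_, h.isMIntegralCurveOn_flowField s e.1.1 e.1.2 e.2, fun t ↦ ?_⟩⟩
  · have h1 : timeProj s ((s : ℝ) + 0) = s := by rw [add_zero, timeProj_coe]
    refine (congrArg (fun t : J ↦ ((⟨(t, m), tangentPair (t, m) 0 e.1.1⟩ :
      TangentBundle (𝓘(ℝ, ℝ).prod 𝓘(ℝ, E')) (J × M)),
        (⟨φ (t, m), LieAlgebroid.transport y s t m e.1.1 e.1.2⟩ : TotalSpace F V))) h1).trans ?_
    exact Prod.ext rfl (congrArg (TotalSpace.mk (φ (s, m))) (h.transport_self e.2))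
  · have h1 : timeProj s ((s : ℝ) + (t - s)) = t := by rw [add_sub_cancel, timeProj_coe]
    exact congrArg (fun t : J ↦ ((⟨(t, m), tangentPair (t, m) 0 e.1.1⟩ :
      TangentBundle (𝓘(ℝ, ℝ).prod 𝓘(ℝ, E')) (J × M)),
        (⟨φ (t, m), LieAlgebroid.transport y s t m e.1.1 e.1.2⟩ : TotalSpace F V))) h1
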